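/- Let $d\ge 1$, let $H$ be a (real or complex) Hilbert space and let $2\le p<\infty$. Let $K=K(t,s,x)$ be a measurable scalar (real or complex, matching $H$) function on $\mathbb R\times\mathbb R\times\mathbb R^d$. Derivatives of $K$ are understood in the weak (distributional) sense: $D_xK(t,s,\cdot)$ on $\mathbb R^d$, $D_x^2K(t,s,\cdot)$ on $\mathbb R^d\setminus\{0\}$, and, for each $s$, $\partial_tK(\cdot,s,\cdot)$ and $\partial_tD_xK(\cdot,s,\cdot)$ on $(s,\infty)\times\mathbb R^d$ (as usual, a function and its weak derivative are locally integrable on the open set considered); $\mathcal F(u)(\xi)=\int_{\mathbb R^d}e^{-ix\cdot\xi}u(x)\,dx$, extended to tempered distributions; and $a\wedge b=\min\{a,b\}$. Suppose the following two assumptions hold. **Assumption 1.** For every $s$ and almost every $t>s$, $K(t,s,\cdot)$ defines a tempered distribution (in the sense that $(1+|x|)^{-k}K(t,s,x)$ is integrable in $x$ for some $k\in\mathbb N$) whose Fourier transform is a locally integrable function, with a version measurable in $(t,s,\xi)$, and there is a constant $C_0$ such that for every $s$ and almost every $\xi$ $$\int_s^\infty |\mathcal F\{K(t,s,\cdot)\}(\xi)|^2\,dt\le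 C_0 .$$ **Assumption 2.** Let $c_2>\tfrac12$ be a constant and put $c_3:=\dfrac{2(d+1)(c_2+1)+3}{2(d+2)}$. (i) For almost all $t$ and each $s<t$, the functions $K(t,s,\cdot)$, $D_xK(t,s,\cdot)$ and $\partial_tK(t,s,\cdot)$ are locally integrable on $\mathbb R^d$. (ii) There exist real functions $F_i(t,s,x)$, measurable in $x$, and positive constants $\sigma_i,\kappa_i$ $(i=1,2,3)$ and $C$ such that for almost all $t$, each $s<t$ and almost every $x\in\mathbb R^d$, all partial derivatives of the indicated order satisfy $$|D_xK(t,s,x)|\le C(t-s)^{-\sigma_1}\big|F_1(t,s,(t-s)^{-\kappa_1}x)\big|,$$ $$|D_x^2K(t,s,x)|\le C\Big((t-s)^{-\sigma_2}\big|F_2(t,s,(t-s)^{-\kappa_2}x)\big|\wedge(t-s)^{-c_2}\Big),$$ $$|\partial_tD_xK(t,s,x)|\le C\Big((t-s)^{-\sigma_3}\big|F_3(t,s,(t-s)^{-\kappa_3}x)\big|\wedge(t-s)^{-c_3}\Big).$$ (iii) There are $\mu_1,\mu_2,\mu_3>d+2$ with $$\sup_{s<t}\int_{\mathbb R^d}|x|^{\mu_1}|F_1(t,s,x)|^2dx<\infty,\qquad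 \sup_{s<t}\int_{|x|\ge (t-s)^{c_2-c_3+1-\kappa_i}}|x|^{\mu_i}|F_i(t,s,x)|^2dx<\infty\quad(i=2,3),$$ and $$(c_2-c_3+1-\kappa_1)\mu_1=d(\kappa_1+c_2-c_3+1)+2(c_2-c_3-\sigma_1)+3,$$ $$(c_2-c_3+1-\kappa_2)\mu_2=d(\kappa_2-c_2+c_3-1)+2(c_2-\sigma_2),$$ $$(c_2-c_3+1-\kappa_3)\mu_3=d(\kappa_3-c_2+c_3-1)+2(c_3-\sigma_3).$$ Then there is a constant $N<\infty$ such that for every $f\in C_0^\infty(\mathbb R^{d+1},H)$ (infinitely differentiable with compact support) the function $$\mathcal Gf(t,x)=\Big(\int_{-\infty}^t|K(t,s,\cdot)*f(s,\cdot)(x)|_H^2\,ds\Big)^{1/2}\in[0,\infty]$$ is (Lebesgue) measurable on $\mathbb R^{d+1}$ and $$\|\mathcal Gf\|_{L_p(\mathbb R^{d+1})}\le N\,\||f|_H\|_{L_p(\mathbb R^{d+1})} .$$ -/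

import Mathlib

open MeasureTheory Set
open scoped ENNReal NNReal ContDiff FourierTransform Convolution

noncomputable section

namespace LittlewoodPaley

/-- `g` is the weak (distributional) derivative of `u` in the direction `v` on the open set `Ω`:
both functions are locally integrable on `Ω` and
`∫ u ∂_v φ = - ∫ g φ` for every real test function `φ ∈ C_c^∞(Ω)`. -/
structure HasWeakDerivOn {𝕜 V : Type*} [RCLike 𝕜] [NormedAddCommGroup V] [NormedSpace ℝ V]
    [MeasureSpace V] (Ω : Set V) (v : V) (u g : V → 𝕜) : Prop where
  locallyIntegrableOn : LocallyIntegrableOn u Ω volume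
  locallyIntegrableOn_deriv : LocallyIntegrableOn g Ω volume
  integral_eq : ∀ φ : V → ℝ, ContDiff ℝ ∞ φ → HasCompactSupport φ → tsupport φ ⊆ Ω →
    ∫ x, (fderiv ℝ φ x v) • u x = - ∫ x, φ x • g x

/-- The function `u` on `ℝ^d` is a tempered distribution, and its distributional Fourier
transform, with the normalisation `û(ξ) = ∫ e^{-i x·ξ} u(x) dx`, is the locally integrable
function `uhat`.  (With this normalisation the transform of a test function `φ` at the point `x` is
Mathlib's `𝓕 φ` at `x / (2π)`.)  For integrable `u` this is the usual Fourier transform. -/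
structure HasFourierTransform {𝕜 : Type*} [RCLike 𝕜] {d : ℕ}
    (u : EuclideanSpace ℝ (Fin d) → 𝕜) (uhat : EuclideanSpace ℝ (Fin d) → ℂ) : Prop where
  tempered : ∃ k : ℕ, Integrable (fun x => ((1 + ‖x‖) ^ k)⁻¹ • u x) volume
  locallyIntegrable : LocallyIntegrable uhat volume
  integral_eq : ∀ φ : EuclideanSpace ℝ (Fin d) → ℂ, ContDiff ℝ ∞ φ → HasCompactSupport φ →
    ∫ x, RCLike.map 𝕜 ℂ (u x) * 𝓕 φ ((2 * Real.pi)⁻¹ • x) = ∫ ξ, uhat ξ * φ ξ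

/-- The first assumption on the kernel: `K(t,s,x)` is measurable on `ℝ^{d+2}` and
`∫_s^∞ |F{K(t,s,·)}(ξ)|² dt ≤ C₀` with `C₀` independent of `(s, ξ)`.  Here `Khat` is a measurable
version of the Fourier transform in `x`, which for fixed `(t, s)` is determined up to null sets. -/
def FourierBound {𝕜 : Type*} [RCLike 𝕜] {d : ℕ}
    (K : ℝ → ℝ → EuclideanSpace ℝ (Fin d) → 𝕜) : Prop :=
  Measurable (fun z : ℝ × ℝ × EuclideanSpace ℝ (Fin d) => K z.1 z.2.1 z.2.2) ∧
  ∃ (Khat : ℝ → ℝ → EuclideanSpace ℝ (Fin d) → ℂ) (C₀ : ℝ≥0),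
    Measurable (fun z : ℝ × ℝ × EuclideanSpace ℝ (Fin d) => Khat z.1 z.2.1 z.2.2) ∧
    (∀ s, ∀ᵐ t ∂(volume.restrict (Ioi s)), HasFourierTransform (K t s) (Khat t s)) ∧
    ∀ s, ∀ᵐ ξ, ∫⁻ t in Ioi s, ‖Khat t s ξ‖ₑ ^ 2 ≤ C₀

/-- The family `DK`, `D2K`, `dtK`, `dtDK` consists of the weak derivatives
`∂_i K`, `∂_j ∂_i K`, `∂_t K`, `∂_t ∂_i K` of the kernel `K(t,s,x)` on `{s < t}`; the second
derivatives in `x` are only considered away from `x = 0`. -/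
structure IsKernelDerivatives {𝕜 : Type*} [RCLike 𝕜] {d : ℕ}
    (K : ℝ → ℝ → EuclideanSpace ℝ (Fin d) → 𝕜)
    (DK : Fin d → ℝ → ℝ → EuclideanSpace ℝ (Fin d) → 𝕜)
    (D2K : Fin d → Fin d → ℝ → ℝ → EuclideanSpace ℝ (Fin d) → 𝕜)
    (dtK : ℝ → ℝ → EuclideanSpace ℝ (Fin d) → 𝕜)
    (dtDK : Fin d → ℝ → ℝ → EuclideanSpace ℝ (Fin d) → 𝕜) : Prop where
  locallyIntegrable_dtK : ∀ᵐ t : ℝ, ∀ s < t, LocallyIntegrable (dtK t s) volume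
  weak_DK : ∀ᵐ t : ℝ, ∀ s < t, ∀ i,
    HasWeakDerivOn univ (EuclideanSpace.single i 1) (K t s) (DK i t s)
  weak_D2K : ∀ᵐ t : ℝ, ∀ s < t, ∀ i j,
    HasWeakDerivOn {0}ᶜ (EuclideanSpace.single j 1) (DK i t s) (D2K i j t s)
  weak_dtK : ∀ s : ℝ, HasWeakDerivOn (Ioi s ×ˢ univ) ((1 : ℝ), (0 : EuclideanSpace ℝ (Fin d)))
    (fun z => K z.1 s z.2) (fun z => dtK z.1 s z.2)
  weak_dtDK : ∀ s : ℝ, ∀ i,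
    HasWeakDerivOn (Ioi s ×ˢ univ) ((1 : ℝ), (0 : EuclideanSpace ℝ (Fin d)))
      (fun z => DK i z.1 s z.2) (fun z => dtDK i z.1 s z.2)

/-- The exponent `c₃ = (2(d+1)(c₂+1)+3) / (2(d+2))`. -/
def c₃ (d : ℕ) (c₂ : ℝ) : ℝ := (2 * (d + 1) * (c₂ + 1) + 3) / (2 * (d + 2))

/-- The second assumption on the kernel, for a given constant `c₂`.  The indices `0, 1, 2` of
`F`, `σ`, `κ`, `μ` stand for `1, 2, 3`. -/
def ScalingBounds {𝕜 : Type*} [RCLike 𝕜] {d : ℕ}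
    (K : ℝ → ℝ → EuclideanSpace ℝ (Fin d) → 𝕜) (c₂ : ℝ) : Prop :=
  ∃ (DK : Fin d → ℝ → ℝ → EuclideanSpace ℝ (Fin d) → 𝕜)
    (D2K : Fin d → Fin d → ℝ → ℝ → EuclideanSpace ℝ (Fin d) → 𝕜)
    (dtK : ℝ → ℝ → EuclideanSpace ℝ (Fin d) → 𝕜)
    (dtDK : Fin d → ℝ → ℝ → EuclideanSpace ℝ (Fin d) → 𝕜)
    (F : Fin 3 → ℝ → ℝ → EuclideanSpace ℝ (Fin d) → ℝ) (σ κ μ : Fin 3 → ℝ) (C : ℝ) (M : ℝ≥0),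
    IsKernelDerivatives K DK D2K dtK dtDK ∧
    (∀ n, 0 < σ n) ∧ (∀ n, 0 < κ n) ∧ 0 < C ∧ (∀ n, (d : ℝ) + 2 < μ n) ∧
    (∀ n t s, s < t → AEMeasurable (F n t s) volume) ∧
    -- pointwise bounds on the derivatives
    (∀ᵐ t : ℝ, ∀ s < t, ∀ᵐ x : EuclideanSpace ℝ (Fin d), ∀ i,
      ‖DK i t s x‖ ≤ C * ((t - s) ^ (-σ 0) * |F 0 t s ((t - s) ^ (-κ 0) • x)|)) ∧
    (∀ᵐ t : ℝ, ∀ s < t, ∀ᵐ x : EuclideanSpace ℝ (Fin d), ∀ i j,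
      ‖D2K i j t s x‖ ≤
        C * min ((t - s) ^ (-σ 1) * |F 1 t s ((t - s) ^ (-κ 1) • x)|) ((t - s) ^ (-c₂))) ∧
    (∀ᵐ t : ℝ, ∀ s < t, ∀ᵐ x : EuclideanSpace ℝ (Fin d), ∀ i,
      ‖dtDK i t s x‖ ≤
        C * min ((t - s) ^ (-σ 2) * |F 2 t s ((t - s) ^ (-κ 2) • x)|) ((t - s) ^ (-c₃ d c₂))) ∧
    -- weighted square integrability, uniformly in `s < t`
    (∀ t s, s < t → ∫⁻ x, ENNReal.ofReal (‖x‖ ^ μ 0 * |F 0 t s x| ^ 2) ≤ M) ∧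
    (∀ t s, s < t → ∫⁻ x in {x | (t - s) ^ (c₂ - c₃ d c₂ + 1 - κ 1) ≤ ‖x‖},
      ENNReal.ofReal (‖x‖ ^ μ 1 * |F 1 t s x| ^ 2) ≤ M) ∧
    (∀ t s, s < t → ∫⁻ x in {x | (t - s) ^ (c₂ - c₃ d c₂ + 1 - κ 2) ≤ ‖x‖},
      ENNReal.ofReal (‖x‖ ^ μ 2 * |F 2 t s x| ^ 2) ≤ M) ∧
    -- relations among the exponents
    (c₂ - c₃ d c₂ + 1 - κ 0) * μ 0 =
      d * (κ 0 + c₂ - c₃ d c₂ + 1) + 2 * (c₂ - c₃ d c₂ - σ 0) + 3 ∧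
    (c₂ - c₃ d c₂ + 1 - κ 1) * μ 1 =
      d * (κ 1 - c₂ + c₃ d c₂ - 1) + 2 * (c₂ - σ 1) ∧
    (c₂ - c₃ d c₂ + 1 - κ 2) * μ 2 =
      d * (κ 2 - c₂ + c₃ d c₂ - 1) + 2 * (c₃ d c₂ - σ 2)

/-- The square function
`G f (t,x) = (∫_{-∞}^t |K(t,s,·) * f(s,·)(x)|_H² ds)^{1/2}`, with values in `[0,∞]`. -/
def squareFunction {𝕜 : Type*} [RCLike 𝕜] {d : ℕ}
    {H : Type*} [NormedAddCommGroup H] [InnerProductSpace 𝕜 H] [NormedSpace ℝ H]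
    (K : ℝ → ℝ → EuclideanSpace ℝ (Fin d) → 𝕜) (f : ℝ × EuclideanSpace ℝ (Fin d) → H)
    (z : ℝ × EuclideanSpace ℝ (Fin d)) : ℝ≥0∞ :=
  (∫⁻ s in Iio z.1,
    ‖(K z.1 s ⋆[ContinuousLinearMap.lsmul 𝕜 𝕜, volume] (fun y => f (s, y))) z.2‖ₑ ^ 2) ^
      (1 / 2 : ℝ)

end LittlewoodPaley

end

/-!
The kernel `K(t,s,·)` satisfies the estimates of a homogeneous kernel at the scale `|x| ~ (t-s)^γ`,
`γ = c₂ - c₃ + 1`, and the square function is treated as a vector-valued singular integral.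

**The case `p = 2`.** For fixed `s`, convolution with `K(t,s,·)` is a multiplier in `ξ`, so that
Plancherel's theorem and `∫ |F K|² dt ≤ C₀` give the bound of `lintegral_convolution_le`. Vector
values are reduced to scalars through an orthonormal basis of the separable span of the range of
`u`, and integration over `s` yields `lintegral_squareEnergy_le`.

**Kernel estimates.** The relations among the exponents make the bounds on `D_x K`, `D_x² K` and
`∂_t D_x K` homogeneous in `t - s` with the single exponent `γ`, in `L₂` with power weights in `x`.
A weighted Hardy inequality (`VanishesAtInfinity.lintegral_le`) transfers them to `K` and its
increments in space and time (`ScalingBounds.exists_kernelEstimates`). The Hardy inequality needs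
vanishing at infinity in a weak sense, which holds for `K` because its Fourier transform is a
function (`HasFourierTransform.vanishesAtInfinity`) and for the derivatives because of their decay.
Since only weak derivatives are available, the fundamental theorem of calculus is proved along
translations and dilations by moving the test function instead.

**Oscillation.** Take a box of time length `R`, starting at time `a`, and of spatial size `R^γ`.
The sources at times `s > a - R` contribute to the average of `(G f)²` at most a multiple of the
iterated maximal function of `|f|²` at any point of the box: the part of `f(s,·)` near the box is
treated by the `L₂` bound, the remaining part by the decay of `K`. The sources at times
`s ≤ a - R` contribute a function whose oscillation over the box is bounded likewise, by the
increments of `K`. This is `KernelEstimates.exists_oscillation_le`.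

**The case `p > 2`.** The boxes are taken from a nested family of anisotropic dyadic partitions,
with sides `2^{-⌊γ n⌋}` in space at level `n`. A good-`λ` inequality for nested partitions
(`CellFamily.measure_levelSet_inter_le`) turns the oscillation bound into an `L_q` bound of
`(G f)²` by the iterated maximal function of `|f|²`, with `q = p/2 > 1`; the latter is bounded in
`L_q` by the Hardy–Littlewood theorem in each variable. Only a one-sided estimate is needed: `(G f)²`
exceeds twice its average over a box by an amount that is controlled in the mean.
-/

namespace LittlewoodPaley

/-! ### Layer cake formula for functions with values in `[0, ∞]` -/

lemma lintegral_Ioo_rpow_sub_one {q : ℝ} (hq : 0 < q) {b : ℝ} (hb : 0 ≤ b) :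
    ∫⁻ l in Ioo 0 b, ENNReal.ofReal (q * l ^ (q - 1)) = ENNReal.ofReal (b ^ q) := by
  rw [restrict_Ioo_eq_restrict_Ioc, ← ofReal_integral_eq_lintegral_ofReal]
  · rw [← intervalIntegral.integral_of_le hb, intervalIntegral.integral_const_mul,
      integral_rpow (Or.inl (by linarith))]
    congr 1
    rw [sub_add_cancel, Real.zero_rpow hq.ne', sub_zero, mul_div_cancel₀ _ hq.ne']
  · have := (intervalIntegral.intervalIntegrable_rpow' (a := 0) (b := b) (r := q - 1)
      (by linarith)).const_mul q
    exact (intervalIntegrable_iff_integrableOn_Ioc_of_le hb).1 this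
  · filter_upwards [ae_restrict_mem measurableSet_Ioc] with l hl
    have := Real.rpow_nonneg hl.1.le (q - 1)
    positivity

lemma lintegral_indicator_rpow_sub_one {q : ℝ} (hq : 0 < q) (X : ℝ≥0∞) :
    ∫⁻ l in Ioi (0 : ℝ), {l : ℝ | ENNReal.ofReal l < X}.indicator
      (fun l => ENNReal.ofReal (q * l ^ (q - 1))) l = X ^ q := by
  have key : ∀ b : ℝ, 0 ≤ b → ENNReal.ofReal b ≤ X → ENNReal.ofReal (b ^ q) ≤
      ∫⁻ l in Ioi (0 : ℝ), {l : ℝ | ENNReal.ofReal l < X}.indicator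
      (fun l => ENNReal.ofReal (q * l ^ (q - 1))) l := by
    intro b hb hbX
    rw [← lintegral_Ioo_rpow_sub_one hq hb, ← lintegral_indicator measurableSet_Ioo,
      ← lintegral_indicator measurableSet_Ioi]
    refine lintegral_mono fun l => ?_
    by_cases hl : l ∈ Ioo 0 b
    · have h1 : l ∈ {l : ℝ | ENNReal.ofReal l < X} :=
        lt_of_lt_of_le ((ENNReal.ofReal_lt_ofReal_iff (hl.1.trans hl.2)).2 hl.2) hbX
      rw [indicator_of_mem hl, indicator_of_mem (show l ∈ Ioi 0 from hl.1), indicator_of_mem h1]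
    · simp [indicator_of_notMem hl]
  by_cases hX : X = ⊤
  · subst hX
    rw [ENNReal.top_rpow_of_pos hq]
    refine ENNReal.eq_top_of_forall_nnreal_le fun r => ?_
    have h := key ((r : ℝ) ^ q⁻¹) (by positivity) le_top
    rwa [← Real.rpow_mul r.coe_nonneg, inv_mul_cancel₀ hq.ne', Real.rpow_one,
      ENNReal.ofReal_coe_nnreal] at h
  · lift X to ℝ≥0 using hX
    refine le_antisymm ?_ ?_
    · have : (X : ℝ≥0∞) ^ q = ENNReal.ofReal ((X : ℝ) ^ q) := by
        rw [← ENNReal.ofReal_rpow_of_nonneg X.coe_nonneg hq.le, ENNReal.ofReal_coe_nnreal]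
      rw [this, ← lintegral_Ioo_rpow_sub_one hq X.coe_nonneg, ← lintegral_indicator measurableSet_Ioo,
        ← lintegral_indicator measurableSet_Ioi]
      refine lintegral_mono fun l => ?_
      by_cases hl : l ∈ Ioi (0 : ℝ)
      · rw [indicator_of_mem hl]
        by_cases h1 : l ∈ {l : ℝ | ENNReal.ofReal l < X}
        · have h2 : l ∈ Ioo 0 (X : ℝ) := by
            refine ⟨hl, ?_⟩
            have h1' : ENNReal.ofReal l < X := h1
            rw [← ENNReal.ofReal_coe_nnreal, ENNReal.ofReal_lt_ofReal_iff_of_nonneg (le_of_lt hl)]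
              at h1'
            exact h1'
          rw [indicator_of_mem h1, indicator_of_mem h2]
        · simp [indicator_of_notMem h1]
      · simp [indicator_of_notMem hl]
    · have := key X X.coe_nonneg (by simp)
      rwa [← ENNReal.ofReal_rpow_of_nonneg X.coe_nonneg hq.le, ENNReal.ofReal_coe_nnreal] at this

/-- Tonelli's theorem for `∫_Y ∫_0^{X(y)} q l^{q-1} w(y) dl dy`. -/
lemma lintegral_mul_rpow_eq_lintegral {Y : Type*} [MeasurableSpace Y] {ν : Measure Y} [SFinite ν]
    {q : ℝ} (hq : 0 < q) {X w : Y → ℝ≥0∞} (hX : Measurable X) (hw : Measurable w) :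
    ∫⁻ y, w y * X y ^ q ∂ν = ∫⁻ l in Ioi (0 : ℝ),
      ENNReal.ofReal (q * l ^ (q - 1)) * ∫⁻ y in {y | ENNReal.ofReal l < X y}, w y ∂ν := by
  have hS : MeasurableSet {z : Y × ℝ | ENNReal.ofReal z.2 < X z.1} :=
    measurableSet_lt (by fun_prop) (by fun_prop)
  have hm : Measurable (fun z : Y × ℝ => {z : Y × ℝ | ENNReal.ofReal z.2 < X z.1}.indicator
      (fun z => ENNReal.ofReal (q * z.2 ^ (q - 1)) * w z.1) z) :=
    Measurable.indicator (by fun_prop) hS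
  calc ∫⁻ y, w y * X y ^ q ∂ν
      = ∫⁻ y, (∫⁻ l in Ioi (0 : ℝ), {z : Y × ℝ | ENNReal.ofReal z.2 < X z.1}.indicator
          (fun z => ENNReal.ofReal (q * z.2 ^ (q - 1)) * w z.1) (y, l)) ∂ν := by
        refine lintegral_congr fun y => ?_
        rw [← lintegral_indicator_rpow_sub_one hq, ← lintegral_const_mul]
        · refine lintegral_congr fun l => ?_
          by_cases h : ENNReal.ofReal l < X y
          · simp [indicator, h, mul_comm]
          · simp [indicator, h]
        · exact Measurable.indicator (by fun_prop) (measurableSet_lt (by fun_prop) (by fun_prop))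
    _ = ∫⁻ l in Ioi (0 : ℝ), (∫⁻ y, {z : Y × ℝ | ENNReal.ofReal z.2 < X z.1}.indicator
          (fun z => ENNReal.ofReal (q * z.2 ^ (q - 1)) * w z.1) (y, l) ∂ν) :=
        lintegral_lintegral_swap hm.aemeasurable
    _ = _ := by
        refine lintegral_congr fun l => ?_
        rw [← lintegral_const_mul _ hw, ← lintegral_indicator (measurableSet_lt (by fun_prop) hX)]
        rfl

lemma lintegral_rpow_eq_lintegral_measure {Y : Type*} [MeasurableSpace Y] {ν : Measure Y}
    [SFinite ν] {q : ℝ} (hq : 0 < q) {X : Y → ℝ≥0∞} (hX : Measurable X) :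
    ∫⁻ y, X y ^ q ∂ν = ∫⁻ l in Ioi (0 : ℝ),
      ENNReal.ofReal (q * l ^ (q - 1)) * ν {y | ENNReal.ofReal l < X y} := by
  have := lintegral_mul_rpow_eq_lintegral (ν := ν) hq hX (w := fun _ => 1) measurable_const
  simpa using this

/-! ### The Hardy–Littlewood maximal function -/

section Maximal

variable {V : Type*} [NormedAddCommGroup V] [NormedSpace ℝ V] [MeasureSpace V]

/-- The maximal function of `u : V → [0, ∞]` over centred balls with dyadic radii. -/
noncomputable def maximalFunction (u : V → ℝ≥0∞) (x : V) : ℝ≥0∞ :=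
  ⨆ k : ℤ, (volume (Metric.ball x ((2 : ℝ) ^ k)))⁻¹ * ∫⁻ y in Metric.ball x ((2 : ℝ) ^ k), u y

set_option linter.unusedSectionVars false
variable [BorelSpace V] [FiniteDimensional ℝ V] [(volume : Measure V).IsAddHaarMeasure]

lemma setLIntegral_ball_le_maximalFunction (u : V → ℝ≥0∞) (x : V) (k : ℤ) :
    ∫⁻ y in Metric.ball x ((2 : ℝ) ^ k), u y ≤
      volume (Metric.ball x ((2 : ℝ) ^ k)) * maximalFunction u x := by
  have h0 : volume (Metric.ball x ((2 : ℝ) ^ k)) ≠ 0 :=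
    (Metric.measure_ball_pos _ _ (by positivity)).ne'
  have h1 : volume (Metric.ball x ((2 : ℝ) ^ k)) ≠ ⊤ := measure_ball_lt_top.ne
  calc ∫⁻ y in Metric.ball x ((2 : ℝ) ^ k), u y
      = volume (Metric.ball x ((2 : ℝ) ^ k)) * ((volume (Metric.ball x ((2 : ℝ) ^ k)))⁻¹ *
        ∫⁻ y in Metric.ball x ((2 : ℝ) ^ k), u y) := by
        rw [← mul_assoc, ENNReal.mul_inv_cancel h0 h1, one_mul]
    _ ≤ _ := by
        gcongr
        exact le_iSup (fun k : ℤ => (volume (Metric.ball x ((2 : ℝ) ^ k)))⁻¹ *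
          ∫⁻ y in Metric.ball x ((2 : ℝ) ^ k), u y) k

/-- Joint measurability of the maximal function in the second variable. -/
lemma measurable_maximalFunction_prod {T : Type*} [MeasurableSpace T] {u : T × V → ℝ≥0∞}
    (hu : Measurable u) :
    Measurable (fun z : T × V => maximalFunction (fun y => u (z.1, y)) z.2) := by
  have hS : ∀ k : ℤ, MeasurableSet {z : (T × V) × V | z.2 ∈ Metric.ball z.1.2 ((2 : ℝ) ^ k)} := by
    intro k
    simp only [Metric.mem_ball]
    exact measurableSet_lt (by fun_prop) measurable_const
  unfold maximalFunction
  refine Measurable.iSup fun k => ?_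
  have hvol : ∀ x : V, volume (Metric.ball x ((2 : ℝ) ^ k)) =
      volume (Metric.ball (0 : V) ((2 : ℝ) ^ k)) :=
    fun x => Measure.addHaar_ball_center _ _ _
  simp only [hvol]
  refine Measurable.const_mul ?_ _
  have : ∀ z : T × V, ∫⁻ y in Metric.ball z.2 ((2 : ℝ) ^ k), u (z.1, y) =
      ∫⁻ y, {z : (T × V) × V | z.2 ∈ Metric.ball z.1.2 ((2 : ℝ) ^ k)}.indicator
        (fun z => u (z.1.1, z.2)) (z, y) := by
    intro z
    rw [← lintegral_indicator Metric.isOpen_ball.measurableSet]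
    rfl
  simp only [this]
  exact Measurable.lintegral_prod_right' (Measurable.indicator (by fun_prop) (hS k))

lemma measurable_maximalFunction {u : V → ℝ≥0∞} (hu : Measurable u) :
    Measurable (maximalFunction u) := by
  have h := measurable_maximalFunction_prod (T := ℝ) (hu.comp measurable_snd)
  simp only [Function.comp_apply] at h
  exact (h.comp (measurable_prodMk_left (x := (0 : ℝ))) :)

/-- The weak type `(1,1)` inequality, by the Vitali covering lemma. Large radii are cut off first
and recovered by monotone convergence. -/
lemma measure_maximalFunction_gt_le (u : V → ℝ≥0∞) {l : ℝ≥0∞} (hl : l ≠ 0)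
    (hl' : l ≠ ⊤) :
    volume {x | l < maximalFunction u x} ≤
      ENNReal.ofReal (5 ^ Module.finrank ℝ V) * l⁻¹ * ∫⁻ y, u y := by
  classical
  set n := Module.finrank ℝ V
  let E : ℕ → Set V := fun m => {x | ∃ k : ℤ, k ≤ m ∧
    l < (volume (Metric.ball x ((2 : ℝ) ^ k)))⁻¹ * ∫⁻ y in Metric.ball x ((2 : ℝ) ^ k), u y}
  have hE : {x | l < maximalFunction u x} = ⋃ m, E m := by
    ext x
    simp only [maximalFunction, lt_iSup_iff, mem_ofPred_eq, mem_iUnion, E]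
    constructor
    · rintro ⟨k, hk⟩
      exact ⟨k.toNat, k, Int.self_le_toNat k, hk⟩
    · rintro ⟨m, k, -, hk⟩
      exact ⟨k, hk⟩
  have hmono : Monotone E := by
    intro m m' hm x ⟨k, hk, h⟩
    exact ⟨k, hk.trans (by exact_mod_cast hm), h⟩
  rw [hE, hmono.measure_iUnion]
  refine iSup_le fun m => ?_
  choose! k hk hkl using fun x (hx : x ∈ E m) => hx
  obtain ⟨s, hsE, hdisj, hcov⟩ := Vitali.exists_disjoint_subfamily_covering_enlargement_ball
    (E m) (fun x => x) (fun x => (2 : ℝ) ^ (k x)) ((2 : ℝ) ^ (m : ℤ))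
    (fun x hx => zpow_le_zpow_right₀ (by norm_num) (hk x hx)) 5 (by norm_num)
  have hcount : s.Countable := by
    refine hdisj.countable_of_isOpen (fun i _ => Metric.isOpen_ball) fun i _ => ?_
    exact Metric.nonempty_ball.2 (by positivity)
  have hball : ∀ b ∈ s, volume (Metric.ball b (5 * (2 : ℝ) ^ k b)) ≤
      ENNReal.ofReal (5 ^ n) * l⁻¹ * ∫⁻ y in Metric.ball b ((2 : ℝ) ^ k b), u y := by
    intro b hb
    have h := hkl b (hsE hb)
    have h0 : volume (Metric.ball b ((2 : ℝ) ^ k b)) ≠ 0 :=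
      (Metric.measure_ball_pos _ _ (by positivity)).ne'
    have h1 : volume (Metric.ball b ((2 : ℝ) ^ k b)) ≠ ⊤ := measure_ball_lt_top.ne
    have h2 : l * volume (Metric.ball b ((2 : ℝ) ^ k b)) ≤
        ∫⁻ y in Metric.ball b ((2 : ℝ) ^ k b), u y := by
      calc _ ≤ ((volume (Metric.ball b ((2 : ℝ) ^ k b)))⁻¹ *
            ∫⁻ y in Metric.ball b ((2 : ℝ) ^ k b), u y) * volume (Metric.ball b ((2 : ℝ) ^ k b)) := by
              gcongr
        _ = _ := by
          rw [mul_right_comm, ENNReal.inv_mul_cancel h0 h1, one_mul]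
    rw [Measure.addHaar_ball_mul_of_pos _ _ (by norm_num), Measure.addHaar_ball_center, mul_assoc]
    gcongr
    rw [Measure.addHaar_ball_center] at h2
    rwa [mul_comm, ← div_eq_mul_inv, ENNReal.le_div_iff_mul_le (Or.inl hl) (Or.inl hl'), mul_comm]
  calc volume (E m) ≤ volume (⋃ b ∈ s, Metric.ball b (5 * (2 : ℝ) ^ k b)) := by
        refine measure_mono fun x hx => ?_
        obtain ⟨b, hb, hxb⟩ := hcov x hx
        exact mem_biUnion hb (hxb (Metric.mem_ball_self (by positivity)))
    _ ≤ ∑' b : s, volume (Metric.ball (b : V) (5 * (2 : ℝ) ^ k b)) :=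
        measure_biUnion_le _ hcount _
    _ ≤ ∑' b : s, ENNReal.ofReal (5 ^ n) * l⁻¹ *
          ∫⁻ y in Metric.ball (b : V) ((2 : ℝ) ^ k b), u y :=
        ENNReal.tsum_le_tsum fun b => hball b b.2
    _ = ENNReal.ofReal (5 ^ n) * l⁻¹ * ∫⁻ y in ⋃ b ∈ s, Metric.ball b ((2 : ℝ) ^ k b), u y := by
        rw [ENNReal.tsum_mul_left, lintegral_biUnion hcount
          (fun _ _ => Metric.isOpen_ball.measurableSet) hdisj]
    _ ≤ _ := mul_le_mul_right (setLIntegral_le_lintegral _ _) _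

/-- The part of `u` below `l` does not contribute to the set where the maximal function
exceeds `2 l`. -/
lemma measure_maximalFunction_gt_two_mul_le (u : V → ℝ≥0∞) (hu : Measurable u) {l : ℝ≥0∞}
    (hl : l ≠ 0) (hl' : l ≠ ⊤) :
    volume {x | 2 * l < maximalFunction u x} ≤
      ENNReal.ofReal (5 ^ Module.finrank ℝ V) * l⁻¹ * ∫⁻ y in {y | l < u y}, u y := by
  have hS : MeasurableSet {y | l < u y} := measurableSet_lt measurable_const hu
  refine le_trans (measure_mono fun x hx => ?_)
    ((measure_maximalFunction_gt_le ({y | l < u y}.indicator u) hl hl').trans_eq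
      (by rw [lintegral_indicator hS]))
  simp only [maximalFunction, lt_iSup_iff, mem_ofPred_eq] at hx ⊢
  obtain ⟨k, hk⟩ := hx
  refine ⟨k, ?_⟩
  set B := Metric.ball x ((2 : ℝ) ^ k)
  have h0 : volume B ≠ 0 := (Metric.measure_ball_pos _ _ (by positivity)).ne'
  have h1 : volume B ≠ ⊤ := measure_ball_lt_top.ne
  have h2 : ∫⁻ y in B, u y ≤ (∫⁻ y in B, {y | l < u y}.indicator u y) + l * volume B := by
    rw [← setLIntegral_const, ← lintegral_add_right _ measurable_const]
    refine lintegral_mono fun y => ?_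
    by_cases hy : l < u y
    · simp [indicator, hy]
    · simp [indicator, hy, not_lt.1 hy]
  have h3 : (volume B)⁻¹ * ∫⁻ y in B, u y ≤
      ((volume B)⁻¹ * ∫⁻ y in B, {y | l < u y}.indicator u y) + l := by
    calc _ ≤ (volume B)⁻¹ * ((∫⁻ y in B, {y | l < u y}.indicator u y) + l * volume B) := by gcongr
      _ = _ := by
        rw [mul_add, mul_left_comm, ENNReal.inv_mul_cancel h0 h1, mul_one]
  have h4 := hk.trans_le h3
  rw [two_mul] at h4
  exact (ENNReal.add_lt_add_iff_right hl').1 h4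

/-- The constant in the `L_q` bound for the maximal function on an `n`-dimensional space. -/
noncomputable def maximalConst (n : ℕ) (q : ℝ) : ℝ≥0∞ :=
  2 ^ q * (ENNReal.ofReal (5 ^ n) * ENNReal.ofReal (q / (q - 1)))

lemma maximalConst_ne_top (n : ℕ) {q : ℝ} (hq : 1 < q) : maximalConst n q ≠ ⊤ := by
  unfold maximalConst
  refine ENNReal.mul_ne_top (ENNReal.rpow_ne_top_of_nonneg (by linarith) (by norm_num)) ?_
  exact ENNReal.mul_ne_top ENNReal.ofReal_ne_top ENNReal.ofReal_ne_top

/-- The `L_q` bound for the maximal function, from the weak type inequality for the part of `u`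
above the level. -/
lemma lintegral_maximalFunction_rpow_le {q : ℝ} (hq : 1 < q) {u : V → ℝ≥0∞} (hu : Measurable u) :
    ∫⁻ x, maximalFunction u x ^ q ≤ maximalConst (Module.finrank ℝ V) q * ∫⁻ x, u x ^ q := by
  have hq0 : 0 < q := by linarith
  have hM := measurable_maximalFunction hu
  set n := Module.finrank ℝ V
  have e1 : ∀ x, maximalFunction u x ^ q = 2 ^ q * (maximalFunction u x / 2) ^ q := by
    intro x
    rw [← ENNReal.mul_rpow_of_nonneg _ _ hq0.le, ENNReal.mul_div_cancel (by norm_num) (by norm_num)]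
  simp only [e1]
  rw [lintegral_const_mul _ (by fun_prop), maximalConst, mul_assoc]
  gcongr
  rw [lintegral_rpow_eq_lintegral_measure hq0 (by fun_prop)]
  have e2 : ∀ x, u x ^ q = u x * u x ^ (q - 1) := by
    intro x
    conv_lhs => rw [show q = 1 + (q - 1) by ring]
    rw [ENNReal.rpow_add_of_nonneg _ _ zero_le_one (by linarith), ENNReal.rpow_one]
  simp only [e2]
  rw [lintegral_mul_rpow_eq_lintegral (by linarith) hu hu, ← lintegral_const_mul']
  swap
  · exact ENNReal.mul_ne_top ENNReal.ofReal_ne_top ENNReal.ofReal_ne_top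
  refine setLIntegral_mono' measurableSet_Ioi fun l (hl : 0 < l) => ?_
  have hset : {x | ENNReal.ofReal l < maximalFunction u x / 2} =
      {x | 2 * ENNReal.ofReal l < maximalFunction u x} := by
    ext x
    simp only [mem_ofPred_eq]
    rw [ENNReal.lt_div_iff_mul_lt (by simp) (by simp), mul_comm]
  rw [hset]
  have := measure_maximalFunction_gt_two_mul_le u hu (l := ENNReal.ofReal l) (by simpa using hl)
    ENNReal.ofReal_ne_top
  have hq1 : 0 < q - 1 := by linarith
  have hreal : ENNReal.ofReal (q * l ^ (q - 1)) * (ENNReal.ofReal l)⁻¹ =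
      ENNReal.ofReal (q / (q - 1)) * ENNReal.ofReal ((q - 1) * l ^ (q - 1 - 1)) := by
    rw [← ENNReal.ofReal_inv_of_pos hl, ← ENNReal.ofReal_mul (by positivity),
      ← ENNReal.ofReal_mul (by positivity)]
    congr 1
    rw [Real.rpow_sub_one hl.ne' (q - 1)]
    field_simp
  calc _ ≤ ENNReal.ofReal (q * l ^ (q - 1)) * (ENNReal.ofReal (5 ^ n) * (ENNReal.ofReal l)⁻¹ *
        ∫⁻ y in {y | ENNReal.ofReal l < u y}, u y) := mul_le_mul_right this _
    _ = ENNReal.ofReal (5 ^ n) * (ENNReal.ofReal (q * l ^ (q - 1)) * (ENNReal.ofReal l)⁻¹) *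
        ∫⁻ y in {y | ENNReal.ofReal l < u y}, u y := by ring
    _ = _ := by
      rw [hreal]; ring

/-- A function dominated by a radial decreasing profile with integrable tail is controlled by the
maximal function: `∫ u(y) (1 + |y - x|/r)^{-ν} dy ≤ N r^n M u(x)` for `ν > n`. -/
lemma exists_lintegral_mul_decay_le (V : Type*) [NormedAddCommGroup V] [NormedSpace ℝ V]
    [MeasureSpace V] [BorelSpace V] [FiniteDimensional ℝ V] [(volume : Measure V).IsAddHaarMeasure]
    {ν : ℝ} (hν : (Module.finrank ℝ V : ℝ) < ν) :
    ∃ N : ℝ≥0, ∀ (u : V → ℝ≥0∞), Measurable u → ∀ (x : V) (r : ℝ), 0 < r →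
      ∫⁻ y, u y * ENNReal.ofReal ((1 + ‖y - x‖ / r) ^ (-ν)) ≤
        N * ENNReal.ofReal (r ^ Module.finrank ℝ V) * maximalFunction u x := by
  set n := Module.finrank ℝ V
  set ρ : ℝ := 2 ^ ((n : ℝ) - ν) with hρ
  have hρ0 : 0 < ρ := by positivity
  have hρ1 : ρ < 1 := Real.rpow_lt_one_of_one_lt_of_neg (by norm_num) (by linarith)
  have hν0 : 0 ≤ ν := le_trans (by positivity) hν.le
  have hB : volume (Metric.ball (0 : V) 1) ≠ ⊤ := measure_ball_lt_top.ne
  refine ⟨(ENNReal.ofReal (2 ^ ν * 2 ^ n * (1 - ρ)⁻¹) * volume (Metric.ball (0 : V) 1)).toNNReal,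
    fun u hu x r hr => ?_⟩
  rw [ENNReal.coe_toNNReal (ENNReal.mul_ne_top ENNReal.ofReal_ne_top hB)]
  obtain ⟨k, hk1, hk2⟩ : ∃ k : ℤ, r ≤ (2 : ℝ) ^ k ∧ (2 : ℝ) ^ k ≤ 2 * r := by
    obtain ⟨k, h1, h2⟩ := exists_mem_Ioc_zpow hr (one_lt_two : (1 : ℝ) < 2)
    refine ⟨k + 1, h2, ?_⟩
    rw [zpow_add₀ (by norm_num), zpow_one]
    linarith
  have hpt : ∀ y, u y * ENNReal.ofReal ((1 + ‖y - x‖ / r) ^ (-ν)) ≤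
      ∑' j : ℕ, ENNReal.ofReal (2 ^ ν * 2 ^ (-ν * j)) *
        (Metric.ball x ((2 : ℝ) ^ (k + j))).indicator u y := by
    intro y
    have hex : ∃ j : ℕ, ‖y - x‖ < 2 ^ j * r := by
      obtain ⟨j, hj⟩ := pow_unbounded_of_one_lt (‖y - x‖ / r) (one_lt_two : (1 : ℝ) < 2)
      exact ⟨j, by rwa [div_lt_iff₀ hr] at hj⟩
    classical
    set j := Nat.find hex
    have hj : ‖y - x‖ < 2 ^ j * r := Nat.find_spec hex
    refine le_trans ?_ (ENNReal.le_tsum j)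
    have hmem : y ∈ Metric.ball x ((2 : ℝ) ^ (k + j)) := by
      rw [mem_ball_iff_norm, zpow_add₀ (by norm_num), zpow_natCast, mul_comm]
      exact hj.trans_le (by gcongr)
    rw [indicator_of_mem hmem, mul_comm]
    gcongr
    rw [← Real.rpow_add (by norm_num), show ν + -ν * j = -(ν * (j - 1)) by ring]
    by_cases hj0 : j = 0
    · rw [hj0]
      calc (1 + ‖y - x‖ / r) ^ (-ν) ≤ 1 :=
            Real.rpow_le_one_of_one_le_of_nonpos (by
              have : 0 ≤ ‖y - x‖ / r := by positivity
              linarith) (by linarith)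
        _ ≤ _ := Real.one_le_rpow (by norm_num) (by simpa using hν0)
    · obtain ⟨i, hi⟩ := Nat.exists_eq_succ_of_ne_zero hj0
      have h1 : ¬ ‖y - x‖ < 2 ^ i * r := Nat.find_min hex (by omega)
      have h2 : (2 : ℝ) ^ i ≤ 1 + ‖y - x‖ / r := by
        have : (2 : ℝ) ^ i ≤ ‖y - x‖ / r := by
          rw [le_div_iff₀ hr]; exact not_lt.1 h1
        linarith
      calc (1 + ‖y - x‖ / r) ^ (-ν) ≤ ((2 : ℝ) ^ i) ^ (-ν) :=
            Real.rpow_le_rpow_of_nonpos (by positivity) h2 (by linarith)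
        _ = _ := by
          rw [← Real.rpow_natCast, ← Real.rpow_mul (by norm_num), hi]
          congr 1
          push_cast
          ring
  have hvol : ∀ j : ℕ, volume (Metric.ball x ((2 : ℝ) ^ (k + j))) ≤
      ENNReal.ofReal (2 ^ n * r ^ n * 2 ^ ((n : ℝ) * j)) * volume (Metric.ball (0 : V) 1) := by
    intro j
    rw [Measure.addHaar_ball_of_pos _ _ (by positivity)]
    gcongr
    have e : (2 : ℝ) ^ ((n : ℝ) * j) = ((2 : ℝ) ^ j) ^ n := by
      rw [← Nat.cast_mul, Real.rpow_natCast, ← pow_mul, mul_comm]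
    rw [zpow_add₀ (by norm_num), zpow_natCast, e, ← mul_pow, ← mul_pow]
    gcongr
  calc ∫⁻ y, u y * ENNReal.ofReal ((1 + ‖y - x‖ / r) ^ (-ν))
      ≤ ∫⁻ y, ∑' j : ℕ, ENNReal.ofReal (2 ^ ν * 2 ^ (-ν * j)) *
        (Metric.ball x ((2 : ℝ) ^ (k + j))).indicator u y := lintegral_mono hpt
    _ = ∑' j : ℕ, ENNReal.ofReal (2 ^ ν * 2 ^ (-ν * j)) *
        ∫⁻ y in Metric.ball x ((2 : ℝ) ^ (k + j)), u y := by
        rw [lintegral_tsum fun j => ((hu.indicator Metric.isOpen_ball.measurableSet).const_mul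
          _).aemeasurable]
        congr 1; ext j
        rw [lintegral_const_mul _ (hu.indicator Metric.isOpen_ball.measurableSet),
          lintegral_indicator Metric.isOpen_ball.measurableSet]
    _ ≤ ∑' j : ℕ, ENNReal.ofReal (2 ^ ν * 2 ^ (-ν * j)) *
        (ENNReal.ofReal (2 ^ n * r ^ n * 2 ^ ((n : ℝ) * j)) * volume (Metric.ball (0 : V) 1) *
          maximalFunction u x) := by
        refine ENNReal.tsum_le_tsum fun j => ?_
        gcongr
        exact (setLIntegral_ball_le_maximalFunction u x _).trans (by gcongr; exact hvol j)
    _ = ∑' j : ℕ, ENNReal.ofReal (ρ ^ j) * (ENNReal.ofReal (2 ^ ν * 2 ^ n * r ^ n) *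
          volume (Metric.ball (0 : V) 1) * maximalFunction u x) := by
        congr 1; ext j
        have hexp : ρ ^ j = 2 ^ (-ν * j) * 2 ^ ((n : ℝ) * j) := by
          rw [← Real.rpow_add (by norm_num), hρ, ← Real.rpow_natCast, ← Real.rpow_mul (by norm_num)]
          congr 1; ring
        have hmul : ENNReal.ofReal (2 ^ ν * 2 ^ (-ν * j)) *
            ENNReal.ofReal (2 ^ n * r ^ n * 2 ^ ((n : ℝ) * j)) =
            ENNReal.ofReal (ρ ^ j) * ENNReal.ofReal (2 ^ ν * 2 ^ n * r ^ n) := by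
          rw [← ENNReal.ofReal_mul (by positivity), ← ENNReal.ofReal_mul (by positivity), hexp]
          congr 1; ring
        rw [← mul_assoc, ← mul_assoc, hmul]
        ring
    _ = _ := by
        rw [ENNReal.tsum_mul_right, ← ENNReal.ofReal_tsum_of_nonneg (fun j => by positivity)
          (summable_geometric_of_lt_one hρ0.le hρ1), tsum_geometric_of_lt_one hρ0.le hρ1,
          ← mul_assoc, ← mul_assoc, ← ENNReal.ofReal_mul (by
            have : 0 < 1 - ρ := by linarith
            positivity), mul_right_comm (ENNReal.ofReal _) _ (ENNReal.ofReal (r ^ n)),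
          ← ENNReal.ofReal_mul (by
            have : 0 < 1 - ρ := by linarith
            positivity)]
        congr 3
        ring

end Maximal

/-! ### Weak derivatives along flows -/

section Weak

set_option linter.unusedSectionVars false

variable {V : Type*} [NormedAddCommGroup V] [NormedSpace ℝ V] [MeasureSpace V] [BorelSpace V]
  [FiniteDimensional ℝ V] [(volume : Measure V).IsAddHaarMeasure]

/-- If `|∫ η w| ≤ ∫ |η| A` for all test functions `η` on `Ω`, then `|w| ≤ A` almost everywhere
on `Ω`: test with mollifiers and pass to the limit. -/
theorem ae_enorm_le_of_enorm_integral_smul_le {F : Type*} [NormedAddCommGroup F] [NormedSpace ℝ F]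
    [CompleteSpace F] {Ω : Set V} (hΩ : IsOpen Ω) {w : V → F}
    (hw : LocallyIntegrableOn w Ω volume) {A : V → ℝ≥0∞} (hA : AEMeasurable A volume)
    (hAfin : ∀ S ⊆ Ω, IsCompact S → ∫⁻ x in S, A x ≠ ⊤)
    (h : ∀ η : V → ℝ, ContDiff ℝ ∞ η → HasCompactSupport η → tsupport η ⊆ Ω →
      ‖∫ x, η x • w x‖ₑ ≤ ∫⁻ x, ‖η x‖ₑ * A x) :
    ∀ᵐ x, x ∈ Ω → ‖w x‖ₑ ≤ A x := by
  rw [ae_iff]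
  refine measure_null_of_locally_null _ fun x₀ hx₀ => ?_
  simp only [Classical.not_imp, mem_ofPred_eq] at hx₀
  obtain ⟨ε, hε, hS⟩ := Metric.nhds_basis_closedBall.mem_iff.1 (hΩ.mem_nhds hx₀.1)
  set S := Metric.closedBall x₀ ε
  have hSc : IsCompact S := isCompact_closedBall _ _
  have hSm : MeasurableSet S := Metric.isClosed_closedBall.measurableSet
  refine ⟨{x | ¬ (x ∈ Ω → ‖w x‖ₑ ≤ A x)} ∩ Metric.ball x₀ ε,
    inter_mem_nhdsWithin _ (Metric.ball_mem_nhds _ hε), ?_⟩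
  suffices hae : ∀ᵐ x, x ∈ Metric.ball x₀ ε → ‖w x‖ₑ ≤ A x by
    rw [ae_iff] at hae
    refine measure_mono_null (fun x hx => ?_) hae
    simp only [mem_inter_iff, mem_ofPred_eq, Classical.not_imp] at hx ⊢
    exact ⟨hx.2, hx.1.2⟩
  have hAS : ∀ᵐ x, x ∈ S → A x < ⊤ := by
    rw [← ae_restrict_iff' hSm]
    exact ae_lt_top' hA.restrict (hAfin S hS hSc)
  set W := S.indicator w
  set B := S.indicator fun x => (A x).toReal
  have hWi : Integrable W := (integrable_indicator_iff hSm).2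
    (hw.integrableOn_compact_subset hS hSc)
  have hBi : Integrable B := (integrable_indicator_iff hSm).2
    (integrable_toReal_of_lintegral_ne_top hA.restrict (hAfin S hS hSc))
  -- mollifiers shrinking to a point recover the values of `W` and `B` almost everywhere
  let φ : ℕ → ContDiffBump (0 : V) := fun n =>
    { rIn := 1 / (n + 1) / 2, rOut := 1 / (n + 1), rIn_pos := by positivity
      rIn_lt_rOut := by
        have : (0 : ℝ) < 1 / (n + 1) := by positivity
        linarith }
  have hφ : Filter.Tendsto (fun n => (φ n).rOut) Filter.atTop (nhds 0) :=
    tendsto_one_div_add_atTop_nhds_zero_nat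
  have hφ' : ∀ᶠ n in Filter.atTop, (φ n).rOut ≤ 2 * (φ n).rIn :=
    Filter.Eventually.of_forall fun n => by
      change (1 : ℝ) / (n + 1) ≤ 2 * (1 / (n + 1) / 2); linarith
  filter_upwards [ContDiffBump.ae_convolution_tendsto_right_of_locallyIntegrable hφ hφ'
    hWi.locallyIntegrable, ContDiffBump.ae_convolution_tendsto_right_of_locallyIntegrable hφ hφ'
    hBi.locallyIntegrable, hAS] with x hx1 hx2 hx3 hx
  have hxS : x ∈ S := Metric.ball_subset_closedBall hx
  have e1 : W x = w x := indicator_of_mem hxS _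
  have e2 : B x = (A x).toReal := indicator_of_mem hxS _
  rw [e1] at hx1
  rw [e2] at hx2
  have hlim : ‖w x‖ ≤ (A x).toReal := by
    refine le_of_tendsto_of_tendsto hx1.norm hx2 ?_
    have hd : 0 < ε - dist x x₀ := by
      have : dist x x₀ < ε := hx
      linarith
    filter_upwards [hφ.eventually (gt_mem_nhds hd)] with n hn
    set η : V → ℝ := fun y => (φ n).normed volume (x - y)
    have hηc : ContDiff ℝ ∞ η := (φ n).contDiff_normed.comp (contDiff_const.sub contDiff_id)
    have hηz : ∀ y, y ∉ Metric.closedBall x (φ n).rOut → η y = 0 := by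
      intro y hy
      have : x - y ∉ Function.support ((φ n).normed volume) := by
        rw [(φ n).support_normed_eq]
        intro h'
        apply hy
        rw [mem_ball_zero_iff] at h'
        rw [Metric.mem_closedBall, dist_comm, dist_eq_norm]
        exact h'.le
      simpa using this
    have hηs : tsupport η ⊆ Metric.closedBall x (φ n).rOut :=
      closure_minimal (fun y hy => by
        by_contra hc
        exact hy (hηz y hc)) Metric.isClosed_closedBall
    have hsubS : Metric.closedBall x (φ n).rOut ⊆ S :=
      Metric.closedBall_subset_closedBall' (by linarith)
    have hηcs : HasCompactSupport η :=
      HasCompactSupport.of_support_subset_isCompact (isCompact_closedBall _ _)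
        ((subset_tsupport _).trans hηs)
    have hη0 : ∀ y, 0 ≤ η y := fun y => (φ n).nonneg_normed _
    have key := h η hηc hηcs (hηs.trans (hsubS.trans hS))
    have c1 : ((φ n).normed volume ⋆[ContinuousLinearMap.lsmul ℝ ℝ, volume] W) x =
        ∫ y, η y • w y := by
      rw [convolution_eq_swap]
      refine integral_congr_ae (Filter.Eventually.of_forall fun y => ?_)
      by_cases hy : y ∈ S
      · simp [η, W, hy]
      · have : η y = 0 := hηz y fun h' => hy (hsubS h')
        simp only [η] at this
        simp [η, this]
    have c2 : ((φ n).normed volume ⋆[ContinuousLinearMap.lsmul ℝ ℝ, volume] B) x =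
        ∫ y, η y • B y := by
      rw [convolution_eq_swap]
      rfl
    rw [c1, c2]
    have c3 : Integrable (fun y => η y • B y) := by
      refine hBi.bdd_mul (c := ⨆ y, ‖η y‖) hηc.continuous.aestronglyMeasurable ?_
      exact Filter.Eventually.of_forall fun y => le_ciSup
        (hηc.continuous.norm.bddAbove_range_of_hasCompactSupport hηcs.norm) y
    have c4 : ∫⁻ y, ‖η y‖ₑ * A y = ENNReal.ofReal (∫ y, η y • B y) := by
      rw [ofReal_integral_eq_lintegral_ofReal c3 (Filter.Eventually.of_forall fun y =>
        mul_nonneg (hη0 y) (indicator_nonneg (fun _ _ => ENNReal.toReal_nonneg) y))]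
      refine lintegral_congr_ae ?_
      filter_upwards [hAS] with y hy
      by_cases hyS : y ∈ S
      · have hBy : B y = (A y).toReal := indicator_of_mem hyS _
        rw [smul_eq_mul, ENNReal.ofReal_mul (hη0 y), hBy,
          ENNReal.ofReal_toReal (hy hyS).ne, Real.enorm_of_nonneg (hη0 y)]
      · have : η y = 0 := hηz y fun h' => hyS (hsubS h')
        simp [this]
    rw [c4, ← ofReal_norm] at key
    have hnn : 0 ≤ ∫ y, η y • B y := integral_nonneg fun y =>
        mul_nonneg (hη0 y) (indicator_nonneg (fun _ _ => ENNReal.toReal_nonneg) y)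
    exact (ENNReal.ofReal_le_ofReal_iff hnn).1 key
  rw [← ofReal_norm]
  exact ENNReal.ofReal_le_of_le_toReal hlim

lemma integrable_smul_of_locallyIntegrableOn {F : Type*} [NormedAddCommGroup F] [NormedSpace ℝ F]
    {Ω S : Set V} (hS : IsCompact S) (hSΩ : S ⊆ Ω) {φ : V → ℝ} (hφ : Continuous φ)
    (hφS : ∀ y ∉ S, φ y = 0) {u : V → F} (hu : LocallyIntegrableOn u Ω volume) :
    Integrable fun y => φ y • u y := by
  have hu' : Integrable (S.indicator u) :=
    (integrable_indicator_iff hS.isClosed.measurableSet).2 (hu.integrableOn_compact_subset hSΩ hS)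
  have hc : HasCompactSupport φ := HasCompactSupport.intro hS hφS
  have h1 : Integrable fun y => φ y • S.indicator u y := by
    refine hu'.bdd_smul (⨆ y, ‖φ y‖) hφ.aestronglyMeasurable ?_
    exact Filter.Eventually.of_forall fun y => le_ciSup
        (hφ.norm.bddAbove_range_of_hasCompactSupport hc.norm) y
  refine h1.congr (Filter.Eventually.of_forall fun y => ?_)
  by_cases hy : y ∈ S
  · simp [hy]
  · simp [hφS y hy]

/-- Change of a test integral along a smooth family of test functions `N λ` whose velocity is
`- ∑ ∂_{v i} (Ψ i λ)`: the weak derivatives `g i` of `u` control the increment. -/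
theorem HasWeakDerivOn.enorm_integral_sub_le {𝕜 : Type*} [RCLike 𝕜] {ι : Type*} [Fintype ι]
    {Ω : Set V} {v : ι → V} {u : V → 𝕜} {g : ι → V → 𝕜}
    (hu : LocallyIntegrableOn u Ω volume) (h : ∀ i, HasWeakDerivOn Ω (v i) u (g i)) {a b : ℝ}
    (hab : a ≤ b) {S : Set V} (hS : IsCompact S) (hSΩ : S ⊆ Ω) {N : ℝ → V → ℝ}
    {Ψ : ι → ℝ × V → ℝ} (hΨ : ∀ i, ContDiff ℝ ∞ (Ψ i))
    (hΨS : ∀ i, ∀ l ∈ Icc a b, ∀ y ∉ S, Ψ i (l, y) = 0)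
    (hN : ∀ l y, HasDerivAt (fun l => N l y) (-∑ i, fderiv ℝ (fun y => Ψ i (l, y)) y (v i)) l)
    (hNS : ∀ l ∈ Icc a b, ∀ y ∉ S, N l y = 0) :
    ‖∫ y, (N b y - N a y) • u y‖ₑ ≤
      ∫⁻ l in Ioc a b, ∫⁻ y, ∑ i, ‖Ψ i (l, y)‖ₑ * ‖g i y‖ₑ := by
  have hSm : MeasurableSet S := hS.isClosed.measurableSet
  have hsec : ∀ i l, ContDiff ℝ ∞ (fun y => Ψ i (l, y)) := fun i l =>
    (hΨ i).comp (contDiff_const.prodMk contDiff_id)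
  have hfd : ∀ i l y, fderiv ℝ (fun y => Ψ i (l, y)) y (v i) = fderiv ℝ (Ψ i) (l, y) (0, v i) := by
    intro i l y
    have h1 : HasFDerivAt (Ψ i) (fderiv ℝ (Ψ i) (l, y)) (l, y) :=
      ((hΨ i).differentiable (by simp) (l, y)).hasFDerivAt
    have h2 : HasFDerivAt (fun y : V => (l, y)) (ContinuousLinearMap.inr ℝ ℝ V) y :=
      hasFDerivAt_prodMk_right l y
    have h3 : HasFDerivAt (fun y => Ψ i (l, y)) _ y := h1.comp y h2
    rw [h3.fderiv]
    simp
  set D : ℝ × V → ℝ := fun z => ∑ i, fderiv ℝ (Ψ i) z (0, v i) with hD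
  have hDc : Continuous D := by
    refine continuous_finsetSum _ fun i _ => ?_
    exact ((hΨ i).continuous_fderiv (by simp)).clm_apply continuous_const
  have hND : ∀ l y, HasDerivAt (fun l => N l y) (-D (l, y)) l := by
    intro l y
    have := hN l y
    simp only [hfd] at this
    exact this
  -- integrate the velocity in `l`; Fubini's theorem then brings in the weak derivatives
  have hNint : ∀ y, N b y - N a y = ∫ l in Ioc a b, -D (l, y) := by
    intro y
    rw [← intervalIntegral.integral_of_le hab]
    refine (intervalIntegral.integral_eq_sub_of_hasDerivAt (fun l _ => hND l y) ?_).symm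
    exact (Continuous.intervalIntegrable (by fun_prop) _ _)
  obtain ⟨M, hM⟩ : ∃ M, ∀ z ∈ Icc a b ×ˢ S, ‖D z‖ ≤ M :=
    (isCompact_Icc.prod hS).exists_bound_of_continuousOn hDc.continuousOn
  have hu' : Integrable (S.indicator u) :=
    (integrable_indicator_iff hSm).2 (hu.integrableOn_compact_subset hSΩ hS)
  have hint : Integrable (Function.uncurry fun (y : V) (l : ℝ) => -D (l, y) • S.indicator u y)
      (volume.prod (volume.restrict (Ioc a b))) := by
    have h1 : Integrable (fun z : V × ℝ => S.indicator u z.1)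
        (volume.prod (volume.restrict (Ioc a b))) := hu'.comp_fst _
    refine (h1.norm.const_mul M).mono' ?_ ?_
    · refine AEStronglyMeasurable.smul ?_ h1.aestronglyMeasurable
      exact Continuous.aestronglyMeasurable (by fun_prop)
    · have : ∀ᵐ z ∂((volume : Measure V).prod (volume.restrict (Ioc a b))), z.2 ∈ Ioc a b :=
        Measure.quasiMeasurePreserving_snd.ae (ae_restrict_mem measurableSet_Ioc)
      filter_upwards [this] with z hz
      simp only [Function.uncurry, norm_smul, norm_neg]
      by_cases hzS : z.1 ∈ S
      · gcongr
        exact hM _ ⟨Ioc_subset_Icc_self hz, hzS⟩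
      · simp [hzS]
  have e1 : ∫ y, (N b y - N a y) • u y =
      ∫ y, ∫ l in Ioc a b, -D (l, y) • S.indicator u y := by
    refine integral_congr_ae (Filter.Eventually.of_forall fun y => ?_)
    simp only
    rw [integral_smul_const, ← hNint]
    by_cases hy : y ∈ S
    · simp [hy]
    · rw [hNS b (right_mem_Icc.2 hab) y hy, hNS a (left_mem_Icc.2 hab) y hy]
      simp
  rw [e1, integral_integral_swap hint]
  refine (enorm_integral_le_lintegral_enorm _).trans
    (setLIntegral_mono_ae' measurableSet_Ioc (Filter.Eventually.of_forall fun l hl => ?_))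
  have hl' := Ioc_subset_Icc_self hl
  have hts : ∀ i, tsupport (fun y => Ψ i (l, y)) ⊆ S := fun i =>
    closure_minimal (fun y hy => by
      by_contra hc
      exact hy (hΨS i l hl' y hc)) hS.isClosed
  have hcs : ∀ i, HasCompactSupport (fun y => Ψ i (l, y)) := fun i =>
    hS.of_isClosed_subset (isClosed_tsupport _) (hts i)
  have hD0 : ∀ i, ∀ y ∉ S, fderiv ℝ (fun y => Ψ i (l, y)) y = 0 := by
    intro i y hy
    exact Function.notMem_support.1 fun h' => hy (hts i (support_fderiv_subset ℝ h'))
  have e2 : ∫ y, -D (l, y) • S.indicator u y = ∑ i, ∫ y, Ψ i (l, y) • g i y := by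
    have hi : ∀ i, Integrable fun y => (fderiv ℝ (fun y => Ψ i (l, y)) y (v i)) • u y := fun i =>
      integrable_smul_of_locallyIntegrableOn hS hSΩ
        (((hsec i l).continuous_fderiv (by simp)).clm_apply continuous_const)
        (fun y hy => by simp [hD0 i y hy]) hu
    calc ∫ y, -D (l, y) • S.indicator u y
        = ∫ y, -∑ i, (fderiv ℝ (fun y => Ψ i (l, y)) y (v i)) • u y := by
          refine integral_congr_ae (Filter.Eventually.of_forall fun y => ?_)
          simp only [hD, ← hfd, ← Finset.sum_smul, neg_smul]
          by_cases hy : y ∈ S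
          · simp [hy]
          · simp [hy, hD0 _ y hy]
      _ = ∑ i, ∫ y, Ψ i (l, y) • g i y := by
          rw [integral_neg, integral_finsetSum _ fun i _ => hi i, ← Finset.sum_neg_distrib]
          refine Finset.sum_congr rfl fun i _ => ?_
          rw [(h i).integral_eq _ (hsec i l) (hcs i) ((hts i).trans hSΩ), neg_neg]
  rw [e2]
  refine (enorm_sum_le _ _).trans ?_
  have hgm : ∀ i, AEMeasurable (fun y => ‖Ψ i (l, y)‖ₑ * ‖g i y‖ₑ) := by
    intro i
    have := (integrable_smul_of_locallyIntegrableOn hS hSΩ (hsec i l).continuous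
      (hΨS i l hl') (h i).locallyIntegrableOn_deriv).aestronglyMeasurable.enorm
    simpa only [enorm_smul] using this
  rw [lintegral_finsetSum' _ fun i _ => hgm i]
  refine Finset.sum_le_sum fun i _ => (enorm_integral_le_lintegral_enorm _).trans_eq ?_
  simp only [enorm_smul]

lemma HasWeakDerivOn.exists_stronglyMeasurable {𝕜 : Type*} [RCLike 𝕜] {Ω : Set V}
    (hΩ : IsOpen Ω) {v : V} {u g : V → 𝕜} (h : HasWeakDerivOn Ω v u g) :
    ∃ g' : V → 𝕜, StronglyMeasurable g' ∧ (∀ᵐ x, x ∈ Ω → g x = g' x) ∧ HasWeakDerivOn Ω v u g' := by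
  have hm := h.locallyIntegrableOn_deriv.aestronglyMeasurable
  have hae : ∀ᵐ x, x ∈ Ω → g x = hm.mk g x := by
    rw [← ae_restrict_iff' hΩ.measurableSet]; exact hm.ae_eq_mk
  refine ⟨hm.mk g, hm.stronglyMeasurable_mk, hae, h.locallyIntegrableOn, ?_, fun φ h1 h2 h3 => ?_⟩
  · rw [locallyIntegrableOn_iff hΩ.isLocallyClosed]
    intro S hS hSc
    refine (h.locallyIntegrableOn_deriv.integrableOn_compact_subset hS hSc).congr ?_
    exact ae_mono (Measure.restrict_mono hS le_rfl) hm.ae_eq_mk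
  · rw [h.integral_eq φ h1 h2 h3]
    congr 1
    refine integral_congr_ae ?_
    filter_upwards [hae] with x hx
    by_cases hxS : x ∈ tsupport φ
    · simp only [hx (h3 hxS)]
    · simp [image_eq_zero_of_notMem_tsupport hxS]

lemma HasWeakDerivOn.mono {𝕜 : Type*} [RCLike 𝕜] {Ω Ω' : Set V} (hΩ : Ω' ⊆ Ω) {v : V}
    {u g : V → 𝕜} (h : HasWeakDerivOn Ω v u g) : HasWeakDerivOn Ω' v u g :=
  ⟨h.locallyIntegrableOn.mono_set hΩ, h.locallyIntegrableOn_deriv.mono_set hΩ,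
    fun φ h1 h2 h3 => h.integral_eq φ h1 h2 (h3.trans hΩ)⟩

lemma HasWeakDerivOn.sub {𝕜 : Type*} [RCLike 𝕜] {Ω : Set V} {v : V}
    {u g u' g' : V → 𝕜} (h : HasWeakDerivOn Ω v u g) (h' : HasWeakDerivOn Ω v u' g') :
    HasWeakDerivOn Ω v (fun x => u x - u' x) (fun x => g x - g' x) := by
  refine ⟨h.locallyIntegrableOn.sub h'.locallyIntegrableOn,
    h.locallyIntegrableOn_deriv.sub h'.locallyIntegrableOn_deriv, fun φ h1 h2 h3 => ?_⟩
  have hD : Continuous fun x => fderiv ℝ φ x v :=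
    (h1.continuous_fderiv (by simp)).clm_apply continuous_const
  have hD0 : ∀ x ∉ tsupport φ, fderiv ℝ φ x v = 0 := fun x hx => by
    have : fderiv ℝ φ x = 0 :=
      Function.notMem_support.1 fun h' => hx (support_fderiv_subset ℝ h')
    simp [this]
  have hφ0 : ∀ x ∉ tsupport φ, φ x = 0 := fun x hx => image_eq_zero_of_notMem_tsupport hx
  simp only [smul_sub]
  rw [integral_sub (integrable_smul_of_locallyIntegrableOn h2 h3 hD hD0 h.locallyIntegrableOn)
    (integrable_smul_of_locallyIntegrableOn h2 h3 hD hD0 h'.locallyIntegrableOn),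
    integral_sub
    (integrable_smul_of_locallyIntegrableOn h2 h3 h1.continuous hφ0 h.locallyIntegrableOn_deriv)
    (integrable_smul_of_locallyIntegrableOn h2 h3 h1.continuous hφ0 h'.locallyIntegrableOn_deriv),
    h.integral_eq φ h1 h2 h3, h'.integral_eq φ h1 h2 h3]
  ring

/-- The fundamental theorem of calculus for weak derivatives, as an inequality: the increment of
`u` along the segment from `x` to `x + r v` is at most the integral of the derivative. -/
theorem HasWeakDerivOn.ae_enorm_translate_sub_le {𝕜 : Type*} [RCLike 𝕜] {Ω : Set V}
    (hΩ : IsOpen Ω) {v : V} {u g : V → 𝕜} (h : HasWeakDerivOn Ω v u g) (hg : StronglyMeasurable g)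
    {r : ℝ} (hr : 0 ≤ r) (hΩr : ∀ x ∈ Ω, ∀ θ ∈ Icc 0 r, x + θ • v ∈ Ω) :
    ∀ᵐ x, x ∈ Ω → ‖u (x + r • v) - u x‖ₑ ≤ ∫⁻ θ in Ioc 0 r, ‖g (x + θ • v)‖ₑ := by
  -- the set swept out by a compact set stays compact in `Ω`
  have hsw : ∀ S ⊆ Ω, IsCompact S → ∃ S' ⊆ Ω, IsCompact S' ∧
      ∀ x ∈ S, ∀ θ ∈ Icc 0 r, x + θ • v ∈ S' := by
    intro S hSΩ hS
    refine ⟨(fun z : V × ℝ => z.1 + z.2 • v) '' (S ×ˢ Icc 0 r), ?_,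
      (hS.prod isCompact_Icc).image (by fun_prop), fun x hx θ hθ => ⟨(x, θ), ⟨hx, hθ⟩, rfl⟩⟩
    rintro _ ⟨⟨x, θ⟩, ⟨hx, hθ⟩, rfl⟩
    exact hΩr x (hSΩ hx) θ hθ
  have hr' : r ∈ Icc 0 r := ⟨hr, le_rfl⟩
  have hmeas : Measurable fun z : V × ℝ => ‖g (z.1 + z.2 • v)‖ₑ :=
    (hg.comp_measurable (by fun_prop)).enorm
  have hloc : LocallyIntegrableOn (fun x => u (x + r • v)) Ω volume := by
    rw [locallyIntegrableOn_iff hΩ.isLocallyClosed]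
    intro S hSΩ hS
    obtain ⟨S', hS'Ω, hS', hmem⟩ := hsw S hSΩ hS
    have h1 : IntegrableOn u ((fun x => x + r • v) '' S) :=
      (h.locallyIntegrableOn.integrableOn_compact_subset hS'Ω hS').mono_set (by
        rintro _ ⟨x, hx, rfl⟩; exact hmem x hx r hr')
    have := (measurePreserving_add_right volume (r • v)).integrableOn_comp_preimage
      (MeasurableEquiv.addRight (r • v)).measurableEmbedding (f := u)
      (s := (fun x => x + r • v) '' S)
    rw [preimage_image_eq _ (add_left_injective _)] at this
    exact this.2 h1
  refine ae_enorm_le_of_enorm_integral_smul_le hΩ (hloc.sub h.locallyIntegrableOn)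
    hmeas.lintegral_prod_right'.aemeasurable ?_ ?_
  · intro S hSΩ hS
    obtain ⟨S', hS'Ω, hS', hmem⟩ := hsw S hSΩ hS
    rw [lintegral_lintegral_swap hmeas.aemeasurable]
    have hb : ∀ θ ∈ Ioc 0 r, ∫⁻ x in S, ‖g (x + θ • v)‖ₑ ≤ ∫⁻ x in S', ‖g x‖ₑ := by
      intro θ hθ
      rw [← lintegral_indicator hS.isClosed.measurableSet,
        ← lintegral_indicator hS'.isClosed.measurableSet,
        ← lintegral_add_right_eq_self (S'.indicator fun x => ‖g x‖ₑ) (θ • v)]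
      refine lintegral_mono fun x => ?_
      by_cases hx : x ∈ S
      · simp [hx, hmem x hx θ (Ioc_subset_Icc_self hθ)]
      · simp [hx]
    refine ((setLIntegral_mono' measurableSet_Ioc hb).trans_lt ?_).ne
    rw [setLIntegral_const]
    refine ENNReal.mul_lt_top ?_ (by simp)
    exact (h.locallyIntegrableOn_deriv.integrableOn_compact_subset hS'Ω hS').hasFiniteIntegral
  · intro η hη hηc hηΩ
    obtain ⟨S', hS'Ω, hS', hmem⟩ := hsw _ hηΩ hηc
    have hz : ∀ θ ∈ Icc 0 r, ∀ y ∉ S', η (y - θ • v) = 0 := by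
      intro θ hθ y hy
      refine image_eq_zero_of_notMem_tsupport fun hc => hy ?_
      have := hmem _ hc θ hθ
      rwa [sub_add_cancel] at this
    -- the translates `η (y - θ v)` move with velocity `-∂_v η (y - θ v)`
    have key := HasWeakDerivOn.enorm_integral_sub_le (ι := Unit) (v := fun _ => v)
      (g := fun _ => g) h.locallyIntegrableOn (fun _ => h) hr hS' hS'Ω
      (N := fun θ y => η (y - θ • v)) (Ψ := fun _ z => η (z.2 - z.1 • v))
      (fun _ => by fun_prop) (fun _ => hz) (fun l y => by
        have h1 : HasFDerivAt η (fderiv ℝ η (y - l • v)) (y - l • v) :=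
          (hη.differentiable (by simp) _).hasFDerivAt
        have h2 : HasDerivAt (fun l : ℝ => y - l • v) (-v) l := by
          simpa using ((hasDerivAt_id l).smul_const v).const_sub y
        have h3 : HasFDerivAt (fun y : V => y - l • v) (ContinuousLinearMap.id ℝ V) y :=
          (hasFDerivAt_id y).sub_const _
        have h4 : HasFDerivAt (fun y : V => η (y - l • v)) _ y := h1.comp y h3
        have := h1.comp_hasDerivAt l h2
        simpa [h4.fderiv, Function.comp_def] using this) hz
    have e1 : ∫ x, η x • (u (x + r • v) - u x) =
        ∫ y, (η (y - r • v) - η (y - (0 : ℝ) • v)) • u y := by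
      have i1 := integrable_smul_of_locallyIntegrableOn hηc hηΩ hη.continuous
        (fun x hx => image_eq_zero_of_notMem_tsupport hx) hloc
      have i2 := integrable_smul_of_locallyIntegrableOn hηc hηΩ hη.continuous
        (fun x hx => image_eq_zero_of_notMem_tsupport hx) h.locallyIntegrableOn
      have i3 := integrable_smul_of_locallyIntegrableOn hS' hS'Ω
        (φ := fun y => η (y - r • v)) (by fun_prop) (hz r hr') h.locallyIntegrableOn
      simp only [smul_sub, sub_smul, zero_smul, sub_zero]
      rw [integral_sub i1 i2, integral_sub i3 i2,
        ← integral_add_right_eq_self (fun y => η (y - r • v) • u y) (r • v)]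
      simp
    have e2 : ∀ θ : ℝ, ∫⁻ y, ‖η (y - θ • v)‖ₑ * ‖g y‖ₑ = ∫⁻ x, ‖η x‖ₑ * ‖g (x + θ • v)‖ₑ := by
      intro θ
      rw [← lintegral_add_right_eq_self (fun y => ‖η (y - θ • v)‖ₑ * ‖g y‖ₑ) (θ • v)]
      simp
    change ‖∫ x, η x • (u (x + r • v) - u x)‖ₑ ≤ _
    rw [e1]
    refine key.trans_eq ?_
    simp only [Finset.univ_unique, Finset.sum_const, Finset.card_singleton, one_smul, e2]
    have hm2 : Measurable fun z : ℝ × V => ‖η z.2‖ₑ * ‖g (z.2 + z.1 • v)‖ₑ :=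
      (hη.continuous.measurable.comp measurable_snd).enorm.mul
        (hg.comp_measurable (by fun_prop)).enorm
    rw [lintegral_lintegral_swap hm2.aemeasurable]
    refine lintegral_congr fun x => ?_
    rw [lintegral_const_mul]
    exact (hg.comp_measurable (by fun_prop)).enorm

end Weak

/-! ### The fundamental theorem of calculus along rays -/

section Rays

lemma sq_lintegral_mul_le {Y : Type*} [MeasurableSpace Y] {ν : Measure Y} {f g : Y → ℝ≥0∞}
    (hf : AEMeasurable f ν) (hg : AEMeasurable g ν) :
    (∫⁻ y, f y * g y ∂ν) ^ 2 ≤ (∫⁻ y, f y ^ 2 ∂ν) * ∫⁻ y, g y ^ 2 ∂ν := by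
  have h := ENNReal.lintegral_mul_le_Lp_mul_Lq ν Real.HolderConjugate.two_two hf hg
  simp only [Pi.mul_apply, ENNReal.rpow_two] at h
  calc (∫⁻ y, f y * g y ∂ν) ^ 2
      ≤ ((∫⁻ y, f y ^ 2 ∂ν) ^ (1 / 2 : ℝ) * (∫⁻ y, g y ^ 2 ∂ν) ^ (1 / 2 : ℝ)) ^ 2 := by gcongr
    _ = _ := by
      rw [mul_pow, ← ENNReal.rpow_mul_natCast, ← ENNReal.rpow_mul_natCast]
      norm_num

lemma lintegral_comp_smul_of_pos {V : Type*} [NormedAddCommGroup V] [NormedSpace ℝ V]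
    [MeasureSpace V] [BorelSpace V] [FiniteDimensional ℝ V] [(volume : Measure V).IsAddHaarMeasure]
    (f : V → ℝ≥0∞) {c : ℝ} (hc : 0 < c) :
    ∫⁻ x, f (c • x) = ENNReal.ofReal (c ^ (-(Module.finrank ℝ V : ℝ))) * ∫⁻ x, f x := by
  have h1 := (Homeomorph.smulOfNeZero c hc.ne').measurableEmbedding.lintegral_map
    (μ := (volume : Measure V)) f
  have h2 : Measure.map (Homeomorph.smulOfNeZero c hc.ne') (volume : Measure V) =
      Measure.map (fun x : V => c • x) volume := rfl
  rw [h2, Measure.map_addHaar_smul _ hc.ne', lintegral_smul_measure] at h1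
  rw [show (∫⁻ x, f (c • x)) = ∫⁻ a, f (Homeomorph.smulOfNeZero c hc.ne' a) from rfl, ← h1,
    smul_eq_mul, abs_of_nonneg (by positivity), Real.rpow_neg hc.le, Real.rpow_natCast]

variable {d : ℕ}

local notation "E" => EuclideanSpace ℝ (Fin d)

lemma enorm_coord_le (y : E) (i : Fin d) : ‖y i‖ₑ ≤ ‖y‖ₑ := by
  rw [enorm_le_iff_norm_le]
  exact PiLp.norm_apply_le y i

/-- The dilation `θ ↦ e^{-dθ} η(e^{-θ} y)` moves with velocity `- div (e^{-dθ} η(e^{-θ} y) y)`. -/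
lemma hasDerivAt_dilation {η : E → ℝ} (hη : ContDiff ℝ ∞ η) (l : ℝ) (y : E) :
    HasDerivAt (fun l : ℝ => Real.exp (-(d * l)) * η (Real.exp (-l) • y))
      (-∑ i, fderiv ℝ (fun y : E => Real.exp (-(d * l)) * (y i * η (Real.exp (-l) • y))) y
        (EuclideanSpace.single i 1)) l := by
  have hη' : HasFDerivAt η (fderiv ℝ η (Real.exp (-l) • y)) (Real.exp (-l) • y) :=
    (hη.differentiable (by simp) _).hasFDerivAt
  have hsp : ∀ i, fderiv ℝ (fun y : E => Real.exp (-(d * l)) * (y i * η (Real.exp (-l) • y))) y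
      (EuclideanSpace.single i 1) =
      Real.exp (-(d * l)) * (η (Real.exp (-l) • y) +
        y i * (Real.exp (-l) * fderiv ℝ η (Real.exp (-l) • y) (EuclideanSpace.single i 1))) := by
    intro i
    have h1 : HasFDerivAt (fun y : E => y i) (EuclideanSpace.proj (𝕜 := ℝ) i) y :=
      (EuclideanSpace.proj (𝕜 := ℝ) i).hasFDerivAt
    have h2 : HasFDerivAt (fun y : E => Real.exp (-l) • y)
        (Real.exp (-l) • ContinuousLinearMap.id ℝ E) y :=
      (hasFDerivAt_id y).const_smul (Real.exp (-l))
    have h3 : HasFDerivAt (fun y : E => η (Real.exp (-l) • y)) _ y := hη'.comp y h2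
    have h4 := (h1.mul h3).const_mul (Real.exp (-(d * l)))
    have h5 : HasFDerivAt (fun y : E => Real.exp (-(d * l)) * (y i * η (Real.exp (-l) • y))) _ y :=
      h4
    rw [h5.fderiv]
    simp
    ring
  have hsum : y = ∑ i, y i • EuclideanSpace.single i (1 : ℝ) := by
    ext j
    simp [Finset.sum_apply, Pi.single_apply]
  have hdiv : ∑ i, y i * fderiv ℝ η (Real.exp (-l) • y) (EuclideanSpace.single i 1) =
      fderiv ℝ η (Real.exp (-l) • y) y := by
    conv_rhs => rw [hsum, map_sum]
    simp [← hsum]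
  have h1 : HasDerivAt (fun l : ℝ => Real.exp (-l) • y) (-Real.exp (-l) • y) l := by
    simpa using ((hasDerivAt_id l).neg.exp).smul_const y
  have h2 : HasDerivAt (fun l : ℝ => Real.exp (-(d * l))) (-(Real.exp (-(d * l)) * d)) l := by
    simpa using (((hasDerivAt_id l).const_mul (d : ℝ)).neg.exp)
  have h3 := h2.mul (hη'.comp_hasDerivAt l h1)
  refine h3.congr_deriv ?_
  simp only [hsp, ← Finset.mul_sum, Finset.sum_add_distrib, Finset.sum_const, Finset.card_univ,
    Fintype.card_fin, nsmul_eq_mul, map_smul, map_neg, neg_smul, smul_eq_mul,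
    mul_left_comm (y _), ← Finset.mul_sum, hdiv, Function.comp_apply]
  ring

lemma measurable_dilation_sum {𝕜 : Type*} [RCLike 𝕜] {g : Fin d → E → 𝕜}
    (hg : ∀ i, StronglyMeasurable (g i)) : Measurable fun z : E × ℝ =>
      ∑ i, ‖Real.exp z.2 • z.1‖ₑ * ‖g i (Real.exp z.2 • z.1)‖ₑ := by
  have hs : Measurable fun z : E × ℝ => Real.exp z.2 • z.1 := by fun_prop
  exact Finset.measurable_fun_sum _ fun i _ => hs.enorm.mul ((hg i).comp_measurable hs).enorm

lemma lintegral_dilation_le {𝕜 : Type*} [RCLike 𝕜] (η : E → ℝ) (g : Fin d → E → 𝕜) (θ : ℝ) :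
    ∫⁻ y, ∑ i, ‖Real.exp (-(d * θ)) * (y i * η (Real.exp (-θ) • y))‖ₑ * ‖g i y‖ₑ ≤
      ∫⁻ z, ‖η z‖ₑ * ∑ i, ‖Real.exp θ • z‖ₑ * ‖g i (Real.exp θ • z)‖ₑ := by
  have h1 := lintegral_comp_smul_of_pos (fun y : E =>
    ∑ i, ‖Real.exp (-(d * θ)) * (y i * η (Real.exp (-θ) • y))‖ₑ * ‖g i y‖ₑ)
    (Real.exp_pos θ)
  have h2 : ENNReal.ofReal (Real.exp (d * θ)) *
      ENNReal.ofReal (Real.exp θ ^ (-(Module.finrank ℝ E : ℝ))) = 1 := by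
    rw [← ENNReal.ofReal_mul (by positivity), ← Real.exp_mul, ← Real.exp_add,
      finrank_euclideanSpace_fin]
    simp [mul_comm]
  have h3 : ∫⁻ y, ∑ i, ‖Real.exp (-(d * θ)) * (y i * η (Real.exp (-θ) • y))‖ₑ * ‖g i y‖ₑ =
      ENNReal.ofReal (Real.exp (d * θ)) * ∫⁻ z, ∑ i, ‖Real.exp (-(d * θ)) *
        ((Real.exp θ • z) i * η (Real.exp (-θ) • Real.exp θ • z))‖ₑ * ‖g i (Real.exp θ • z)‖ₑ := by
    rw [h1, ← mul_assoc, h2, one_mul]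
  rw [h3, ← lintegral_const_mul' _ _ ENNReal.ofReal_ne_top]
  refine lintegral_mono fun z => ?_
  simp only [Finset.mul_sum]
  refine Finset.sum_le_sum fun i _ => ?_
  have h4 : Real.exp (-(d * θ)) * ((Real.exp θ • z) i * η (Real.exp (-θ) • Real.exp θ • z)) =
      Real.exp (-(d * θ)) * ((Real.exp θ • z) i * η z) := by
    simp [smul_smul, ← Real.exp_add]
  rw [h4, enorm_mul, enorm_mul, Real.enorm_of_nonneg (Real.exp_pos _).le]
  calc ENNReal.ofReal (Real.exp (d * θ)) * (ENNReal.ofReal (Real.exp (-(d * θ))) *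
        (‖(Real.exp θ • z) i‖ₑ * ‖η z‖ₑ) * ‖g i (Real.exp θ • z)‖ₑ)
      = (ENNReal.ofReal (Real.exp (d * θ)) * ENNReal.ofReal (Real.exp (-(d * θ)))) *
        (‖η z‖ₑ * (‖(Real.exp θ • z) i‖ₑ * ‖g i (Real.exp θ • z)‖ₑ)) := by ring
    _ ≤ 1 * (‖η z‖ₑ * (‖Real.exp θ • z‖ₑ * ‖g i (Real.exp θ • z)‖ₑ)) := by
      gcongr
      · rw [← ENNReal.ofReal_mul (by positivity), ← Real.exp_add]; simp
      · exact enorm_coord_le _ i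
    _ = _ := one_mul _

lemma lintegral_lintegral_ray_swap {𝕜 : Type*} [RCLike 𝕜] {η : E → ℝ} (hη : Continuous η)
    {g : Fin d → E → 𝕜} (hg : ∀ i, StronglyMeasurable (g i)) :
    ∫⁻ θ in Ioi (0 : ℝ), ∫⁻ z, ‖η z‖ₑ * ∑ i, ‖Real.exp θ • z‖ₑ * ‖g i (Real.exp θ • z)‖ₑ =
      ∫⁻ z, ‖η z‖ₑ * ∫⁻ θ in Ioi (0 : ℝ), ∑ i, ‖Real.exp θ • z‖ₑ * ‖g i (Real.exp θ • z)‖ₑ := by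
  set G : E × ℝ → ℝ≥0∞ := fun z => ∑ i, ‖Real.exp z.2 • z.1‖ₑ * ‖g i (Real.exp z.2 • z.1)‖ₑ
    with hG
  have hGm : Measurable G := measurable_dilation_sum hg
  have h1 : Measurable fun z : ℝ × E => ‖η z.2‖ₑ * G (z.2, z.1) :=
    Measurable.mul (hη.measurable.comp measurable_snd).enorm
      (hGm.comp (measurable_snd.prodMk measurable_fst))
  change ∫⁻ θ in Ioi (0 : ℝ), ∫⁻ z, ‖η z‖ₑ * G (z, θ) =
    ∫⁻ z, ‖η z‖ₑ * ∫⁻ θ in Ioi (0 : ℝ), G (z, θ)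
  rw [lintegral_lintegral_swap h1.aemeasurable]
  refine lintegral_congr fun z => ?_
  rw [lintegral_const_mul]
  exact hGm.comp measurable_prodMk_left

/-- The fundamental theorem of calculus along the rays `θ ↦ e^θ z`, for a function with vanishing
weak limit at infinity. -/
theorem ae_enorm_le_lintegral_ray {𝕜 : Type*} [RCLike 𝕜] {u : E → 𝕜} {g : Fin d → E → 𝕜}
    (hu : LocallyIntegrableOn u {0}ᶜ volume)
    (h : ∀ i, HasWeakDerivOn {0}ᶜ (EuclideanSpace.single i 1) u (g i))
    (hg : ∀ i, StronglyMeasurable (g i))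
    (hdecay : ∀ η : E → ℝ, ContDiff ℝ ∞ η → HasCompactSupport η → tsupport η ⊆ {0}ᶜ →
      Filter.Tendsto (fun θ : ℝ => ∫ y, η y • u (Real.exp θ • y)) Filter.atTop (nhds 0))
    (hfin : ∀ S ⊆ {0}ᶜ, IsCompact S →
      ∫⁻ z in S, ∫⁻ θ in Ioi (0 : ℝ), ∑ i, ‖Real.exp θ • z‖ₑ * ‖g i (Real.exp θ • z)‖ₑ ≠ ⊤) :
    ∀ᵐ z, z ∈ ({0}ᶜ : Set E) →
      ‖u z‖ₑ ≤ ∫⁻ θ in Ioi (0 : ℝ), ∑ i, ‖Real.exp θ • z‖ₑ * ‖g i (Real.exp θ • z)‖ₑ := by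
  have hmeas : Measurable fun z : E × ℝ =>
      ∑ i, ‖Real.exp z.2 • z.1‖ₑ * ‖g i (Real.exp z.2 • z.1)‖ₑ := measurable_dilation_sum hg
  refine ae_enorm_le_of_enorm_integral_smul_le isOpen_compl_singleton hu
    hmeas.lintegral_prod_right'.aemeasurable hfin fun η hη hηc hηΩ => ?_
  -- the increment up to the dilation `e^Θ`
  have key : ∀ Θ : ℝ, 0 ≤ Θ →
      ‖(∫ y, η y • u (Real.exp Θ • y)) - ∫ y, η y • u y‖ₑ ≤
      ∫⁻ z, ‖η z‖ₑ * ∫⁻ θ in Ioi (0 : ℝ), ∑ i, ‖Real.exp θ • z‖ₑ * ‖g i (Real.exp θ • z)‖ₑ := by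
    intro Θ hΘ
    set S : Set E := (fun z : E × ℝ => Real.exp z.2 • z.1) '' (tsupport η ×ˢ Icc 0 Θ) with hSdef
    have hS : IsCompact S := (hηc.prod isCompact_Icc).image (by fun_prop)
    have hSΩ : S ⊆ {0}ᶜ := by
      rintro _ ⟨⟨x, θ⟩, ⟨hx, -⟩, rfl⟩
      have : x ≠ 0 := hηΩ hx
      simp [this, Real.exp_ne_zero]
    have hz : ∀ θ ∈ Icc 0 Θ, ∀ y ∉ S, η (Real.exp (-θ) • y) = 0 := by
      intro θ hθ y hy
      refine image_eq_zero_of_notMem_tsupport fun hc => hy ⟨(Real.exp (-θ) • y, θ), ⟨hc, hθ⟩, ?_⟩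
      simp [smul_smul, ← Real.exp_add]
    set N : ℝ → E → ℝ := fun θ y => Real.exp (-(d * θ)) * η (Real.exp (-θ) • y) with hN
    set Ψ : Fin d → ℝ × E → ℝ := fun i z =>
      Real.exp (-(d * z.1)) * (z.2 i * η (Real.exp (-z.1) • z.2)) with hΨ
    have hcoord : ∀ i : Fin d, ContDiff ℝ ∞ fun y : E => y i := fun i =>
      (EuclideanSpace.proj (𝕜 := ℝ) i).contDiff
    have hΨc : ∀ i, ContDiff ℝ ∞ (Ψ i) := by
      intro i
      have h1 : ContDiff ℝ ∞ fun z : ℝ × E => z.2 i := (hcoord i).comp contDiff_snd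
      have h2 : ContDiff ℝ ∞ fun z : ℝ × E => η (Real.exp (-z.1) • z.2) :=
        hη.comp ((Real.contDiff_exp.comp contDiff_fst.neg).smul contDiff_snd)
      exact (Real.contDiff_exp.comp (contDiff_const.mul contDiff_fst).neg).mul (h1.mul h2)
    have hder : ∀ l y, HasDerivAt (fun l => N l y)
        (-∑ i, fderiv ℝ (fun y => Ψ i (l, y)) y (EuclideanSpace.single i 1)) l := by
      intro l y
      exact hasDerivAt_dilation hη l y
    have main := HasWeakDerivOn.enorm_integral_sub_le hu h hΘ hS hSΩ hΨc
      (fun i l hl y hy => by simp [hΨ, hz l hl y hy]) hder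
      (fun l hl y hy => by simp [hN, hz l hl y hy])
    have hNint : ∀ θ ∈ Icc 0 Θ, Integrable fun y => N θ y • u y := fun θ hθ =>
      integrable_smul_of_locallyIntegrableOn hS hSΩ (by simp only [hN]; fun_prop)
        (fun y hy => by simp [hN, hz θ hθ y hy]) hu
    have hNeq : ∀ θ : ℝ, ∫ y, N θ y • u y = ∫ y, η y • u (Real.exp θ • y) := by
      intro θ
      have := Measure.integral_comp_smul_of_nonneg volume
        (fun y : E => N θ y • u y) (Real.exp θ) (hR := (Real.exp_pos θ).le)
      have e : Real.exp θ ^ d ≠ 0 := by positivity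
      rw [finrank_euclideanSpace_fin, eq_comm, inv_smul_eq_iff₀ e, ← integral_smul] at this
      rw [this]
      refine integral_congr_ae (Filter.Eventually.of_forall fun y => ?_)
      simp only [hN, smul_smul, ← Real.exp_add, ← Real.exp_nat_mul]
      simp [← mul_assoc, ← Real.exp_add]
    have e1 : (∫ y, η y • u (Real.exp Θ • y)) - ∫ y, η y • u y = ∫ y, (N Θ y - N 0 y) • u y := by
      simp only [sub_smul]
      rw [integral_sub (hNint Θ ⟨hΘ, le_rfl⟩) (hNint 0 ⟨le_rfl, hΘ⟩), hNeq, hNeq]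
      simp
    rw [e1]
    refine main.trans ?_
    have e2 := fun θ : ℝ => lintegral_dilation_le η g θ
    calc ∫⁻ θ in Ioc 0 Θ, ∫⁻ y, ∑ i, ‖Ψ i (θ, y)‖ₑ * ‖g i y‖ₑ
        ≤ ∫⁻ θ in Ioi (0 : ℝ), ∫⁻ z, ‖η z‖ₑ *
            ∑ i, ‖Real.exp θ • z‖ₑ * ‖g i (Real.exp θ • z)‖ₑ :=
          lintegral_mono' (Measure.restrict_mono Ioc_subset_Ioi_self le_rfl) e2
      _ = _ := lintegral_lintegral_ray_swap hη.continuous hg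
  -- the dilated term disappears as `Θ → ∞`
  have hl := ((hdecay η hη hηc hηΩ).sub_const (∫ y, η y • u y)).enorm
  rw [zero_sub, enorm_neg] at hl
  exact le_of_tendsto hl ((Filter.eventually_ge_atTop 0).mono key)

end Rays

/-! ### A weighted Hardy inequality -/

section WeightedHardy

variable {d : ℕ}

local notation "E" => EuclideanSpace ℝ (Fin d)

/-- `u` vanishes at infinity in the weak sense: its dilates `u(e^θ ·)` tend to zero on test
functions supported away from the origin. -/
def VanishesAtInfinity {𝕜 : Type*} [RCLike 𝕜] (u : E → 𝕜) : Prop :=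
  ∀ η : E → ℝ, ContDiff ℝ ∞ η → HasCompactSupport η → tsupport η ⊆ {0}ᶜ →
    Filter.Tendsto (fun θ : ℝ => ∫ y, η y • u (Real.exp θ • y)) Filter.atTop (nhds 0)

lemma exists_pos_le_norm_of_tsupport {η : E → ℝ} (hη : tsupport η ⊆ {0}ᶜ) :
    ∃ δ > 0, ∀ y, η y ≠ 0 → δ ≤ ‖y‖ := by
  have h0 : (tsupport η)ᶜ ∈ nhds (0 : E) :=
    (isClosed_tsupport η).isOpen_compl.mem_nhds fun h => hη h rfl
  obtain ⟨δ, hδ, hs⟩ := Metric.mem_nhds_iff.1 h0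
  refine ⟨δ, hδ, fun y hy => ?_⟩
  by_contra hc
  exact hs (mem_ball_zero_iff.2 (not_le.1 hc)) (subset_tsupport _ hy)

lemma lintegral_exp_neg_mul_Ioi {c : ℝ} (hc : 0 < c) :
    ∫⁻ θ in Ioi (0 : ℝ), ENNReal.ofReal (Real.exp (-c * θ)) = ENNReal.ofReal (1 / c) := by
  have h := integrableOn_exp_mul_Ioi (a := -c) (by linarith) 0
  rw [← ofReal_integral_eq_lintegral_ofReal h
    (Filter.Eventually.of_forall fun _ => (Real.exp_pos _).le), integral_exp_mul_Ioi (by linarith)]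
  simp [neg_div_neg_eq]

lemma lintegral_weight_mul_comp_exp_smul {κ : ℝ} (hκ : 0 ≤ κ) (P : E → ℝ≥0∞) (θ : ℝ) :
    ∫⁻ z : E, ‖z‖ₑ ^ κ * P (Real.exp θ • z) =
      ENNReal.ofReal (Real.exp (-(κ + d) * θ)) * ∫⁻ y : E, ‖y‖ₑ ^ κ * P y := by
  have h1 := lintegral_comp_smul_of_pos (fun y : E => ‖y‖ₑ ^ κ * P y) (Real.exp_pos θ)
  have h2 : ∀ z : E, ‖z‖ₑ ^ κ * P (Real.exp θ • z) = ENNReal.ofReal (Real.exp (-κ * θ)) *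
      (‖Real.exp θ • z‖ₑ ^ κ * P (Real.exp θ • z)) := by
    intro z
    rw [enorm_smul, ENNReal.mul_rpow_of_nonneg _ _ hκ, Real.enorm_of_nonneg (Real.exp_pos _).le,
      ENNReal.ofReal_rpow_of_nonneg (Real.exp_pos _).le hκ, ← Real.exp_mul, ← mul_assoc,
      ← mul_assoc, ← ENNReal.ofReal_mul (Real.exp_pos _).le, ← Real.exp_add]
    simp [mul_comm κ]
  simp only [h2]
  rw [lintegral_const_mul' _ _ ENNReal.ofReal_ne_top, h1, ← mul_assoc,
    ← ENNReal.ofReal_mul (by positivity), ← Real.exp_mul, ← Real.exp_add,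
    finrank_euclideanSpace_fin]
  congr 3; ring

/-- Hardy's inequality for the integral along rays, in a weighted `L₂`. -/
lemma lintegral_weight_mul_ray_sq_le (hd : 1 ≤ d) {κ : ℝ} (hκ : 0 ≤ κ) {P : E → ℝ≥0∞}
    (hP : Measurable P) :
    ∫⁻ z : E, ‖z‖ₑ ^ κ * (∫⁻ θ in Ioi (0 : ℝ), P (Real.exp θ • z)) ^ 2 ≤
      4 * ∫⁻ y : E, ‖y‖ₑ ^ κ * P y ^ 2 := by
  set W := ∫⁻ y : E, ‖y‖ₑ ^ κ * P y ^ 2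
  have hPm : Measurable fun z : E × ℝ => P (Real.exp z.2 • z.1) := hP.comp (by fun_prop)
  have hexp : Measurable fun z : E × ℝ => ENNReal.ofReal (Real.exp (z.2 / 2)) := by fun_prop
  -- Cauchy–Schwarz with the weight `e^{θ/2}`
  have hCS : ∀ z : E, (∫⁻ θ in Ioi (0 : ℝ), P (Real.exp θ • z)) ^ 2 ≤
      2 * ∫⁻ θ in Ioi (0 : ℝ), ENNReal.ofReal (Real.exp (θ / 2)) * P (Real.exp θ • z) ^ 2 := by
    intro z
    have h1 : ∀ θ : ℝ, P (Real.exp θ • z) = ENNReal.ofReal (Real.exp (-(θ / 4))) *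
        (ENNReal.ofReal (Real.exp (θ / 4)) * P (Real.exp θ • z)) := by
      intro θ
      rw [← mul_assoc, ← ENNReal.ofReal_mul (by positivity), ← Real.exp_add]
      simp
    have hPz : Measurable fun θ : ℝ => P (Real.exp θ • z) := hPm.comp measurable_prodMk_left
    calc (∫⁻ θ in Ioi (0 : ℝ), P (Real.exp θ • z)) ^ 2
        = (∫⁻ θ in Ioi (0 : ℝ), ENNReal.ofReal (Real.exp (-(θ / 4))) *
          (ENNReal.ofReal (Real.exp (θ / 4)) * P (Real.exp θ • z))) ^ 2 := by simp only [← h1]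
      _ ≤ (∫⁻ θ in Ioi (0 : ℝ), ENNReal.ofReal (Real.exp (-(θ / 4))) ^ 2) *
          ∫⁻ θ in Ioi (0 : ℝ), (ENNReal.ofReal (Real.exp (θ / 4)) * P (Real.exp θ • z)) ^ 2 := by
          refine sq_lintegral_mul_le (by fun_prop) (Measurable.aemeasurable ?_)
          exact Measurable.mul (by fun_prop) hPz
      _ = _ := by
          congr 1
          · have := lintegral_exp_neg_mul_Ioi (c := 1 / 2) (by norm_num)
            rw [show (2 : ℝ≥0∞) = ENNReal.ofReal (1 / (1 / 2)) by norm_num, ← this]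
            refine lintegral_congr fun θ => ?_
            rw [← ENNReal.ofReal_pow (by positivity), ← Real.exp_nat_mul]
            congr 2; push_cast; ring
          · refine lintegral_congr fun θ => ?_
            rw [mul_pow, ← ENNReal.ofReal_pow (by positivity), ← Real.exp_nat_mul]
            congr 3; push_cast; ring
  have hscale := fun θ : ℝ => lintegral_weight_mul_comp_exp_smul hκ (fun y => P y ^ 2) θ
  calc ∫⁻ z : E, ‖z‖ₑ ^ κ * (∫⁻ θ in Ioi (0 : ℝ), P (Real.exp θ • z)) ^ 2
      ≤ ∫⁻ z : E, ∫⁻ θ in Ioi (0 : ℝ),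
          2 * (ENNReal.ofReal (Real.exp (θ / 2)) * (‖z‖ₑ ^ κ * P (Real.exp θ • z) ^ 2)) := by
        refine lintegral_mono fun z => ?_
        have hPz : Measurable fun θ : ℝ => P (Real.exp θ • z) := hPm.comp measurable_prodMk_left
        have hm : Measurable fun θ : ℝ => ENNReal.ofReal (Real.exp (θ / 2)) *
            P (Real.exp θ • z) ^ 2 := Measurable.mul (by fun_prop) (hPz.pow_const 2)
        refine (mul_le_mul_right (hCS z) _).trans_eq ?_
        rw [← lintegral_const_mul _ hm, ← lintegral_const_mul _ (hm.const_mul _)]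
        refine lintegral_congr fun θ => ?_
        ring
    _ = ∫⁻ θ in Ioi (0 : ℝ), ∫⁻ z : E,
          2 * (ENNReal.ofReal (Real.exp (θ / 2)) * (‖z‖ₑ ^ κ * P (Real.exp θ • z) ^ 2)) := by
        refine lintegral_lintegral_swap (Measurable.aemeasurable ?_)
        refine Measurable.const_mul (Measurable.mul (by fun_prop) (Measurable.mul ?_ ?_)) _
        · fun_prop
        · exact hPm.pow_const 2
    _ = ∫⁻ θ in Ioi (0 : ℝ), 2 * (ENNReal.ofReal (Real.exp (θ / 2)) *
          (ENNReal.ofReal (Real.exp (-(κ + d) * θ)) * W)) := by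
        refine lintegral_congr fun θ => ?_
        rw [lintegral_const_mul' _ _ (by norm_num), lintegral_const_mul' _ _ ENNReal.ofReal_ne_top,
          hscale]
    _ ≤ ∫⁻ θ in Ioi (0 : ℝ), 2 * W * ENNReal.ofReal (Real.exp (-(1 / 2) * θ)) := by
        refine setLIntegral_mono' measurableSet_Ioi fun θ (hθ : 0 < θ) => ?_
        rw [← mul_assoc (ENNReal.ofReal _), ← ENNReal.ofReal_mul (by positivity), ← Real.exp_add,
          mul_assoc, mul_comm W]
        gcongr
        have : (1 : ℝ) ≤ d := by exact_mod_cast hd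
        nlinarith
    _ = 4 * W := by
        rw [lintegral_const_mul _ (by fun_prop), lintegral_exp_neg_mul_Ioi (by norm_num)]
        rw [show ENNReal.ofReal (1 / (1 / 2)) = 2 by norm_num]
        ring

/-- Weighted Hardy inequality: if `u` vanishes at infinity then
`∫ |z|^κ |u|² ≤ 4 ∫ |z|^{κ+2} |Du|²`. -/
theorem VanishesAtInfinity.lintegral_le {𝕜 : Type*} [RCLike 𝕜] (hd : 1 ≤ d) {u : E → 𝕜}
    (hu0 : VanishesAtInfinity u) {g : Fin d → E → 𝕜} (hu : LocallyIntegrableOn u {0}ᶜ volume)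
    (h : ∀ i, HasWeakDerivOn {0}ᶜ (EuclideanSpace.single i 1) u (g i)) {κ : ℝ} (hκ : 0 ≤ κ) :
    ∫⁻ z, ‖z‖ₑ ^ κ * ‖u z‖ₑ ^ 2 ≤ 4 * ∫⁻ z, ‖z‖ₑ ^ (κ + 2) * (∑ i, ‖g i z‖ₑ) ^ 2 := by
  have hne : ∀ᵐ z : E, z ∈ ({0}ᶜ : Set E) := by
    have : Nonempty (Fin d) := ⟨⟨0, by omega⟩⟩
    exact Measure.ae_ne volume (0 : E)
  choose g' hg'm hg'e hg' using fun i => (h i).exists_stronglyMeasurable isOpen_compl_singleton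
  have hgg : ∫⁻ z : E, ‖z‖ₑ ^ (κ + 2) * (∑ i, ‖g i z‖ₑ) ^ 2 =
      ∫⁻ z : E, ‖z‖ₑ ^ κ * (∑ i, ‖z‖ₑ * ‖g' i z‖ₑ) ^ 2 := by
    refine lintegral_congr_ae ?_
    filter_upwards [hne, Filter.eventually_all.2 hg'e] with z hz hg
    rw [← Finset.mul_sum, mul_pow, ENNReal.rpow_add_of_nonneg _ _ hκ (by norm_num),
      ENNReal.rpow_two, mul_assoc]
    simp only [fun i => hg i hz]
  rw [hgg]
  set P : E → ℝ≥0∞ := fun z => ∑ i, ‖z‖ₑ * ‖g' i z‖ₑ with hP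
  have hPm : Measurable P :=
    Finset.measurable_fun_sum _ fun i _ => Measurable.mul measurable_enorm (hg'm i).enorm
  have hH := lintegral_weight_mul_ray_sq_le hd hκ hPm
  by_cases htop : 4 * ∫⁻ y : E, ‖y‖ₑ ^ κ * P y ^ 2 = ⊤
  · rw [htop]; exact le_top
  refine le_trans (lintegral_mono_ae ?_) hH
  have := ae_enorm_le_lintegral_ray hu hg' hg'm hu0 ?_
  · filter_upwards [this, hne] with z hz hz0
    gcongr
    exact hz hz0
  intro S hS hSc
  -- on a compact set away from the origin, `A ≤ 1 + A²` and the weight is bounded below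
  have h0 : Sᶜ ∈ nhds (0 : E) := hSc.isClosed.isOpen_compl.mem_nhds fun h => hS h rfl
  obtain ⟨δ, hδ, hs⟩ := Metric.mem_nhds_iff.1 h0
  set A : E → ℝ≥0∞ := fun z => ∫⁻ θ in Ioi (0 : ℝ), P (Real.exp θ • z) with hA
  have hc0 : ENNReal.ofReal δ ^ κ ≠ 0 := by
    rw [ENNReal.ofReal_rpow_of_pos hδ]
    simpa using Real.rpow_pos_of_pos hδ κ
  have hct : ENNReal.ofReal δ ^ κ ≠ ⊤ := ENNReal.rpow_ne_top_of_nonneg hκ ENNReal.ofReal_ne_top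
  have hb : ∀ z ∈ S, A z ≤ 1 + (ENNReal.ofReal δ ^ κ)⁻¹ * (‖z‖ₑ ^ κ * A z ^ 2) := by
    intro z hz
    have h1 : ENNReal.ofReal δ ≤ ‖z‖ₑ := by
      rw [← ofReal_norm]
      refine ENNReal.ofReal_le_ofReal ?_
      by_contra hc
      exact hs (mem_ball_zero_iff.2 (not_le.1 hc)) hz
    calc A z ≤ 1 + A z ^ 2 := by
          rcases le_total (A z) 1 with h | h
          · exact h.trans le_self_add
          · calc A z = A z * 1 := (mul_one _).symm
              _ ≤ A z * A z := by gcongr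
              _ = A z ^ 2 := (sq _).symm
              _ ≤ _ := le_add_self
      _ = 1 + (ENNReal.ofReal δ ^ κ)⁻¹ * (ENNReal.ofReal δ ^ κ * A z ^ 2) := by
          rw [← mul_assoc, ENNReal.inv_mul_cancel hc0 hct, one_mul]
      _ ≤ _ := by gcongr
  refine ((setLIntegral_mono' hSc.isClosed.measurableSet hb).trans_lt ?_).ne
  rw [lintegral_add_left measurable_const, lintegral_const_mul' _ _ (ENNReal.inv_ne_top.2 hc0)]
  refine ENNReal.add_lt_top.2 ⟨by simpa using hSc.measure_lt_top, ?_⟩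
  refine ENNReal.mul_lt_top (ENNReal.inv_lt_top.2 (pos_iff_ne_zero.2 hc0)) ?_
  exact ((setLIntegral_le_lintegral _ _).trans hH).trans_lt (lt_top_iff_ne_top.2 htop)

lemma VanishesAtInfinity.sub {𝕜 : Type*} [RCLike 𝕜] {u w : E → 𝕜} (hu : LocallyIntegrable u)
    (hw : LocallyIntegrable w) (hu0 : VanishesAtInfinity u) (hw0 : VanishesAtInfinity w) :
    VanishesAtInfinity fun x => u x - w x := by
  intro η h1 h2 h3
  have hint : ∀ {v : E → 𝕜}, LocallyIntegrable v → ∀ θ : ℝ,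
      Integrable fun y => η y • v (Real.exp θ • y) := by
    intro v hv θ
    have h4 : Integrable fun y => η (Real.exp (-θ) • y) • v y := by
      refine hv.integrable_smul_left_of_hasCompactSupport (h1.continuous.comp (by fun_prop)) ?_
      exact h2.comp_homeomorph (Homeomorph.smulOfNeZero _ (Real.exp_ne_zero (-θ)))
    have := h4.comp_smul (Real.exp_ne_zero θ)
    simpa [smul_smul, ← Real.exp_add] using this
  have := (hu0 η h1 h2 h3).sub (hw0 η h1 h2 h3)
  rw [sub_zero] at this
  refine this.congr fun θ => ?_
  simp only [smul_sub]
  rw [integral_sub (hint hu θ) (hint hw θ)]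

/-- A function in a weighted `L₂` space vanishes at infinity. -/
lemma vanishesAtInfinity_of_lintegral_ne_top {𝕜 : Type*} [RCLike 𝕜] (hd : 1 ≤ d) {u : E → 𝕜}
    (hu : AEStronglyMeasurable u volume) {κ : ℝ} (hκ : 0 ≤ κ)
    (hfin : ∫⁻ z, ‖z‖ₑ ^ κ * ‖u z‖ₑ ^ 2 ≠ ⊤) : VanishesAtInfinity u := by
  intro η h1 h2 h3
  obtain ⟨δ, hδ, hs⟩ := exists_pos_le_norm_of_tsupport h3
  set W := ∫⁻ z, ‖z‖ₑ ^ κ * ‖u z‖ₑ ^ 2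
  have hc0 : ENNReal.ofReal δ ^ κ ≠ 0 := by
    rw [ENNReal.ofReal_rpow_of_pos hδ]
    simpa using Real.rpow_pos_of_pos hδ κ
  have hct : ENNReal.ofReal δ ^ κ ≠ ⊤ := ENNReal.rpow_ne_top_of_nonneg hκ ENNReal.ofReal_ne_top
  set C : ℝ≥0∞ := (∫⁻ y, ‖η y‖ₑ ^ 2) * ((ENNReal.ofReal δ ^ κ)⁻¹ * W) with hC
  have hCt : C ≠ ⊤ := by
    refine ENNReal.mul_ne_top ?_ (ENNReal.mul_ne_top (ENNReal.inv_ne_top.2 hc0) hfin)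
    have : MemLp η 2 volume := h1.continuous.memLp_of_hasCompactSupport h2
    have := (eLpNorm_lt_top_iff_lintegral_rpow_enorm_lt_top (by norm_num) (by norm_num)).1
      this.eLpNorm_lt_top
    simpa using this.ne
  have hbound : ∀ θ : ℝ, ‖∫ y, η y • u (Real.exp θ • y)‖ₑ ≤
      (C * ENNReal.ofReal (Real.exp (-(κ + d) * θ))) ^ (1 / 2 : ℝ) := by
    intro θ
    have hum : AEStronglyMeasurable (fun y => u (Real.exp θ • y)) volume :=
      hu.comp_quasiMeasurePreserving ⟨by fun_prop, by
        rw [Measure.map_addHaar_smul _ (Real.exp_ne_zero θ)]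
        exact Measure.smul_absolutelyContinuous⟩
    have hsm : MeasurableSet {y : E | δ ≤ ‖y‖} := measurableSet_le measurable_const measurable_norm
    set U : E → ℝ≥0∞ := {y : E | δ ≤ ‖y‖}.indicator fun y => ‖u (Real.exp θ • y)‖ₑ with hU
    have hscale := lintegral_weight_mul_comp_exp_smul hκ (fun y => ‖u y‖ₑ ^ 2) θ
    rw [one_div, ENNReal.le_rpow_inv_iff (by norm_num), ENNReal.rpow_two]
    calc ‖∫ y, η y • u (Real.exp θ • y)‖ₑ ^ 2
        ≤ (∫⁻ y, ‖η y‖ₑ * U y) ^ 2 := by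
          gcongr
          refine (enorm_integral_le_lintegral_enorm _).trans (lintegral_mono fun y => ?_)
          rw [enorm_smul]
          by_cases hy : η y = 0
          · simp [hy]
          · have : y ∈ {y : E | δ ≤ ‖y‖} := hs y hy
            rw [hU, indicator_of_mem this]
      _ ≤ (∫⁻ y, ‖η y‖ₑ ^ 2) * ∫⁻ y, U y ^ 2 :=
          sq_lintegral_mul_le h1.continuous.enorm.measurable.aemeasurable (hum.enorm.indicator hsm)
      _ ≤ (∫⁻ y, ‖η y‖ₑ ^ 2) * ∫⁻ y, (ENNReal.ofReal δ ^ κ)⁻¹ *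
            (‖y‖ₑ ^ κ * ‖u (Real.exp θ • y)‖ₑ ^ 2) := by
          gcongr with y
          by_cases hy : y ∈ {y : E | δ ≤ ‖y‖}
          · have h5 : ENNReal.ofReal δ ≤ ‖y‖ₑ := by
              rw [← ofReal_norm]; exact ENNReal.ofReal_le_ofReal hy
            rw [hU, indicator_of_mem hy, ← mul_assoc]
            refine le_mul_of_one_le_left' ?_
            rw [← ENNReal.inv_mul_cancel hc0 hct]
            gcongr
          · simp [hU, indicator_of_notMem hy]
      _ = _ := by
          rw [lintegral_const_mul' _ _ (ENNReal.inv_ne_top.2 hc0), hscale, hC]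
          ring
  rw [tendsto_iff_enorm_sub_tendsto_zero]
  simp only [sub_zero]
  refine tendsto_of_tendsto_of_tendsto_of_le_of_le tendsto_const_nhds ?_ (fun _ => zero_le) hbound
  have hexp : Filter.Tendsto (fun θ : ℝ => C * ENNReal.ofReal (Real.exp (-(κ + d) * θ)))
      Filter.atTop (nhds (C * ENNReal.ofReal 0)) := by
    refine ENNReal.Tendsto.const_mul (ENNReal.tendsto_ofReal ?_) (Or.inr hCt)
    refine Real.tendsto_exp_atBot.comp ?_
    have : (1 : ℝ) ≤ d := by exact_mod_cast hd
    exact Filter.tendsto_id.const_mul_atTop_of_neg (by linarith)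
  have := hexp.ennrpow_const (1 / 2 : ℝ)
  simpa using this

end WeightedHardy

/-! ### Plancherel's theorem and testing Fourier transforms on Schwartz functions -/

section SchwartzTest

open scoped SchwartzMap

variable {d : ℕ}

local notation "E" => EuclideanSpace ℝ (Fin d)

/-- Plancherel's theorem for the Fourier integral of a function in `L₁ ∩ L₂`. -/
theorem lintegral_enorm_fourier_sq {h : E → ℂ} (h1 : Integrable h) (h2 : MemLp h 2 volume) :
    ∫⁻ x, ‖𝓕 h x‖ₑ ^ 2 = ∫⁻ x, ‖h x‖ₑ ^ 2 := by
  set H : Lp ℂ 2 (volume : Measure E) := h2.toLp h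
  set H' : Lp ℂ 2 (volume : Measure E) := 𝓕 H
  have hcont : Continuous (𝓕 h) :=
    VectorFourier.fourierIntegral_continuous Real.continuous_fourierChar
      (by exact continuous_inner) h1
  have hae : ∀ᵐ x, H' x = 𝓕 h x := by
    refine ae_eq_of_integral_contDiff_smul_eq
      ((Lp.memLp H').locallyIntegrable (by norm_num)) hcont.locallyIntegrable fun g hg hgc => ?_
    have hgC : ContDiff ℝ ∞ fun x => (g x : ℂ) := Complex.ofRealCLM.contDiff.comp hg
    have hgCc : HasCompactSupport fun x => (g x : ℂ) :=
      hgc.comp_left (g := fun r : ℝ => (r : ℂ)) (by simp)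
    set φ : 𝓢(E, ℂ) := hgCc.toSchwartzMap hgC with hφ
    have hφe : ∀ x, φ x = (g x : ℂ) := fun x => rfl
    have e1 : (𝓕 (H : 𝓢'(E, ℂ))) φ = (H' : 𝓢'(E, ℂ)) φ := by
      rw [Lp.fourier_toTemperedDistribution_eq]
    rw [TemperedDistribution.fourier_apply, Lp.toTemperedDistribution_apply,
      Lp.toTemperedDistribution_apply] at e1
    have e2 : ∫ x, (𝓕 φ) x • H x = ∫ x, (𝓕 φ) x • h x := by
      refine integral_congr_ae ?_
      filter_upwards [h2.coeFn_toLp] with x hx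
      rw [hx]
    have e3 : ∫ x, (𝓕 φ) x • h x = ∫ x, φ x • 𝓕 h x := by
      have := VectorFourier.integral_fourierIntegral_smul_eq_flip (L := innerₗ E)
        (μ := volume) (ν := volume) Real.continuous_fourierChar (by exact continuous_inner)
        φ.integrable h1
      rw [flip_innerₗ] at this
      exact this
    simp only [hφe, Complex.real_smul, smul_eq_mul] at e1 e2 e3 ⊢
    rw [← e1, e2, e3]
  have e4 : ∫⁻ x, ‖𝓕 h x‖ₑ ^ 2 = ∫⁻ x, ‖H' x‖ₑ ^ 2 := by
    refine lintegral_congr_ae ?_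
    filter_upwards [hae] with x hx
    rw [hx]
  have e5 : ∫⁻ x, ‖h x‖ₑ ^ 2 = ∫⁻ x, ‖H x‖ₑ ^ 2 := by
    refine lintegral_congr_ae ?_
    filter_upwards [h2.coeFn_toLp] with x hx
    rw [hx]
  have e6 : ∀ G : Lp ℂ 2 (volume : Measure E), ∫⁻ x, ‖G x‖ₑ ^ 2 = ‖G‖ₑ ^ 2 := by
    intro G
    rw [Lp.enorm_def, eLpNorm_eq_lintegral_rpow_enorm_toReal (by norm_num) (by norm_num),
      ← ENNReal.rpow_mul_natCast]
    simp
  rw [e4, e5, e6, e6, ← ofReal_norm, ← ofReal_norm, Lp.norm_fourier_eq]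

/-- Truncating a Schwartz function by dilated bump functions keeps its Fourier transform bounded by
a fixed rapidly decreasing function. -/
lemma exists_forall_pow_mul_norm_fourier_truncation_le (χ : E → ℝ) (hχ : ContDiff ℝ ∞ χ)
    (hχc : HasCompactSupport χ) (η : 𝓢(E, ℂ)) (k : ℕ) :
    ∃ C : ℝ, ∀ c : ℝ, 0 < c → c ≤ 1 → ∀ w : E,
      ‖w‖ ^ k * ‖𝓕 (fun x => (χ (c • x) : ℂ) * η x) w‖ ≤ C := by
  have hχC : ContDiff ℝ ∞ fun x => (χ x : ℂ) := Complex.ofRealCLM.contDiff.comp hχ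
  have hχCc : HasCompactSupport fun x => (χ x : ℂ) :=
    hχc.comp_left (g := fun r : ℝ => (r : ℂ)) (by simp)
  have hb : ∀ i : ℕ, ∃ B : ℝ, ∀ x, ‖iteratedFDeriv ℝ i (fun x => (χ x : ℂ)) x‖ ≤ B := by
    intro i
    obtain ⟨B, hB⟩ := (hχCc.iteratedFDeriv (𝕜 := ℝ) i).exists_bound_of_continuous
      (hχC.continuous_iteratedFDeriv (by exact_mod_cast le_top))
    exact ⟨B, hB⟩
  choose B hB using hb
  have hη := η.smooth'
  -- pointwise bounds on the derivatives of the product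
  set D : ℕ → E → ℝ := fun q x => ∑ i ∈ Finset.range (q + 1),
    (q.choose i : ℝ) * B i * ‖iteratedFDeriv ℝ (q - i) η x‖ with hD
  have hDer : ∀ c : ℝ, 0 < c → c ≤ 1 → ∀ q x,
      ‖iteratedFDeriv ℝ q (fun x => (χ (c • x) : ℂ) * η x) x‖ ≤ D q x := by
    intro c hc hc1 q x
    have hχc' : ContDiff ℝ ∞ fun x => (χ (c • x) : ℂ) := hχC.comp (contDiff_const_smul c)
    refine (norm_iteratedFDeriv_mul_le hχc' hη x (n := q) (by exact_mod_cast le_top)).trans ?_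
    refine Finset.sum_le_sum fun i _ => ?_
    have hB0 : 0 ≤ B i := (norm_nonneg _).trans (hB i 0)
    refine mul_le_mul_of_nonneg_right (mul_le_mul_of_nonneg_left ?_ (by positivity))
      (norm_nonneg _)
    have := iteratedFDeriv_comp_const_smul (𝕜 := ℝ) (i := i) c
      (hχC.of_le (by exact_mod_cast le_top))
    rw [this, norm_smul, norm_pow, Real.norm_of_nonneg hc.le]
    calc c ^ i * _ ≤ 1 * B i := by
          gcongr
          · exact pow_le_one₀ hc.le hc1
          · exact hB i _
      _ = B i := one_mul _
  have hDi : ∀ q p : ℕ, Integrable fun x => ‖x‖ ^ p * D q x := by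
    intro q p
    simp only [hD, Finset.mul_sum]
    refine integrable_finsetSum _ fun i _ => ?_
    have := (η.integrable_pow_mul_iteratedFDeriv volume p (q - i)).const_mul ((q.choose i : ℝ) * B i)
    refine this.congr (Filter.Eventually.of_forall fun x => ?_)
    simp only
    ring
  refine ⟨2 ^ k * ∑ p ∈ Finset.range (0 + 1) ×ˢ Finset.range (k + 1), ∫ v, ‖v‖ ^ p.1 * D p.2 v,
    fun c hc hc1 w => ?_⟩
  have hχc' : ContDiff ℝ ∞ fun x => (χ (c • x) : ℂ) * η x :=
    (hχC.comp (contDiff_const_smul c)).mul hη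
  have hint : ∀ p q : ℕ, Integrable fun v =>
      ‖v‖ ^ p * ‖iteratedFDeriv ℝ q (fun x => (χ (c • x) : ℂ) * η x) v‖ := by
    intro p q
    refine (hDi q p).mono' ?_ (Filter.Eventually.of_forall fun x => ?_)
    · exact ((continuous_norm.pow p).mul
        (hχc'.continuous_iteratedFDeriv (by exact_mod_cast le_top)).norm).aestronglyMeasurable
    · rw [Real.norm_of_nonneg (by positivity)]
      gcongr
      exact hDer c hc hc1 q x
  -- the bounds `D` are uniform in `c`, hence so is the bound on the Fourier side
  have := Real.pow_mul_norm_iteratedFDeriv_fourier_le (K := 0) (N := k) (n := k) (k := 0)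
    (hχc'.of_le (by exact_mod_cast le_top)) (fun p q _ _ => hint p q) le_rfl le_rfl w
  simp only [norm_iteratedFDeriv_zero, pow_zero, one_mul, Nat.cast_zero, mul_zero, zero_add] at this
  refine this.trans ?_
  gcongr with p _
  · exact hint _ _
  · exact hDi _ _
  · exact fun v => mul_le_mul_of_nonneg_left (hDer c hc hc1 _ _) (by positivity)

lemma one_add_pow_le {a : ℝ} (ha : 0 ≤ a) (m : ℕ) : (1 + a) ^ m ≤ 2 ^ m * (1 + a ^ m) := by
  rcases le_total a 1 with h | h
  · calc (1 + a) ^ m ≤ 2 ^ m := by gcongr; linarith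
      _ ≤ _ := le_mul_of_one_le_right (by positivity) (by
        have : 0 ≤ a ^ m := by positivity
        linarith)
  · calc (1 + a) ^ m ≤ (2 * a) ^ m := by gcongr; linarith
      _ = 2 ^ m * a ^ m := mul_pow _ _ _
      _ ≤ _ := by gcongr; linarith

lemma exists_schwartz_norm_le (η : 𝓢(E, ℂ)) (k : ℕ) :
    ∃ C : ℝ, 0 ≤ C ∧ ∀ x, ‖η x‖ ≤ C * ((1 + ‖x‖) ^ k)⁻¹ := by
  obtain ⟨C0, hC0⟩ := η.decay 0 0
  obtain ⟨C1, hC1⟩ := η.decay k 0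
  simp only [norm_iteratedFDeriv_zero, pow_zero, one_mul] at hC0 hC1
  have hnn : 0 ≤ 2 ^ k * (C0 + C1) := by
    have h1 := hC0.1
    have h2 := hC1.1
    positivity
  refine ⟨2 ^ k * (C0 + C1), hnn, fun x => ?_⟩
  rw [← div_eq_mul_inv, le_div_iff₀ (by positivity)]
  calc ‖η x‖ * (1 + ‖x‖) ^ k ≤ ‖η x‖ * (2 ^ k * (1 + ‖x‖ ^ k)) := by
        gcongr; exact one_add_pow_le (norm_nonneg _) k
    _ = 2 ^ k * (‖η x‖ + ‖x‖ ^ k * ‖η x‖) := by ring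
    _ ≤ _ := by
      gcongr
      · exact hC0.2 x
      · exact hC1.2 x

lemma integrable_mul_of_norm_le_inv_one_add_pow {v φ : E → ℂ} {k : ℕ} {C : ℝ}
    (hv : Integrable fun x => ((1 + ‖x‖) ^ k)⁻¹ • v x)
    (hφm : AEStronglyMeasurable φ volume) (hvm : AEStronglyMeasurable v volume)
    (hφ : ∀ x, ‖φ x‖ ≤ C * ((1 + ‖x‖) ^ k)⁻¹) : Integrable fun x => v x * φ x := by
  refine (hv.norm.const_mul C).mono' (hvm.mul hφm) (Filter.Eventually.of_forall fun x => ?_)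
  rw [norm_mul, norm_smul, Real.norm_of_nonneg (by positivity), mul_comm, ← mul_assoc]
  gcongr
  exact hφ x

/-- If the Fourier transform is itself tempered, its defining identity extends from test functions
to Schwartz functions. -/
theorem HasFourierTransform.integral_schwartz {𝕜 : Type*} [RCLike 𝕜] {u : E → 𝕜} {uhat : E → ℂ}
    (h : HasFourierTransform u uhat) {k : ℕ}
    (hk : Integrable fun ξ => ((1 + ‖ξ‖) ^ k)⁻¹ • uhat ξ) (hum : AEStronglyMeasurable u volume)
    (η : 𝓢(E, ℂ)) :
    ∫ x, RCLike.map 𝕜 ℂ (u x) * 𝓕 (η : E → ℂ) ((2 * Real.pi)⁻¹ • x) = ∫ ξ, uhat ξ * η ξ := by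
  have hmap : Continuous (RCLike.map 𝕜 ℂ) := (RCLike.map 𝕜 ℂ).continuous
  set v : E → ℂ := fun x => RCLike.map 𝕜 ℂ (u x) with hv
  have hvm : AEStronglyMeasurable v volume := hmap.comp_aestronglyMeasurable hum
  obtain ⟨m, hm⟩ := h.tempered
  have hvi : Integrable fun x => ((1 + ‖x‖) ^ m)⁻¹ • v x := by
    have := (RCLike.map 𝕜 ℂ).toContinuousLinearMap.integrable_comp hm
    refine this.congr (Filter.Eventually.of_forall fun x => ?_)
    simp [hv]
  let χ : ContDiffBump (0 : E) := ⟨1, 2, by norm_num, by norm_num⟩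
  have hχ : ContDiff ℝ ∞ χ := χ.contDiff
  have hχc : HasCompactSupport χ := χ.hasCompactSupport
  let c : ℕ → ℝ := fun n => 1 / ((n : ℝ) + 1)
  have hc0 : ∀ n, 0 < c n := fun n => by positivity
  have hc1 : ∀ n, c n ≤ 1 := fun n => by
    rw [div_le_one (by positivity)]
    have : (0 : ℝ) ≤ n := n.cast_nonneg
    linarith
  have hclim : Filter.Tendsto c Filter.atTop (nhds 0) := tendsto_one_div_add_atTop_nhds_zero_nat
  set φ : ℕ → E → ℂ := fun n x => (χ (c n • x) : ℂ) * η x with hφ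
  have hφlim : ∀ x, Filter.Tendsto (fun n => φ n x) Filter.atTop (nhds (η x)) := by
    intro x
    have h1 : Filter.Tendsto (fun n => c n • x) Filter.atTop (nhds ((0 : ℝ) • x)) :=
      hclim.smul_const x
    rw [zero_smul] at h1
    have h2 : ∀ᶠ n in Filter.atTop, c n • x ∈ Metric.closedBall (0 : E) 1 :=
      h1 (Metric.closedBall_mem_nhds _ one_pos)
    refine tendsto_const_nhds.congr' ?_
    filter_upwards [h2] with n hn
    simp [hφ, χ.one_of_mem_closedBall hn]
  have hφle : ∀ n x, ‖φ n x‖ ≤ ‖η x‖ := by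
    intro n x
    rw [norm_mul, Complex.norm_real, Real.norm_of_nonneg χ.nonneg]
    exact mul_le_of_le_one_left (norm_nonneg _) χ.le_one
  have hφc : ∀ n, ContDiff ℝ ∞ (φ n) := fun n =>
    (Complex.ofRealCLM.contDiff.comp (hχ.comp (contDiff_const_smul (c n)))).mul η.smooth'
  have hφs : ∀ n, HasCompactSupport (φ n) := by
    intro n
    have h1 : HasCompactSupport fun x : E => χ (c n • x) :=
      hχc.comp_homeomorph (Homeomorph.smulOfNeZero _ (hc0 n).ne')
    have h2 : HasCompactSupport fun x : E => (χ (c n • x) : ℂ) :=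
      h1.comp_left (g := fun r : ℝ => (r : ℂ)) (by simp)
    exact h2.mul_right
  -- convergence on the Fourier side
  obtain ⟨Cη, -, hCη⟩ := exists_schwartz_norm_le η k
  have hR : Filter.Tendsto (fun n => ∫ ξ, uhat ξ * φ n ξ) Filter.atTop
      (nhds (∫ ξ, uhat ξ * η ξ)) := by
    have hum := h.locallyIntegrable.aestronglyMeasurable
    refine tendsto_integral_of_dominated_convergence (fun ξ => ‖uhat ξ * η ξ‖)
      (fun n => hum.mul (hφc n).continuous.aestronglyMeasurable) ?_ (fun n => ?_) ?_
    · exact (integrable_mul_of_norm_le_inv_one_add_pow hk η.continuous.aestronglyMeasurable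
        hum hCη).norm
    · refine Filter.Eventually.of_forall fun x => ?_
      simp only [norm_mul]
      exact mul_le_mul_of_nonneg_left (hφle n x) (norm_nonneg _)
    · exact Filter.Eventually.of_forall fun x => (hφlim x).const_mul _
  have hF : ∀ w, Filter.Tendsto (fun n => 𝓕 (φ n) w) Filter.atTop (nhds (𝓕 (η : E → ℂ) w)) := by
    intro w
    simp only [Real.fourier_eq]
    refine tendsto_integral_of_dominated_convergence (fun x => ‖η x‖) (fun n => ?_)
      η.integrable.norm (fun n => ?_) ?_
    · refine Continuous.aestronglyMeasurable (Continuous.smul ?_ (hφc n).continuous)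
      exact continuous_subtype_val.comp (Real.continuous_fourierChar.comp
        (by fun_prop : Continuous fun x : E => -(inner ℝ x w)))
    · refine Filter.Eventually.of_forall fun x => ?_
      rw [Circle.norm_smul]
      exact hφle n x
    · exact Filter.Eventually.of_forall fun x => (hφlim x).const_smul _
  obtain ⟨C0, hC0⟩ := exists_forall_pow_mul_norm_fourier_truncation_le χ hχ hχc η 0
  obtain ⟨C1, hC1⟩ := exists_forall_pow_mul_norm_fourier_truncation_le χ hχ hχc η m
  have hFb : ∀ n x, ‖𝓕 (φ n) ((2 * Real.pi)⁻¹ • x)‖ ≤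
      ((2 * Real.pi) ^ m * 2 ^ m * (C0 + C1)) * ((1 + ‖x‖) ^ m)⁻¹ := by
    intro n x
    set w : E := (2 * Real.pi)⁻¹ • x with hw
    have h2pi : 1 ≤ 2 * Real.pi := by linarith [Real.pi_gt_three]
    have hxw : ‖x‖ = 2 * Real.pi * ‖w‖ := by
      rw [hw, norm_smul, Real.norm_of_nonneg (by positivity), mul_inv_cancel_left₀ (by positivity)]
    have h0 := hC0 (c n) (hc0 n) (hc1 n) w
    have h1 := hC1 (c n) (hc0 n) (hc1 n) w
    rw [pow_zero, one_mul] at h0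
    rw [← div_eq_mul_inv, le_div_iff₀ (by positivity)]
    calc ‖𝓕 (φ n) w‖ * (1 + ‖x‖) ^ m
        ≤ ‖𝓕 (φ n) w‖ * ((2 * Real.pi) * (1 + ‖w‖)) ^ m := by
          gcongr
          rw [hxw, mul_add, mul_one]
          linarith
      _ ≤ ‖𝓕 (φ n) w‖ * ((2 * Real.pi) ^ m * (2 ^ m * (1 + ‖w‖ ^ m))) := by
          rw [mul_pow]
          gcongr
          exact one_add_pow_le (norm_nonneg _) m
      _ = (2 * Real.pi) ^ m * 2 ^ m * (‖𝓕 (φ n) w‖ + ‖w‖ ^ m * ‖𝓕 (φ n) w‖) := by ring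
      _ ≤ _ := by gcongr
  have hFc : ∀ n, Continuous fun x : E => 𝓕 (φ n) ((2 * Real.pi)⁻¹ • x) := by
    intro n
    have : Continuous (𝓕 (φ n)) := VectorFourier.fourierIntegral_continuous
      Real.continuous_fourierChar (by exact continuous_inner)
      ((hφc n).continuous.integrable_of_hasCompactSupport (hφs n))
    exact this.comp (by fun_prop)
  have hL : Filter.Tendsto (fun n => ∫ x, v x * 𝓕 (φ n) ((2 * Real.pi)⁻¹ • x)) Filter.atTop
      (nhds (∫ x, v x * 𝓕 (η : E → ℂ) ((2 * Real.pi)⁻¹ • x))) := by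
    refine tendsto_integral_of_dominated_convergence
      (fun x => ((2 * Real.pi) ^ m * 2 ^ m * (C0 + C1)) * ‖((1 + ‖x‖) ^ m)⁻¹ • v x‖)
      (fun n => hvm.mul (hFc n).aestronglyMeasurable) (hvi.norm.const_mul _) (fun n => ?_) ?_
    · refine Filter.Eventually.of_forall fun x => ?_
      rw [norm_mul, norm_smul, Real.norm_of_nonneg (by positivity), mul_comm, ← mul_assoc]
      gcongr
      exact hFb n x
    · exact Filter.Eventually.of_forall fun x => (hF _).const_mul _
  refine tendsto_nhds_unique hL (hR.congr fun n => ?_)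
  exact (h.integral_eq (φ n) (hφc n) (hφs n)).symm

end SchwartzTest

/-! ### Kernels with a locally integrable Fourier transform -/

section Multiplier

open scoped SchwartzMap

variable {d : ℕ}

local notation "E" => EuclideanSpace ℝ (Fin d)

/-- The canonical embedding of `𝕜 = ℝ` or `ℂ` into `ℂ` as a linear isometry. -/
noncomputable def rclikeMapIsometry (𝕜 : Type*) [RCLike 𝕜] : 𝕜 →ₗᵢ[ℝ] ℂ where
  toLinearMap := (RCLike.map 𝕜 ℂ : 𝕜 →ₗ[ℝ] ℂ)
  norm_map' z := by
    have h : ‖RCLike.map 𝕜 ℂ z‖ ^ 2 = ‖z‖ ^ 2 := by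
      rw [RCLike.map_apply, ← RCLike.normSq_eq_def', ← RCLike.normSq_eq_def', RCLike.normSq_apply,
        RCLike.normSq_apply]
      simp
    exact (pow_left_inj₀ (norm_nonneg _) (norm_nonneg _) two_ne_zero).1 h

lemma rclikeMapIsometry_apply {𝕜 : Type*} [RCLike 𝕜] (z : 𝕜) :
    rclikeMapIsometry 𝕜 z = RCLike.map 𝕜 ℂ z := rfl

lemma rclikeMap_mul {𝕜 : Type*} [RCLike 𝕜] (z w : 𝕜) :
    RCLike.map 𝕜 ℂ (z * w) = RCLike.map 𝕜 ℂ z * RCLike.map 𝕜 ℂ w := by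
  simp only [RCLike.map_apply, RCLike.mul_re, RCLike.mul_im]
  apply Complex.ext <;> simp

/-- A kernel with a locally integrable, tempered Fourier transform vanishes at infinity in the weak
sense: its means over large dilates are tested against a shrinking neighbourhood of the origin on
the Fourier side. -/
theorem HasFourierTransform.vanishesAtInfinity {𝕜 : Type*} [RCLike 𝕜] (hd : 1 ≤ d) {u : E → 𝕜}
    {uhat : E → ℂ} (h : HasFourierTransform u uhat) {k : ℕ}
    (hk : Integrable fun ξ => ((1 + ‖ξ‖) ^ k)⁻¹ • uhat ξ)
    (hum : AEStronglyMeasurable u volume) : VanishesAtInfinity u := by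
  intro η hη hηc _
  have h2pi : (2 * Real.pi) ≠ 0 := by positivity
  -- the test function dilated by `c` and its inverse Fourier transform
  have hsm : ∀ c : ℝ, ContDiff ℝ ∞ fun w : E => ((c ^ d : ℝ) : ℂ)⁻¹ * (η ((2 * Real.pi / c) • w) : ℂ) :=
    fun c => contDiff_const.mul
      (Complex.ofRealCLM.contDiff.comp (hη.comp (contDiff_const_smul (2 * Real.pi / c))))
  have hcs : ∀ c : ℝ, 0 < c →
      HasCompactSupport fun w : E => ((c ^ d : ℝ) : ℂ)⁻¹ * (η ((2 * Real.pi / c) • w) : ℂ) := by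
    intro c hc
    have h1 : HasCompactSupport fun x : E => η ((2 * Real.pi / c) • x) :=
      hηc.comp_homeomorph (Homeomorph.smulOfNeZero _ (div_ne_zero h2pi hc.ne'))
    exact (h1.comp_left (g := fun r : ℝ => (r : ℂ)) (by simp)).mul_left
  set ψ : 𝓢(E, ℂ) := 𝓕⁻ ((hcs 1 one_pos).toSchwartzMap (hsm 1)) with hψ
  -- a mean of the dilate of `u` is a mean of `uhat` against a dilated Schwartz function
  have key : ∀ c : ℝ, 0 < c → RCLike.map 𝕜 ℂ (∫ y, η y • u (c • y)) = ∫ ξ, uhat ξ * ψ (c • ξ) := by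
    intro c hc
    set g : 𝓢(E, ℂ) := (hcs c hc).toSchwartzMap (hsm c) with hg
    have hge : ∀ w, g w = ((c ^ d : ℝ) : ℂ)⁻¹ * (η ((2 * Real.pi / c) • w) : ℂ) := fun w => rfl
    have e1 := h.integral_schwartz hk hum (𝓕⁻ g)
    have e2 : 𝓕 ((𝓕⁻ g : 𝓢(E, ℂ)) : E → ℂ) = g := by
      rw [← SchwartzMap.fourier_coe, FourierTransform.fourier_fourierInv_eq]
    have e3 : ∀ ξ, (𝓕⁻ g) ξ = ψ (c • ξ) := by
      intro ξ
      rw [hψ, SchwartzMap.fourierInv_coe, SchwartzMap.fourierInv_coe, Real.fourierInv_eq,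
        Real.fourierInv_eq]
      have := Measure.integral_comp_smul_of_nonneg volume
        (fun v : E => Real.fourierChar (inner ℝ v ξ) • g v) c (hR := hc.le)
      have e : c ^ d ≠ 0 := by positivity
      rw [finrank_euclideanSpace_fin, eq_comm, inv_smul_eq_iff₀ e, ← integral_smul] at this
      rw [this]
      refine integral_congr_ae (Filter.Eventually.of_forall fun y => ?_)
      simp only [hge, HasCompactSupport.toSchwartzMap_toFun, smul_smul, div_mul_cancel₀ _ hc.ne']
      rw [inner_smul_left, inner_smul_right, smul_comm]
      simp only [Circle.smul_def, smul_eq_mul, Complex.real_smul]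
      have e' : ((c ^ d : ℝ) : ℂ) ≠ 0 := by exact_mod_cast e
      simp only [one_pow, Complex.ofReal_one, inv_one, one_mul, div_one]
      rw [conj_trivial, mul_inv_cancel_left₀ e']
    rw [e2] at e1
    simp only [e3] at e1
    rw [← e1, ← rclikeMapIsometry_apply, ← LinearIsometry.integral_comp_comm]
    have := Measure.integral_comp_smul_of_nonneg volume
      (fun x : E => RCLike.map 𝕜 ℂ (u x) * g ((2 * Real.pi)⁻¹ • x)) c (hR := hc.le)
    have e : c ^ d ≠ 0 := by positivity
    rw [finrank_euclideanSpace_fin, eq_comm, inv_smul_eq_iff₀ e, ← integral_smul] at this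
    rw [this]
    refine integral_congr_ae (Filter.Eventually.of_forall fun y => ?_)
    have e' : ((c ^ d : ℝ) : ℂ) ≠ 0 := by exact_mod_cast e
    have e4 : (2 * Real.pi / c) • (2 * Real.pi)⁻¹ • c • y = y := by
      rw [smul_smul, smul_smul]
      convert one_smul ℝ y using 2
      field_simp
    simp only [hge, e4, map_smul, rclikeMapIsometry_apply, Complex.real_smul]
    field_simp
  -- dominated convergence: `ψ (e^θ ξ)` tends to zero off the origin
  obtain ⟨C, hC0, hC⟩ := exists_schwartz_norm_le ψ (k + 1)
  have hlim : Filter.Tendsto (fun θ : ℝ => ∫ ξ, uhat ξ * ψ (Real.exp θ • ξ)) Filter.atTop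
      (nhds (∫ _ : E, (0 : ℂ))) := by
    refine tendsto_integral_filter_of_dominated_convergence
      (fun ξ => C * ‖((1 + ‖ξ‖) ^ k)⁻¹ • uhat ξ‖) ?_ ?_ (hk.norm.const_mul C) ?_
    · exact Filter.Eventually.of_forall fun θ => h.locallyIntegrable.aestronglyMeasurable.mul
        (ψ.continuous.comp (continuous_const_smul _)).aestronglyMeasurable
    · filter_upwards [Filter.eventually_ge_atTop 0] with θ hθ
      refine Filter.Eventually.of_forall fun ξ => ?_
      have h1 : (1 : ℝ) ≤ Real.exp θ := Real.one_le_exp hθ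
      have h2 : ‖ξ‖ ≤ ‖Real.exp θ • ξ‖ := by
        rw [norm_smul, Real.norm_of_nonneg (Real.exp_pos _).le]
        exact le_mul_of_one_le_left (norm_nonneg _) h1
      rw [norm_mul, norm_smul, Real.norm_of_nonneg (by positivity), mul_comm, ← mul_assoc]
      gcongr
      refine (hC _).trans ?_
      gcongr
      calc (1 + ‖ξ‖) ^ k ≤ (1 + ‖Real.exp θ • ξ‖) ^ k := by gcongr
        _ ≤ _ := pow_le_pow_right₀ (by linarith [norm_nonneg (Real.exp θ • ξ)]) (by omega)
    · have hne : ∀ᵐ ξ : E, ξ ≠ 0 := by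
        have : Nonempty (Fin d) := ⟨⟨0, by omega⟩⟩
        exact Measure.ae_ne volume (0 : E)
      filter_upwards [hne] with ξ hξ
      have h0 : Filter.Tendsto (fun θ : ℝ => ψ (Real.exp θ • ξ)) Filter.atTop (nhds 0) := by
        rw [tendsto_zero_iff_norm_tendsto_zero]
        have h3 : Filter.Tendsto (fun θ : ℝ => C * (Real.exp θ * ‖ξ‖)⁻¹) Filter.atTop
            (nhds (C * 0)) :=
          ((Real.tendsto_exp_atTop.atTop_mul_const (norm_pos_iff.2 hξ)).inv_tendsto_atTop).const_mul C
        rw [mul_zero] at h3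
        refine tendsto_of_tendsto_of_tendsto_of_le_of_le tendsto_const_nhds h3
          (fun _ => norm_nonneg _) fun θ => (hC _).trans ?_
        have hpos : 0 < Real.exp θ * ‖ξ‖ := mul_pos (Real.exp_pos θ) (norm_pos_iff.2 hξ)
        have hnn : ‖Real.exp θ • ξ‖ = Real.exp θ * ‖ξ‖ := by
          rw [norm_smul, Real.norm_of_nonneg (Real.exp_pos _).le]
        gcongr
        rw [hnn]
        calc Real.exp θ * ‖ξ‖ ≤ 1 + Real.exp θ * ‖ξ‖ := by linarith
          _ = (1 + Real.exp θ * ‖ξ‖) ^ 1 := (pow_one _).symm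
          _ ≤ _ := pow_le_pow_right₀ (by linarith) (by omega)
      simpa using h0.const_mul (uhat ξ)
  rw [integral_zero] at hlim
  rw [tendsto_zero_iff_norm_tendsto_zero] at hlim ⊢
  refine hlim.congr fun θ => ?_
  rw [← key _ (Real.exp_pos θ), ← rclikeMapIsometry_apply, LinearIsometry.norm_map]

/-- Convolution with the kernel is multiplication on the Fourier side. -/
theorem HasFourierTransform.convolution_eq {𝕜 : Type*} [RCLike 𝕜] {u : E → 𝕜}
    {uhat : E → ℂ} (h : HasFourierTransform u uhat) {k : ℕ}
    (hk : Integrable fun ξ => ((1 + ‖ξ‖) ^ k)⁻¹ • uhat ξ)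
    (hum : AEStronglyMeasurable u volume) {ψ : E → ℂ} (hψ : ContDiff ℝ ∞ ψ)
    (hψc : HasCompactSupport ψ) (x : E) :
    ∫ y, RCLike.map 𝕜 ℂ (u y) * ψ (x - y) =
      𝓕 (fun ξ => uhat ξ * 𝓕 (fun w => ψ ((2 * Real.pi) • w)) ξ) (-((2 * Real.pi)⁻¹ • x)) := by
  have h2pi : (2 * Real.pi) ≠ 0 := by positivity
  have hsm : ContDiff ℝ ∞ fun w : E => ψ (x - (2 * Real.pi) • w) :=
    hψ.comp (contDiff_const.sub (contDiff_const_smul (2 * Real.pi)))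
  have hcs : HasCompactSupport fun w : E => ψ (x - (2 * Real.pi) • w) :=
    (hψc.comp_homeomorph (Homeomorph.subLeft x)).comp_homeomorph
      (Homeomorph.smulOfNeZero _ h2pi)
  set g : 𝓢(E, ℂ) := hcs.toSchwartzMap hsm with hg
  have hge : ∀ w, g w = ψ (x - (2 * Real.pi) • w) := fun w => rfl
  have e1 := h.integral_schwartz hk hum (𝓕⁻ g)
  have e2 : 𝓕 ((𝓕⁻ g : 𝓢(E, ℂ)) : E → ℂ) = g := by
    rw [← SchwartzMap.fourier_coe, FourierTransform.fourier_fourierInv_eq]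
  have e5 : ∀ y : E, (2 * Real.pi) • (2 * Real.pi)⁻¹ • y = y := fun y => by
    rw [smul_smul, mul_inv_cancel₀ h2pi, one_smul]
  rw [e2] at e1
  simp only [hge, e5] at e1
  rw [e1, Real.fourier_eq]
  refine integral_congr_ae (Filter.Eventually.of_forall fun ξ => ?_)
  have e3 : (𝓕⁻ g) ξ = Real.fourierChar (-(inner ℝ ξ (-((2 * Real.pi)⁻¹ • x)))) •
      𝓕 (fun w => ψ ((2 * Real.pi) • w)) ξ := by
    rw [SchwartzMap.fourierInv_coe, Real.fourierInv_eq, Real.fourier_eq, Circle.smul_def,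
      smul_eq_mul, ← integral_const_mul,
      ← integral_sub_left_eq_self _ volume ((2 * Real.pi)⁻¹ • x)]
    refine integral_congr_ae (Filter.Eventually.of_forall fun w => ?_)
    simp only [hge, smul_sub, e5, sub_sub_cancel, Circle.smul_def, smul_eq_mul]
    rw [← mul_assoc, ← Circle.coe_mul, ← AddChar.map_add_eq_mul]
    congr 3
    rw [inner_sub_left, inner_neg_right, neg_neg, real_inner_comm ξ]
    ring_nf
  simp only [e3, Circle.smul_def, smul_eq_mul]
  ring

/-- The `L₂` norm of the convolution of a kernel with a test function, on the Fourier side. -/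
theorem HasFourierTransform.lintegral_convolution_sq_le {𝕜 : Type*} [RCLike 𝕜] {u : E → 𝕜}
    {uhat : E → ℂ} (h : HasFourierTransform u uhat) {k : ℕ}
    (hk : Integrable fun ξ => ((1 + ‖ξ‖) ^ k)⁻¹ • uhat ξ)
    (hum : AEStronglyMeasurable u volume) {ψ : E → ℂ} (hψ : ContDiff ℝ ∞ ψ)
    (hψc : HasCompactSupport ψ) :
    ∫⁻ x, ‖∫ y, RCLike.map 𝕜 ℂ (u y) * ψ (x - y)‖ₑ ^ 2 ≤
      ENNReal.ofReal ((2 * Real.pi) ^ d) *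
        ∫⁻ ξ, ‖uhat ξ‖ₑ ^ 2 * ‖𝓕 (fun w => ψ ((2 * Real.pi) • w)) ξ‖ₑ ^ 2 := by
  have h2pi : (2 * Real.pi) ≠ 0 := by positivity
  have hsm : ContDiff ℝ ∞ fun w : E => ψ ((2 * Real.pi) • w) := hψ.comp (contDiff_const_smul _)
  have hcs : HasCompactSupport fun w : E => ψ ((2 * Real.pi) • w) :=
    hψc.comp_homeomorph (Homeomorph.smulOfNeZero _ h2pi)
  set W : 𝓢(E, ℂ) := 𝓕 (hcs.toSchwartzMap hsm) with hW
  have hWe : ∀ ξ, W ξ = 𝓕 (fun w => ψ ((2 * Real.pi) • w)) ξ := fun ξ => rfl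
  obtain ⟨C, -, hC⟩ := exists_schwartz_norm_le W k
  simp only [h.convolution_eq hk hum hψ hψc, ← hWe]
  set m : E → ℂ := fun ξ => uhat ξ * W ξ with hm
  have huhm := h.locallyIntegrable.aestronglyMeasurable
  have hm1 : Integrable m := integrable_mul_of_norm_le_inv_one_add_pow hk
    W.continuous.aestronglyMeasurable huhm hC
  have e1 : ∫⁻ ξ, ‖m ξ‖ₑ ^ 2 = ∫⁻ ξ, ‖uhat ξ‖ₑ ^ 2 * ‖W ξ‖ₑ ^ 2 := by
    simp only [hm, enorm_mul, mul_pow]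
  rw [← e1]
  -- Plancherel's theorem needs `m ∈ L₂`; otherwise the right side is infinite
  by_cases htop : ∫⁻ ξ, ‖m ξ‖ₑ ^ 2 = ⊤
  · rw [htop, ENNReal.mul_top (by
      simp only [ne_eq, ENNReal.ofReal_eq_zero, not_le]; positivity)]
    exact le_top
  have hm2 : MemLp m 2 volume := by
    refine ⟨hm1.aestronglyMeasurable, ?_⟩
    rw [eLpNorm_lt_top_iff_lintegral_rpow_enorm_lt_top (by norm_num) (by norm_num)]
    simpa using lt_top_iff_ne_top.2 htop
  have e2 := lintegral_comp_smul_of_pos (fun x : E => ‖𝓕 m (-x)‖ₑ ^ 2)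
    (c := (2 * Real.pi)⁻¹) (by positivity)
  rw [e2, lintegral_neg_eq_self (fun x : E => ‖𝓕 m x‖ₑ ^ 2), lintegral_enorm_fourier_sq hm1 hm2,
    finrank_euclideanSpace_fin, Real.inv_rpow (by positivity), Real.rpow_neg (by positivity), inv_inv,
    Real.rpow_natCast]

lemma lintegral_fourier_dilate_sq {ψ : E → ℂ} (hψ : ContDiff ℝ ∞ ψ) (hψc : HasCompactSupport ψ) :
    ENNReal.ofReal ((2 * Real.pi) ^ d) *
      ∫⁻ ξ, ‖𝓕 (fun w => ψ ((2 * Real.pi) • w)) ξ‖ₑ ^ 2 = ∫⁻ x, ‖ψ x‖ₑ ^ 2 := by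
  have h2pi : (2 * Real.pi) ≠ 0 := by positivity
  have hc : Continuous fun w : E => ψ ((2 * Real.pi) • w) :=
    hψ.continuous.comp (continuous_const_smul _)
  have hcs : HasCompactSupport fun w : E => ψ ((2 * Real.pi) • w) :=
    hψc.comp_homeomorph (Homeomorph.smulOfNeZero _ h2pi)
  rw [lintegral_enorm_fourier_sq (hc.integrable_of_hasCompactSupport hcs)
    (hc.memLp_of_hasCompactSupport hcs),
    lintegral_comp_smul_of_pos (fun x : E => ‖ψ x‖ₑ ^ 2) (c := 2 * Real.pi) (by positivity),
    ← mul_assoc, ← ENNReal.ofReal_mul (by positivity), finrank_euclideanSpace_fin,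
    Real.rpow_neg (by positivity), Real.rpow_natCast, mul_inv_cancel₀ (by positivity)]
  simp

end Multiplier

/-! ### The `L₂` bound for a fixed source time -/

section SliceBound

variable {d : ℕ}

local notation "E" => EuclideanSpace ℝ (Fin d)

/-- A square-integrable bound on the Fourier transform over time makes almost every slice
polynomially integrable in frequency. -/
theorem ae_integrable_fourier_of_lintegral_sq_le {Khat : ℝ → E → ℂ}
    (hm : Measurable (Function.uncurry Khat)) {C₀ : ℝ≥0} {s : ℝ}
    (h : ∀ᵐ ξ, ∫⁻ t in Ioi s, ‖Khat t ξ‖ₑ ^ 2 ≤ C₀) :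
    ∀ᵐ t ∂(volume.restrict (Ioi s)),
      Integrable fun ξ => ((1 + ‖ξ‖) ^ (d + 1))⁻¹ • Khat t ξ := by
  have hw : Integrable (fun ξ : E => ((1 + ‖ξ‖) ^ (d + 1))⁻¹) volume := by
    have := integrable_one_add_norm (μ := (volume : Measure E)) (r := (d + 1 : ℝ))
      (by rw [finrank_euclideanSpace_fin]; linarith)
    refine this.congr (Filter.Eventually.of_forall fun ξ => ?_)
    simp only
    rw [Real.rpow_neg (by positivity)]
    norm_cast
  have hwm : Measurable fun ξ : E => ‖((1 + ‖ξ‖) ^ (d + 1))⁻¹‖ₑ := by fun_prop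
  have hkm : Measurable fun z : ℝ × E => ‖Khat z.1 z.2‖ₑ := hm.enorm
  have h1 : ∫⁻ t in Ioi s, ∫⁻ ξ, ‖((1 + ‖ξ‖) ^ (d + 1))⁻¹‖ₑ * ‖Khat t ξ‖ₑ ^ 2 ≠ ⊤ := by
    rw [lintegral_lintegral_swap
      ((hwm.comp measurable_snd).mul (hkm.pow_const 2)).aemeasurable]
    refine ne_top_of_le_ne_top (ENNReal.mul_ne_top hw.2.ne (ENNReal.coe_ne_top (r := C₀))) ?_
    rw [← lintegral_mul_const _ hwm]
    refine lintegral_mono_ae ?_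
    filter_upwards [h] with ξ hξ
    rw [lintegral_const_mul]
    · exact mul_le_mul_right hξ _
    · exact (hkm.comp (measurable_id.prodMk measurable_const)).pow_const 2
  have h2 := ae_lt_top ((Measurable.lintegral_prod_right'
    (f := fun z : ℝ × E => ‖((1 + ‖z.2‖) ^ (d + 1))⁻¹‖ₑ * ‖Khat z.1 z.2‖ₑ ^ 2)
    ((hwm.comp measurable_snd).mul (hkm.pow_const 2)))) h1
  filter_upwards [h2] with t ht
  have htm : Measurable (Khat t) := hm.comp (measurable_const.prodMk measurable_id)
  have hrm : Measurable fun ξ : E => ((1 + ‖ξ‖) ^ (d + 1))⁻¹ := by fun_prop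
  refine ⟨(hrm.smul htm).aestronglyMeasurable, ?_⟩
  -- `|a| ≤ |a|² + 1`, and the weight itself is integrable
  refine lt_of_le_of_lt (lintegral_mono (g := fun ξ => ‖((1 + ‖ξ‖) ^ (d + 1))⁻¹‖ₑ *
    ‖Khat t ξ‖ₑ ^ 2 + ‖((1 + ‖ξ‖) ^ (d + 1))⁻¹‖ₑ) fun ξ => ?_) ?_
  · simp only [enorm_smul]
    rw [← mul_add_one]
    refine mul_le_mul_right ?_ _
    rcases le_total ‖Khat t ξ‖ₑ 1 with h | h
    · exact h.trans le_add_self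
    · exact (le_self_pow₀ h two_ne_zero).trans le_self_add
  · rw [lintegral_add_right _ hwm]
    exact ENNReal.add_lt_top.2 ⟨ht, hw.2⟩

/-- The range of a continuous function on `ℝ^d` spans a separable subspace, on which the norm is
computed by countably many coordinate functionals; `P` is the projection to that subspace. -/
theorem exists_coordinates_of_continuous (𝕜 : Type*) [RCLike 𝕜] {H : Type*} [NormedAddCommGroup H]
    [InnerProductSpace 𝕜 H] [CompleteSpace H] {u : E → H} (hu : Continuous u) :
    ∃ (w : Set H) (L : w → H →L[𝕜] 𝕜) (P : H →L[𝕜] H), Countable w ∧ (∀ x, P (u x) = u x) ∧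
      ∀ v, P v = v → ‖v‖ₑ ^ 2 = ∑' i, ‖L i v‖ₑ ^ 2 := by
  set S : Submodule 𝕜 H := (Submodule.span 𝕜 (range u)).topologicalClosure with hS
  have hSc : IsClosed (S : Set H) := Submodule.isClosed_topologicalClosure _
  have : CompleteSpace S := hSc.completeSpace_coe
  have hsep : TopologicalSpace.IsSeparable (S : Set H) := by
    rw [hS, Submodule.topologicalClosure_coe]
    exact (TopologicalSpace.isSeparable_range hu).span.closure
  have : TopologicalSpace.SeparableSpace S := hsep.separableSpace
  obtain ⟨w, b, hb⟩ := exists_hilbertBasis 𝕜 S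
  -- the elements of an orthonormal family are separated, hence countable in a separable space
  have hcount : w.Countable := by
    have hpd : w.PairwiseDisjoint fun v => Metric.ball v (1 / 2) := by
      intro v hv v' hv' hne
      refine Metric.ball_disjoint_ball ?_
      have ho := b.orthonormal
      have h0 : inner 𝕜 v v' = 0 := by
        have := ho.2 (i := ⟨v, hv⟩) (j := ⟨v', hv'⟩) (by simpa using hne)
        simpa [hb] using this
      have h1 : ‖v‖ = 1 := by simpa [hb] using ho.1 ⟨v, hv⟩
      have h2 : ‖v'‖ = 1 := by simpa [hb] using ho.1 ⟨v', hv'⟩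
      have h3 : ‖v - v'‖ * ‖v - v'‖ = ‖v‖ * ‖v‖ + ‖v'‖ * ‖v'‖ := by
        have := norm_add_sq_eq_norm_sq_add_norm_sq_of_inner_eq_zero v (-v') (𝕜 := 𝕜)
          (by rw [inner_neg_right, h0, neg_zero])
        rwa [← sub_eq_add_neg, norm_neg] at this
      rw [dist_eq_norm]
      rw [h1, h2] at h3
      nlinarith [norm_nonneg (v - v')]
    exact hpd.countable_of_isOpen (fun _ _ => Metric.isOpen_ball)
      fun v _ => ⟨v, Metric.mem_ball_self (by norm_num)⟩
  have : Countable w := hcount.to_subtype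
  refine ⟨(Subtype.val '' w), fun i => (innerSL 𝕜 (i : H)), S.starProjection,
    (hcount.image _).to_subtype, fun x => ?_, fun v hv => ?_⟩
  · exact Submodule.starProjection_eq_self_iff.2
      (Submodule.le_topologicalClosure _ (Submodule.subset_span (mem_range_self x)))
  · have hvS : v ∈ S := Submodule.starProjection_eq_self_iff.1 hv
    have e1 := lp.norm_rpow_eq_tsum (p := 2) (by norm_num) (b.repr ⟨v, hvS⟩)
    have e2 := lp.hasSum_norm (p := 2) (by norm_num) (b.repr ⟨v, hvS⟩)
    have e3 : Summable fun i => ‖(b.repr ⟨v, hvS⟩) i‖ ^ 2 := by simpa using e2.summable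
    have e4 : ∀ i : w, (b.repr ⟨v, hvS⟩) i = inner 𝕜 ((i : S) : H) v := fun i => by
      rw [b.repr_apply_apply, hb]; rfl
    rw [LinearIsometryEquiv.norm_map] at e1
    have e5 : ‖v‖ ^ 2 = ∑' i : w, ‖inner 𝕜 ((i : S) : H) v‖ ^ 2 := by
      simpa [e4] using e1
    simp only [e4] at e3
    have e6 : ‖v‖ₑ ^ 2 = ∑' i : w, ‖inner 𝕜 ((i : S) : H) v‖ₑ ^ 2 := by
      rw [← ofReal_norm, ← ENNReal.ofReal_pow (norm_nonneg _), e5,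
        ENNReal.ofReal_tsum_of_nonneg (fun _ => by positivity) e3]
      refine tsum_congr fun i => ?_
      rw [ENNReal.ofReal_pow (norm_nonneg _), ofReal_norm]
    rw [e6]
    exact (Equiv.tsum_eq (Equiv.Set.image Subtype.val w Subtype.val_injective)
      fun i : (Subtype.val '' w : Set H) => ‖innerSL 𝕜 (i : H) v‖ₑ ^ 2)

lemma HasFourierTransform.locallyIntegrable_left {𝕜 : Type*} [RCLike 𝕜] {u : E → 𝕜}
    {uhat : E → ℂ} (h : HasFourierTransform u uhat) : LocallyIntegrable u volume := by
  obtain ⟨k, hk⟩ := h.tempered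
  have : u = fun x => (1 + ‖x‖) ^ k • ((1 + ‖x‖) ^ k)⁻¹ • u x := by
    ext x
    rw [smul_smul, mul_inv_cancel₀ (by positivity), one_smul]
  rw [this]
  rw [← locallyIntegrableOn_univ]
  refine (hk.locallyIntegrable.locallyIntegrableOn univ).continuousOn_smul isOpen_univ.isLocallyClosed
    (Continuous.continuousOn (by fun_prop))

lemma continuous_fourier_dilate {ψ : E → ℂ} (hψ : ContDiff ℝ ∞ ψ) (hψc : HasCompactSupport ψ) :
    Continuous (𝓕 (fun w => ψ ((2 * Real.pi) • w)) : E → ℂ) := by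
  have h2pi : (2 * Real.pi) ≠ 0 := by positivity
  have hcs : HasCompactSupport fun w : E => ψ ((2 * Real.pi) • w) :=
    hψc.comp_homeomorph (Homeomorph.smulOfNeZero _ h2pi)
  have hsm : ContDiff ℝ ∞ fun w : E => ψ ((2 * Real.pi) • w) :=
    hψ.comp (contDiff_const_smul _)
  exact VectorFourier.fourierIntegral_continuous Real.continuous_fourierChar
    (by exact continuous_inner) (hsm.continuous.integrable_of_hasCompactSupport hcs)

/-- The scalar form of the `L₂` bound on a time slice of the source. -/
theorem lintegral_convolution_scalar_le {𝕜 : Type*} [RCLike 𝕜] {K : ℝ → E → 𝕜} {Khat : ℝ → E → ℂ}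
    (hKm : Measurable (Function.uncurry K))
    (hm : Measurable (Function.uncurry Khat)) {C₀ : ℝ≥0} {s : ℝ}
    (hF : ∀ᵐ t ∂(volume.restrict (Ioi s)), HasFourierTransform (K t) (Khat t))
    (h : ∀ᵐ ξ, ∫⁻ t in Ioi s, ‖Khat t ξ‖ₑ ^ 2 ≤ C₀) {ψ : E → 𝕜} (hψ : ContDiff ℝ ∞ ψ)
    (hψc : HasCompactSupport ψ) :
    ∫⁻ t in Ioi s, ∫⁻ x, ‖∫ y, K t y * ψ (x - y)‖ₑ ^ 2 ≤ C₀ * ∫⁻ x, ‖ψ x‖ₑ ^ 2 := by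
  set Ψ : E → ℂ := fun x => rclikeMapIsometry 𝕜 (ψ x) with hΨ
  have hΨs : ContDiff ℝ ∞ Ψ :=
    ((rclikeMapIsometry 𝕜).toContinuousLinearMap.contDiff).comp hψ
  have hΨc : HasCompactSupport Ψ := hψc.comp_left (map_zero _)
  have hkm : Measurable fun z : ℝ × E => ‖Khat z.1 z.2‖ₑ := hm.enorm
  set W : E → ℝ≥0∞ := fun ξ => ‖𝓕 (fun w => Ψ ((2 * Real.pi) • w)) ξ‖ₑ ^ 2 with hW
  have hWm : Measurable W := ((continuous_fourier_dilate hΨs hΨc).measurable.enorm).pow_const 2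
  calc ∫⁻ t in Ioi s, ∫⁻ x, ‖∫ y, K t y * ψ (x - y)‖ₑ ^ 2
      ≤ ∫⁻ t in Ioi s, ENNReal.ofReal ((2 * Real.pi) ^ d) *
          ∫⁻ ξ, ‖Khat t ξ‖ₑ ^ 2 * W ξ := by
        refine lintegral_mono_ae ?_
        filter_upwards [hF, ae_integrable_fourier_of_lintegral_sq_le hm h] with t ht hk
        refine le_trans (le_of_eq ?_) (ht.lintegral_convolution_sq_le hk
          (hKm.comp (measurable_const.prodMk measurable_id)).aestronglyMeasurable hΨs hΨc)
        refine lintegral_congr fun x => ?_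
        simp only [hΨ, rclikeMapIsometry_apply, ← rclikeMap_mul]
        simp only [← rclikeMapIsometry_apply]
        rw [LinearIsometry.integral_comp_comm, LinearIsometry.enorm_map]
    _ = ENNReal.ofReal ((2 * Real.pi) ^ d) *
          ∫⁻ ξ, (∫⁻ t in Ioi s, ‖Khat t ξ‖ₑ ^ 2) * W ξ := by
        rw [lintegral_const_mul _ (Measurable.lintegral_prod_right'
          (f := fun z : ℝ × E => ‖Khat z.1 z.2‖ₑ ^ 2 * W z.2)
          ((hkm.pow_const 2).mul (hWm.comp measurable_snd))),
          lintegral_lintegral_swap ((hkm.pow_const 2).mul (hWm.comp measurable_snd)).aemeasurable]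
        congr 1
        refine lintegral_congr fun ξ => ?_
        exact lintegral_mul_const (W ξ)
          ((hkm.comp (measurable_id.prodMk measurable_const)).pow_const 2)
    _ ≤ ENNReal.ofReal ((2 * Real.pi) ^ d) * ∫⁻ ξ, C₀ * W ξ := by
        refine mul_le_mul_right (lintegral_mono_ae ?_) _
        filter_upwards [h] with ξ hξ
        exact mul_le_mul_left hξ _
    _ = C₀ * ∫⁻ x, ‖ψ x‖ₑ ^ 2 := by
        rw [lintegral_const_mul _ hWm, mul_left_comm, lintegral_fourier_dilate_sq hΨs hΨc]
        simp only [hΨ, LinearIsometry.enorm_map]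

/-- The `L₂` bound on a time slice of the source: for fixed `s`, the map
`u ↦ (K(t,s,·) * u)_{t > s}` is bounded in `L₂`. -/
theorem lintegral_convolution_le {𝕜 : Type*} [RCLike 𝕜] {H : Type*}
    [NormedAddCommGroup H] [InnerProductSpace 𝕜 H] [CompleteSpace H] [NormedSpace ℝ H]
    [IsScalarTower ℝ 𝕜 H] {K : ℝ → E → 𝕜} {Khat : ℝ → E → ℂ}
    (hKm : Measurable (Function.uncurry K))
    (hm : Measurable (Function.uncurry Khat)) {C₀ : ℝ≥0} {s : ℝ}
    (hF : ∀ᵐ t ∂(volume.restrict (Ioi s)), HasFourierTransform (K t) (Khat t))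
    (h : ∀ᵐ ξ, ∫⁻ t in Ioi s, ‖Khat t ξ‖ₑ ^ 2 ≤ C₀) {u : E → H} (hu : ContDiff ℝ ∞ u)
    (huc : HasCompactSupport u) :
    ∫⁻ t in Ioi s, ∫⁻ x, ‖∫ y, K t y • u (x - y)‖ₑ ^ 2 ≤ C₀ * ∫⁻ x, ‖u x‖ₑ ^ 2 := by
  -- expand in an orthonormal basis of the separable space spanned by the values of `u`
  obtain ⟨w, L, P, hw, hP, hL⟩ := exists_coordinates_of_continuous 𝕜 hu.continuous
  have hLs : ∀ i, ContDiff ℝ ∞ fun x => L i (u x) := fun i =>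
    ((L i).restrictScalars ℝ).contDiff.comp hu
  have hLc : ∀ i, HasCompactSupport fun x => L i (u x) := fun i => huc.comp_left (map_zero _)
  have hmeas : ∀ i, Measurable fun z : ℝ × E => ‖∫ y, K z.1 y * L i (u (z.2 - y))‖ₑ ^ 2 := by
    intro i
    have : StronglyMeasurable fun z : ℝ × E => ∫ y, K z.1 y * L i (u (z.2 - y)) := by
      refine StronglyMeasurable.integral_prod_right
        (f := fun (z : ℝ × E) y => K z.1 y * L i (u (z.2 - y))) ?_
      refine Measurable.stronglyMeasurable ?_
      refine Measurable.mul (hKm.comp ((measurable_fst.comp measurable_fst).prodMk measurable_snd))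
        ((hLs i).continuous.measurable.comp
          ((measurable_snd.comp measurable_fst).sub measurable_snd))
    exact this.measurable.enorm.pow_const 2
  calc ∫⁻ t in Ioi s, ∫⁻ x, ‖∫ y, K t y • u (x - y)‖ₑ ^ 2
      = ∫⁻ t in Ioi s, ∑' i, ∫⁻ x, ‖∫ y, K t y * L i (u (x - y))‖ₑ ^ 2 := by
        refine lintegral_congr_ae ?_
        filter_upwards [hF] with t ht
        have hmeas' : ∀ i, AEMeasurable
            (fun x => ‖∫ y, K t y * L i (u (x - y))‖ₑ ^ 2) volume := fun i =>
          ((hmeas i).comp (measurable_const.prodMk measurable_id)).aemeasurable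
        rw [← lintegral_tsum hmeas']
        refine lintegral_congr fun x => ?_
        have hint : Integrable (fun y => K t y • u (x - y)) volume :=
          huc.convolutionExists_right (ContinuousLinearMap.lsmul 𝕜 𝕜) ht.locallyIntegrable_left
            hu.continuous x
        rw [hL _ ?_]
        · refine tsum_congr fun i => ?_
          rw [← ContinuousLinearMap.integral_comp_comm (L i) hint]
          simp only [map_smul, smul_eq_mul]
        · rw [← ContinuousLinearMap.integral_comp_comm P hint]
          simp only [map_smul, hP]
    _ = ∑' i, ∫⁻ t in Ioi s, ∫⁻ x, ‖∫ y, K t y * L i (u (x - y))‖ₑ ^ 2 :=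
        lintegral_tsum fun i => (hmeas i).lintegral_prod_right'.aemeasurable
    _ ≤ ∑' i, C₀ * ∫⁻ x, ‖L i (u x)‖ₑ ^ 2 := ENNReal.tsum_le_tsum fun i =>
        lintegral_convolution_scalar_le hKm hm hF h (hLs i) (hLc i)
    _ = C₀ * ∫⁻ x, ‖u x‖ₑ ^ 2 := by
        rw [ENNReal.tsum_mul_left, ← lintegral_tsum fun i =>
          ((hLs i).continuous.measurable.enorm.pow_const 2).aemeasurable]
        congr 1
        refine lintegral_congr fun x => ?_
        rw [hL _ (hP x)]

end SliceBound

/-! ### Weighted `L₂` bounds from scaling -/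

section Scaling

variable {d : ℕ}

local notation "E" => EuclideanSpace ℝ (Fin d)

lemma enorm_rpow_eq_ofReal {V : Type*} [NormedAddCommGroup V] (x : V) {ν : ℝ} (hν : 0 ≤ ν) :
    ‖x‖ₑ ^ ν = ENNReal.ofReal (‖x‖ ^ ν) := by
  rw [← ofReal_norm, ENNReal.ofReal_rpow_of_nonneg (norm_nonneg _) hν]

lemma enorm_sq_eq_ofReal {V : Type*} [NormedAddCommGroup V] (x : V) :
    ‖x‖ₑ ^ 2 = ENNReal.ofReal (‖x‖ ^ 2) := by
  rw [← ofReal_norm, ENNReal.ofReal_pow (norm_nonneg _)]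

/-- A weighted `L₂` bound on a profile `F` gives one on a function dominated by a dilate of `F`. -/
theorem setLIntegral_weight_dilate_le {𝕜 : Type*} [RCLike 𝕜] {g : E → 𝕜} {F : E → ℝ}
    {C τ σ κ μ ρ : ℝ} {M : ℝ≥0∞} (hτ : 0 < τ) (hμ : 0 ≤ μ)
    (hg : ∀ᵐ x, ‖g x‖ ≤ C * (τ ^ (-σ) * |F (τ ^ (-κ) • x)|))
    (hM : ∫⁻ x in {x | ρ ≤ ‖x‖}, ENNReal.ofReal (‖x‖ ^ μ * |F x| ^ 2) ≤ M) :
    ∫⁻ x in {x | τ ^ κ * ρ ≤ ‖x‖}, ‖x‖ₑ ^ μ * ‖g x‖ₑ ^ 2 ≤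
      ENNReal.ofReal (C ^ 2 * τ ^ (κ * (μ + d) - 2 * σ)) * M := by
  have hτκ : 0 < τ ^ κ := Real.rpow_pos_of_pos hτ _
  have hτκ' : 0 < τ ^ (-κ) := Real.rpow_pos_of_pos hτ _
  have hms : ∀ ρ : ℝ, MeasurableSet {x : E | ρ ≤ ‖x‖} := fun ρ =>
    (isClosed_le continuous_const continuous_norm).measurableSet
  set Fw : E → ℝ≥0∞ :=
    {x : E | ρ ≤ ‖x‖}.indicator fun x => ENNReal.ofReal (‖x‖ ^ μ * |F x| ^ 2) with hFw
  have hnorm : ∀ x : E, ‖τ ^ (-κ) • x‖ = τ ^ (-κ) * ‖x‖ := fun x => by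
    rw [norm_smul, Real.norm_of_nonneg hτκ'.le]
  calc ∫⁻ x in {x | τ ^ κ * ρ ≤ ‖x‖}, ‖x‖ₑ ^ μ * ‖g x‖ₑ ^ 2
      = ∫⁻ x, {x : E | τ ^ κ * ρ ≤ ‖x‖}.indicator (fun x => ‖x‖ₑ ^ μ * ‖g x‖ₑ ^ 2) x :=
        (lintegral_indicator (hms _) _).symm
    _ ≤ ∫⁻ x, ENNReal.ofReal (C ^ 2 * τ ^ (κ * μ - 2 * σ)) * Fw (τ ^ (-κ) • x) := by
        refine lintegral_mono_ae ?_
        filter_upwards [hg] with x hx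
        by_cases hxρ : τ ^ κ * ρ ≤ ‖x‖
        · have h1 : ρ ≤ ‖τ ^ (-κ) • x‖ := by
            rw [hnorm, Real.rpow_neg hτ.le]
            rwa [le_inv_mul_iff₀ hτκ]
          rw [indicator_of_mem (by exact hxρ), hFw, indicator_of_mem (by exact h1),
            enorm_rpow_eq_ofReal _ hμ, enorm_sq_eq_ofReal, ← ENNReal.ofReal_mul (by positivity),
            ← ENNReal.ofReal_mul (by positivity)]
          refine ENNReal.ofReal_le_ofReal ?_
          have h2 : ‖g x‖ ^ 2 ≤ (C * (τ ^ (-σ) * |F (τ ^ (-κ) • x)|)) ^ 2 :=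
            pow_le_pow_left₀ (norm_nonneg _) hx 2
          refine (mul_le_mul_of_nonneg_left h2 (by positivity)).trans (le_of_eq ?_)
          rw [hnorm, Real.mul_rpow hτκ'.le (norm_nonneg _), ← Real.rpow_mul hτ.le,
            Real.rpow_sub hτ, Real.rpow_neg hτ.le σ, neg_mul, Real.rpow_neg hτ.le (κ * μ),
            mul_comm 2 σ, Real.rpow_mul hτ.le σ 2]
          have e : (0 : ℝ) < τ ^ (κ * μ) := Real.rpow_pos_of_pos hτ _
          norm_cast
          field_simp
        · rw [indicator_of_notMem (by exact hxρ)]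
          exact zero_le
    _ = ENNReal.ofReal (C ^ 2 * τ ^ (κ * μ - 2 * σ)) *
          (ENNReal.ofReal (τ ^ (κ * d)) *
            ∫⁻ x in {x | ρ ≤ ‖x‖}, ENNReal.ofReal (‖x‖ ^ μ * |F x| ^ 2)) := by
        rw [lintegral_const_mul' _ _ ENNReal.ofReal_ne_top, lintegral_comp_smul_of_pos Fw hτκ',
          hFw, lintegral_indicator (hms _), finrank_euclideanSpace_fin, ← Real.rpow_mul hτ.le,
          neg_mul_neg]
    _ ≤ ENNReal.ofReal (C ^ 2 * τ ^ (κ * μ - 2 * σ)) * (ENNReal.ofReal (τ ^ (κ * d)) * M) :=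
        mul_le_mul_right (mul_le_mul_right hM _) _
    _ = _ := by
        rw [← mul_assoc, ← ENNReal.ofReal_mul (by positivity), mul_assoc (C ^ 2),
          ← Real.rpow_add hτ]
        ring_nf

/-- A function dominated by a dilated profile outside a ball and by a constant inside it, with
matching exponents, has weighted `L₂` norms of one homogeneity. -/
theorem lintegral_weight_min_le {𝕜 : Type*} [RCLike 𝕜] (hd : 1 ≤ d) {g : E → 𝕜} {F : E → ℝ}
    {C τ σ κ c μ ν γ : ℝ} {M : ℝ≥0∞} (hτ : 0 < τ) (hC : 0 ≤ C)
    (hg : ∀ᵐ x, ‖g x‖ ≤ C * min (τ ^ (-σ) * |F (τ ^ (-κ) • x)|) (τ ^ (-c)))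
    (hM : ∫⁻ x in {x | τ ^ (γ - κ) ≤ ‖x‖}, ENNReal.ofReal (‖x‖ ^ μ * |F x| ^ 2) ≤ M)
    (hν : 0 ≤ ν) (hνμ : ν ≤ μ) (hrel : (γ - κ) * μ = d * (κ - γ) + 2 * (c - σ)) :
    ∫⁻ x, ‖x‖ₑ ^ ν * ‖g x‖ₑ ^ 2 ≤
      ENNReal.ofReal (C ^ 2) * (volume (Metric.ball (0 : E) 1) + M) *
        ENNReal.ofReal (τ ^ (γ * (ν + d) - 2 * c)) := by
  have hτγ : 0 < τ ^ γ := Real.rpow_pos_of_pos hτ _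
  have hne : Nonempty (Fin d) := ⟨⟨0, by omega⟩⟩
  have hcompl : (Metric.ball (0 : E) (τ ^ γ))ᶜ = {x : E | τ ^ κ * τ ^ (γ - κ) ≤ ‖x‖} := by
    ext x
    rw [← Real.rpow_add hτ]
    simp
  rw [← lintegral_add_compl _ (Metric.isOpen_ball (x := (0 : E)) (ε := τ ^ γ)).measurableSet,
    mul_add, add_mul]
  -- inside the ball the constant bound is used, outside it the profile
  refine add_le_add ?_ ?_
  · have h1 : ∀ᵐ x, x ∈ Metric.ball (0 : E) (τ ^ γ) →
        ‖x‖ₑ ^ ν * ‖g x‖ₑ ^ 2 ≤ ENNReal.ofReal (C ^ 2 * τ ^ (γ * ν - 2 * c)) := by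
      filter_upwards [hg] with x hx hxb
      rw [mem_ball_zero_iff] at hxb
      rw [enorm_rpow_eq_ofReal _ hν, enorm_sq_eq_ofReal, ← ENNReal.ofReal_mul (by positivity)]
      refine ENNReal.ofReal_le_ofReal ?_
      have h2 : ‖g x‖ ≤ C * τ ^ (-c) :=
        hx.trans (mul_le_mul_of_nonneg_left (min_le_right _ _) hC)
      have h3 : ‖x‖ ^ ν ≤ (τ ^ γ) ^ ν := Real.rpow_le_rpow (norm_nonneg _) hxb.le hν
      refine (mul_le_mul h3 (pow_le_pow_left₀ (norm_nonneg _) h2 2) (by positivity)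
        (by positivity)).trans (le_of_eq ?_)
      rw [← Real.rpow_mul hτ.le, mul_pow, ← Real.rpow_natCast, ← Real.rpow_natCast (τ ^ (-c)),
        ← Real.rpow_mul hτ.le, mul_left_comm, ← Real.rpow_add hτ]
      congr 2
      push_cast
      ring
    refine (setLIntegral_mono_ae measurable_const.aemeasurable h1 |>.trans (le_of_eq ?_))
    rw [lintegral_const, Measure.restrict_apply_univ, Measure.addHaar_ball _ _ hτγ.le,
      finrank_euclideanSpace_fin, ← mul_assoc, ← ENNReal.ofReal_mul (by positivity),
      mul_right_comm (ENNReal.ofReal (C ^ 2)), ← ENNReal.ofReal_mul (by positivity),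
      mul_assoc (C ^ 2), ← Real.rpow_natCast (τ ^ γ), ← Real.rpow_mul hτ.le,
      ← Real.rpow_add hτ]
    ring_nf
  · rw [hcompl]
    have h1 := setLIntegral_weight_dilate_le (C := C) hτ (hν.trans hνμ)
      (hg.mono fun x hx => hx.trans (mul_le_mul_of_nonneg_left (min_le_left _ _) hC)) hM
    calc ∫⁻ x in {x | τ ^ κ * τ ^ (γ - κ) ≤ ‖x‖}, ‖x‖ₑ ^ ν * ‖g x‖ₑ ^ 2
        ≤ ∫⁻ x in {x | τ ^ κ * τ ^ (γ - κ) ≤ ‖x‖},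
            ENNReal.ofReal (τ ^ (γ * (ν - μ))) * (‖x‖ₑ ^ μ * ‖g x‖ₑ ^ 2) := by
          refine setLIntegral_mono' (isClosed_le continuous_const continuous_norm).measurableSet
            fun x hx => ?_
          rw [← mul_assoc]
          refine mul_le_mul_left ?_ _
          have hx' : τ ^ γ ≤ ‖x‖ := by
            rw [mem_ofPred_eq, ← Real.rpow_add hτ] at hx
            simpa using hx
          have hx0 : 0 < ‖x‖ := hτγ.trans_le hx'
          rw [enorm_rpow_eq_ofReal _ hν, enorm_rpow_eq_ofReal _ (hν.trans hνμ),
            ← ENNReal.ofReal_mul (by positivity)]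
          refine ENNReal.ofReal_le_ofReal ?_
          have e : ‖x‖ ^ ν = ‖x‖ ^ (ν - μ) * ‖x‖ ^ μ := by
            rw [← Real.rpow_add hx0]; ring_nf
          rw [e, Real.rpow_mul hτ.le]
          exact mul_le_mul_of_nonneg_right
            (Real.rpow_le_rpow_of_nonpos hτγ hx' (by linarith)) (by positivity)
      _ ≤ ENNReal.ofReal (τ ^ (γ * (ν - μ))) *
            (ENNReal.ofReal (C ^ 2 * τ ^ (κ * (μ + d) - 2 * σ)) * M) := by
          rw [lintegral_const_mul' _ _ ENNReal.ofReal_ne_top]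
          exact mul_le_mul_right h1 _
      _ = _ := by
          rw [← mul_assoc, ← ENNReal.ofReal_mul (by positivity), mul_right_comm,
            ← ENNReal.ofReal_mul (by positivity), mul_left_comm, ← Real.rpow_add hτ]
          congr 4
          linarith

lemma sq_sum_enorm_le {ι : Type*} (s : Finset ι) (f : ι → ℝ≥0∞) :
    (∑ i ∈ s, f i) ^ 2 ≤ s.card * ∑ i ∈ s, f i ^ 2 := by
  have := ENNReal.inner_le_Lp_mul_Lq s f 1 Real.HolderConjugate.two_two
  simp only [Pi.one_apply, mul_one, ENNReal.one_rpow, Finset.sum_const, nsmul_eq_mul] at this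
  have h2 := pow_le_pow_left₀ zero_le this 2
  have e : ∀ a : ℝ≥0∞, (a ^ (1 / 2 : ℝ)) ^ 2 = a := fun a => by
    rw [← ENNReal.rpow_natCast, ← ENNReal.rpow_mul]
    norm_num
  rw [mul_pow, e, e, mul_comm] at h2
  exact_mod_cast h2

/-- A Hardy inequality for the weighted `L₂` norm, with the gradient bounded componentwise. -/
theorem VanishesAtInfinity.lintegral_le_of_forall {𝕜 : Type*} [RCLike 𝕜] (hd : 1 ≤ d) {u : E → 𝕜}
    (hu0 : VanishesAtInfinity u) {g : Fin d → E → 𝕜}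
    (hg : ∀ i, HasWeakDerivOn {0}ᶜ (EuclideanSpace.single i 1) u (g i))
    (hgm : ∀ i, AEStronglyMeasurable (g i) volume) {κ : ℝ} (hκ : 0 ≤ κ)
    {B : ℝ≥0∞} (hB : ∀ i, ∫⁻ z, ‖z‖ₑ ^ (κ + 2) * ‖g i z‖ₑ ^ 2 ≤ B) :
    ∫⁻ z, ‖z‖ₑ ^ κ * ‖u z‖ₑ ^ 2 ≤ 4 * (d * (d * B)) := by
  refine (hu0.lintegral_le hd (hg ⟨0, by omega⟩).locallyIntegrableOn hg hκ).trans ?_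
  refine mul_le_mul_right ?_ _
  calc ∫⁻ z, ‖z‖ₑ ^ (κ + 2) * (∑ i, ‖g i z‖ₑ) ^ 2
      ≤ ∫⁻ z, d * ∑ i, ‖z‖ₑ ^ (κ + 2) * ‖g i z‖ₑ ^ 2 := by
        refine lintegral_mono fun z => ?_
        rw [← Finset.mul_sum, mul_left_comm]
        refine mul_le_mul_right ?_ _
        simpa using sq_sum_enorm_le Finset.univ fun i => ‖g i z‖ₑ
    _ = d * ∑ i, ∫⁻ z, ‖z‖ₑ ^ (κ + 2) * ‖g i z‖ₑ ^ 2 := by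
        rw [lintegral_const_mul' _ _ (ENNReal.natCast_ne_top d), lintegral_finsetSum']
        intro i _
        exact ((measurable_enorm.pow_const _).aemeasurable).mul ((hgm i).enorm.pow_const 2)
    _ ≤ d * (d * B) := by
        refine mul_le_mul_right ?_ _
        refine (Finset.sum_le_sum fun i _ => hB i).trans ?_
        simp

end Scaling

/-! ### Increments of weakly differentiable functions in weighted `L₂` -/

section Increments

variable {d : ℕ}

local notation "E" => EuclideanSpace ℝ (Fin d)

lemma ENNReal_add_rpow_le (a b : ℝ≥0∞) {κ : ℝ} (hκ : 0 ≤ κ) :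
    (a + b) ^ κ ≤ 2 ^ κ * (a ^ κ + b ^ κ) := by
  have h1 : a + b ≤ 2 * max a b := by
    rw [two_mul]
    exact add_le_add (le_max_left _ _) (le_max_right _ _)
  refine (ENNReal.rpow_le_rpow h1 hκ).trans ?_
  rw [ENNReal.mul_rpow_of_nonneg _ _ hκ]
  refine mul_le_mul_right ?_ _
  rcases le_total a b with h | h
  · rw [max_eq_right h]; exact le_add_self
  · rw [max_eq_left h]; exact le_self_add

lemma sq_setLIntegral_Ioc_le {f : ℝ → ℝ≥0∞} (hf : AEMeasurable f) (r : ℝ) :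
    (∫⁻ θ in Ioc 0 r, f θ) ^ 2 ≤ ENNReal.ofReal r * ∫⁻ θ in Ioc 0 r, f θ ^ 2 := by
  have := sq_lintegral_mul_le (ν := volume.restrict (Ioc 0 r)) (f := fun _ => 1) (g := f)
    aemeasurable_const hf.restrict
  simpa using this

/-- Weak partial derivatives combine to a weak directional derivative. -/
theorem HasWeakDerivOn.sum_coord {𝕜 : Type*} [RCLike 𝕜] {Ω : Set E} {u : E → 𝕜}
    {g : Fin d → E → 𝕜} (hd : 1 ≤ d)
    (h : ∀ i, HasWeakDerivOn Ω (EuclideanSpace.single i 1) u (g i)) (v : E) :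
    HasWeakDerivOn Ω v u fun x => ∑ i, v i • g i x := by
  have hu := (h ⟨0, by omega⟩).locallyIntegrableOn
  refine ⟨hu, ?_, fun φ hφ hφc hφΩ => ?_⟩
  · intro x hx
    choose t ht hi using fun i => (h i).locallyIntegrableOn_deriv x hx
    refine ⟨⋂ i, t i, (Filter.iInter_mem).2 ht, integrable_finsetSum _ fun i _ => ?_⟩
    exact Integrable.smul (v i) ((hi i).mono_set (iInter_subset t i))
  · have hv : v = ∑ i, v i • EuclideanSpace.single i (1 : ℝ) := by
      ext j
      simp [Finset.sum_apply, Pi.single_apply]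
    have h1 : ∀ x, fderiv ℝ φ x v • u x =
        ∑ i, v i • (fderiv ℝ φ x (EuclideanSpace.single i 1) • u x) := by
      intro x
      conv_lhs => rw [hv]
      rw [map_sum, Finset.sum_smul]
      refine Finset.sum_congr rfl fun i _ => ?_
      rw [map_smul, smul_assoc]
    have h2 : ∀ x, φ x • ∑ i, v i • g i x = ∑ i, v i • (φ x • g i x) := by
      intro x
      rw [Finset.smul_sum]
      exact Finset.sum_congr rfl fun i _ => smul_comm _ _ _
    simp only [h1, h2]
    rw [integral_finsetSum, integral_finsetSum, ← Finset.sum_neg_distrib]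
    · refine Finset.sum_congr rfl fun i _ => ?_
      rw [integral_smul, integral_smul, (h i).integral_eq φ hφ hφc hφΩ, smul_neg]
    · intro i _
      exact Integrable.smul (v i) (integrable_smul_of_locallyIntegrableOn hφc hφΩ hφ.continuous
        (fun y hy => image_eq_zero_of_notMem_tsupport hy) (h i).locallyIntegrableOn_deriv)
    · intro i _
      refine Integrable.smul (v i) (integrable_smul_of_locallyIntegrableOn (φ := fun x =>
        fderiv ℝ φ x (EuclideanSpace.single i 1)) hφc hφΩ
        ((hφ.continuous_fderiv (by simp)).clm_apply continuous_const)
        (fun y hy => ?_) hu)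
      have : fderiv ℝ φ y = 0 := by
        by_contra hne
        exact hy (support_fderiv_subset ℝ hne)
      rw [this]; rfl

/-- A translation increment is controlled in weighted `L₂` by the weak derivative. -/
theorem HasWeakDerivOn.lintegral_weight_translate_sub_le {𝕜 : Type*} [RCLike 𝕜] {v : E}
    {u g : E → 𝕜} (h : HasWeakDerivOn univ v u g) {κ : ℝ} (hκ : 0 ≤ κ) :
    ∫⁻ x, ‖x‖ₑ ^ κ * ‖u (x + v) - u x‖ₑ ^ 2 ≤
      2 ^ κ * ((∫⁻ x, ‖x‖ₑ ^ κ * ‖g x‖ₑ ^ 2) + ‖v‖ₑ ^ κ * ∫⁻ x, ‖g x‖ₑ ^ 2) := by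
  obtain ⟨g', hg'm, hgg', h'⟩ := h.exists_stronglyMeasurable isOpen_univ
  have hgg : g =ᵐ[volume] g' := hgg'.mono fun x hx => hx (mem_univ x)
  have e1 : ∫⁻ x, ‖x‖ₑ ^ κ * ‖g x‖ₑ ^ 2 = ∫⁻ x, ‖x‖ₑ ^ κ * ‖g' x‖ₑ ^ 2 :=
    lintegral_congr_ae (hgg.mono fun x hx => by simp only [hx])
  have e2 : ∫⁻ x, ‖g x‖ₑ ^ 2 = ∫⁻ x, ‖g' x‖ₑ ^ 2 :=
    lintegral_congr_ae (hgg.mono fun x hx => by simp only [hx])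
  rw [e1, e2]
  have hgm : Measurable fun x => ‖g' x‖ₑ := hg'm.enorm
  have hwm : Measurable fun x : E => ‖x‖ₑ ^ κ := measurable_enorm.pow_const _
  have hpm : Measurable fun z : E × ℝ => z.1 + z.2 • v := by fun_prop
  have hjm : Measurable fun z : E × ℝ => ‖z.1‖ₑ ^ κ * ‖g' (z.1 + z.2 • v)‖ₑ ^ 2 :=
    (hwm.comp measurable_fst).mul ((hgm.comp hpm).pow_const 2)
  have htr := h'.ae_enorm_translate_sub_le isOpen_univ hg'm (r := 1) zero_le_one
    (fun _ _ _ _ => mem_univ _)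
  calc ∫⁻ x, ‖x‖ₑ ^ κ * ‖u (x + v) - u x‖ₑ ^ 2
      ≤ ∫⁻ x, ∫⁻ θ in Ioc (0 : ℝ) 1, ‖x‖ₑ ^ κ * ‖g' (x + θ • v)‖ₑ ^ 2 := by
        refine lintegral_mono_ae ?_
        filter_upwards [htr] with x hx
        have hx' := hx (mem_univ x)
        rw [one_smul] at hx'
        have hmx : Measurable fun θ : ℝ => ‖g' (x + θ • v)‖ₑ :=
          (hgm.comp hpm).comp (measurable_const.prodMk measurable_id)
        rw [lintegral_const_mul _ (hmx.pow_const 2)]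
        refine mul_le_mul_right ?_ _
        refine (pow_le_pow_left₀ zero_le hx' 2).trans ?_
        simpa using sq_setLIntegral_Ioc_le hmx.aemeasurable 1
    _ = ∫⁻ θ in Ioc (0 : ℝ) 1, ∫⁻ x, ‖x‖ₑ ^ κ * ‖g' (x + θ • v)‖ₑ ^ 2 :=
        lintegral_lintegral_swap hjm.aemeasurable
    _ ≤ ∫⁻ θ in Ioc (0 : ℝ) 1, 2 ^ κ * ((∫⁻ x, ‖x‖ₑ ^ κ * ‖g' x‖ₑ ^ 2) +
          ‖v‖ₑ ^ κ * ∫⁻ x, ‖g' x‖ₑ ^ 2) := by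
        refine setLIntegral_mono' measurableSet_Ioc fun θ hθ => ?_
        have e3 : ∀ x : E, ‖x‖ₑ ^ κ * ‖g' (x + θ • v)‖ₑ ^ 2 ≤
            2 ^ κ * (‖x + θ • v‖ₑ ^ κ * ‖g' (x + θ • v)‖ₑ ^ 2 +
              ‖v‖ₑ ^ κ * ‖g' (x + θ • v)‖ₑ ^ 2) := by
          intro x
          rw [← add_mul, ← mul_assoc]
          refine mul_le_mul_left ?_ _
          refine le_trans (ENNReal.rpow_le_rpow ?_ hκ) (ENNReal_add_rpow_le _ _ hκ)
          have hθv : ‖θ • v‖ₑ ≤ ‖v‖ₑ := by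
            rw [enorm_smul]
            refine mul_le_of_le_one_left zero_le ?_
            rw [Real.enorm_of_nonneg hθ.1.le]
            exact ENNReal.ofReal_le_one.2 hθ.2
          calc ‖x‖ₑ = ‖(x + θ • v) - θ • v‖ₑ := by rw [add_sub_cancel_right]
            _ ≤ ‖x + θ • v‖ₑ + ‖θ • v‖ₑ := enorm_sub_le
            _ ≤ _ := by gcongr
        refine (lintegral_mono e3).trans (le_of_eq ?_)
        rw [lintegral_const_mul' _ _ (ENNReal.rpow_ne_top_of_nonneg hκ (by norm_num)),
          lintegral_add_left, lintegral_const_mul',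
          lintegral_add_right_eq_self (fun x => ‖x‖ₑ ^ κ * ‖g' x‖ₑ ^ 2) (θ • v),
          lintegral_add_right_eq_self (fun x => ‖g' x‖ₑ ^ 2) (θ • v)]
        · exact ENNReal.rpow_ne_top_of_nonneg hκ enorm_ne_top
        · have hp : Measurable fun x : E => x + θ • v := by fun_prop
          exact (hwm.comp hp).mul ((hgm.comp hp).pow_const 2)
    _ = _ := by simp

/-- A time increment of a function on `(s,∞) × ℝ^d` is controlled in weighted `L₂` by its weak time
derivative, when the latter has a bound of one homogeneity in `t - s`. -/
theorem HasWeakDerivOn.lintegral_weight_time_sub_le {𝕜 : Type*} [RCLike 𝕜] {s : ℝ}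
    {u g : ℝ → E → 𝕜} (h : HasWeakDerivOn (Ioi s ×ˢ univ) ((1 : ℝ), (0 : E))
      (fun z => u z.1 z.2) fun z => g z.1 z.2) {κ e : ℝ} {B : ℝ≥0}
    (hB : ∀ᵐ t, s < t → ∫⁻ x, ‖x‖ₑ ^ κ * ‖g t x‖ₑ ^ 2 ≤ B * ENNReal.ofReal ((t - s) ^ e))
    {r : ℝ} (hr : 0 < r) :
    ∀ᵐ t, r ≤ t - s → ∫⁻ x, ‖x‖ₑ ^ κ * ‖u (t + r) x - u t x‖ₑ ^ 2 ≤
      2 ^ |e| * B * ENNReal.ofReal (r ^ 2 * (t - s) ^ e) := by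
  have : (volume : Measure (ℝ × E)).IsAddHaarMeasure := by
    rw [Measure.volume_eq_prod]; infer_instance
  have hΩ : IsOpen (Ioi s ×ˢ (univ : Set E)) := isOpen_Ioi.prod isOpen_univ
  obtain ⟨g', hg'm, hgg', h'⟩ := h.exists_stronglyMeasurable hΩ
  have hgm : Measurable fun z => ‖g' z‖ₑ := hg'm.enorm
  have hwm : Measurable fun x : E => ‖x‖ₑ ^ κ := measurable_enorm.pow_const _
  have hB' : ∀ᵐ t, s < t → ∫⁻ x, ‖x‖ₑ ^ κ * ‖g' (t, x)‖ₑ ^ 2 ≤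
      B * ENNReal.ofReal ((t - s) ^ e) := by
    filter_upwards [hB, Measure.ae_ae_of_ae_prod hgg'] with t ht ht' hst
    refine le_trans (le_of_eq (lintegral_congr_ae ?_)) (ht hst)
    filter_upwards [ht'] with x hx
    rw [hx ⟨hst, mem_univ _⟩]
  have htr := Measure.ae_ae_of_ae_prod (h'.ae_enorm_translate_sub_le hΩ hg'm hr.le (by
    rintro ⟨t, x⟩ hx θ hθ
    refine ⟨?_, mem_univ _⟩
    have : s < t := hx.1
    simp only [Prod.smul_mk, smul_eq_mul, mul_one, Prod.mk_add_mk, mem_Ioi]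
    linarith [hθ.1]))
  filter_upwards [htr] with t ht hrt
  have hst : s < t := by linarith
  have hτ : 0 < t - s := by linarith
  have hBt : ∀ᵐ θ, s < t + θ → ∫⁻ x, ‖x‖ₑ ^ κ * ‖g' (t + θ, x)‖ₑ ^ 2 ≤
      B * ENNReal.ofReal ((t + θ - s) ^ e) :=
    (measurePreserving_add_left volume t).quasiMeasurePreserving.ae hB'
  have hpm : Measurable fun z : E × ℝ => (t + z.2, z.1) := by fun_prop
  have hjm : Measurable fun z : E × ℝ => ‖z.1‖ₑ ^ κ * ‖g' (t + z.2, z.1)‖ₑ ^ 2 :=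
    (hwm.comp measurable_fst).mul ((hgm.comp hpm).pow_const 2)
  calc ∫⁻ x, ‖x‖ₑ ^ κ * ‖u (t + r) x - u t x‖ₑ ^ 2
      ≤ ∫⁻ x, ENNReal.ofReal r * ∫⁻ θ in Ioc (0 : ℝ) r, ‖x‖ₑ ^ κ * ‖g' (t + θ, x)‖ₑ ^ 2 := by
        refine lintegral_mono_ae ?_
        filter_upwards [ht] with x hx
        have hx' := hx ⟨hst, mem_univ _⟩
        simp only [Prod.smul_mk, smul_eq_mul, mul_one, smul_zero, Prod.mk_add_mk, add_zero] at hx'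
        have hmx : Measurable fun θ : ℝ => ‖g' (t + θ, x)‖ₑ :=
          (hgm.comp hpm).comp (measurable_const.prodMk measurable_id)
        rw [lintegral_const_mul _ (hmx.pow_const 2), mul_left_comm]
        refine mul_le_mul_right ?_ _
        exact (pow_le_pow_left₀ zero_le hx' 2).trans (sq_setLIntegral_Ioc_le hmx.aemeasurable r)
    _ = ENNReal.ofReal r *
          ∫⁻ θ in Ioc (0 : ℝ) r, ∫⁻ x, ‖x‖ₑ ^ κ * ‖g' (t + θ, x)‖ₑ ^ 2 := by
        rw [lintegral_const_mul' _ _ ENNReal.ofReal_ne_top,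
          lintegral_lintegral_swap hjm.aemeasurable]
    _ ≤ ENNReal.ofReal r * ∫⁻ θ in Ioc (0 : ℝ) r,
          B * (2 ^ |e| * ENNReal.ofReal ((t - s) ^ e)) := by
        refine mul_le_mul_right (setLIntegral_mono_ae measurable_const.aemeasurable ?_) _
        filter_upwards [hBt] with θ hθ hθr
        refine (hθ (by linarith [hθr.1])).trans (mul_le_mul_right ?_ _)
        have h2 : (2 : ℝ≥0∞) ^ |e| = ENNReal.ofReal ((2 : ℝ) ^ |e|) := by
          rw [← ENNReal.ofReal_rpow_of_nonneg zero_le_two (abs_nonneg _)]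
          simp
        rw [h2, ← ENNReal.ofReal_mul (by positivity)]
        refine ENNReal.ofReal_le_ofReal ?_
        -- on the time interval in question `t + θ - s` lies between `t - s` and `2 (t - s)`
        have h3 : t - s ≤ t + θ - s := by linarith [hθr.1]
        have h4 : t + θ - s ≤ 2 * (t - s) := by linarith [hθr.2]
        rcases le_total 0 e with he | he
        · rw [abs_of_nonneg he, ← Real.mul_rpow zero_le_two hτ.le]
          exact Real.rpow_le_rpow (by linarith) h4 he
        · refine (Real.rpow_le_rpow_of_nonpos hτ h3 he).trans ?_
          exact le_mul_of_one_le_left (by positivity)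
            (Real.one_le_rpow one_le_two (abs_nonneg _))
    _ = _ := by
        rw [lintegral_const, Measure.restrict_apply_univ, Real.volume_Ioc, sub_zero, pow_two,
          mul_assoc r r, ENNReal.ofReal_mul hr.le, ENNReal.ofReal_mul hr.le]
        ring

end Increments

/-! ### Homogeneous estimates on the kernel -/

section KernelBounds

variable {d : ℕ}

local notation "E" => EuclideanSpace ℝ (Fin d)

/-- The homogeneous estimates on the kernel that drive the comparison of the square function at two
points: with `τ = t - s` and the parabolic-type scaling `|x| ~ τ ^ γ`, the kernel decays in weighted
`L₂`, and so do its increments in space (of size at most `A τ ^ γ`) and in time. -/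
structure KernelEstimates {𝕜 : Type*} [RCLike 𝕜] (K : ℝ → ℝ → E → 𝕜) (γ : ℝ) (ν : Fin 3 → ℝ)
    (A : ℝ) (N : ℝ≥0) : Prop where
  dim_lt : ∀ n, (d : ℝ) < ν n
  locallyIntegrable : ∀ s, ∀ᵐ t, s < t → LocallyIntegrable (K t s) volume
  weight : ∀ s, ∀ᵐ t, s < t →
    ∫⁻ x, ‖x‖ₑ ^ ν 0 * ‖K t s x‖ₑ ^ 2 ≤ N * ENNReal.ofReal ((t - s) ^ (γ * (ν 0 - d) - 1))
  space : ∀ s, ∀ᵐ t, s < t → ∀ v : E, ‖v‖ ≤ A * (t - s) ^ γ → ∀ κ, κ = 0 ∨ κ = ν 1 →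
    ∫⁻ x, ‖x‖ₑ ^ κ * ‖K t s (x + v) - K t s x‖ₑ ^ 2 ≤
      N * ENNReal.ofReal (‖v‖ ^ 2 * (t - s) ^ (γ * (κ - d - 2) - 1))
  time : ∀ s h, 0 < h → ∀ᵐ t, h ≤ t - s → ∀ κ, κ = 0 ∨ κ = ν 2 →
    ∫⁻ x, ‖x‖ₑ ^ κ * ‖K (t + h) s x - K t s x‖ₑ ^ 2 ≤
      N * ENNReal.ofReal (h ^ 2 * (t - s) ^ (γ * (κ - d) - 3))

/-- The two constants in the assumption on the derivatives, in terms of the single scaling exponent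
`γ = c₂ - c₃ + 1`: they are the homogeneities of `∂_x² K` and `∂_t ∂_x K`, in which a space
derivative counts `γ` and a time derivative counts `1`. -/
lemma c₃_relations (d : ℕ) (c₂ : ℝ) :
    c₂ = (c₂ - c₃ d c₂ + 1) * (d + 2) + 1 / 2 ∧
      c₃ d c₂ = (c₂ - c₃ d c₂ + 1) * (d + 1) + 3 / 2 := by
  have h : (d : ℝ) + 2 ≠ 0 := by positivity
  constructor <;> (unfold c₃; field_simp; ring)

/-- Passing from the derivatives of the kernel to the kernel itself by Hardy's inequality. -/
theorem ScalingBounds.exists_kernelEstimates {𝕜 : Type*} [RCLike 𝕜] (hd : 1 ≤ d)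
    {K : ℝ → ℝ → E → 𝕜} {c₂ : ℝ} (hc₂ : 1 / 2 < c₂) (hK₁ : FourierBound K)
    (hK₂ : ScalingBounds K c₂) {A : ℝ} (hA : 0 ≤ A) :
    ∃ (γ : ℝ) (ν : Fin 3 → ℝ) (N : ℝ≥0), 0 < γ ∧ KernelEstimates K γ ν A N := by
  obtain ⟨hKm, Khat, C₀, hKhat, hFT, hC₀⟩ := hK₁
  obtain ⟨DK, D2K, dtK, dtDK, F, σ, κ, μ, C, M, hder, hσ, hκ, hC, hμ, hFm, hb0, hb1, hb2, hM0, hM1,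
    hM2, hr0, hr1, hr2⟩ := hK₂
  obtain ⟨hc2, hc3⟩ := c₃_relations d c₂
  set γ : ℝ := c₂ - c₃ d c₂ + 1 with hγdef
  have hγ : 0 < γ := by
    have : 0 < γ * (d + 2) := by linarith
    exact pos_of_mul_pos_left this (by positivity)
  have hne : Nonempty (Fin d) := ⟨⟨0, by omega⟩⟩
  have hKm' : ∀ t s, AEStronglyMeasurable (K t s) volume := fun t s =>
    (hKm.comp (measurable_const.prodMk
      (measurable_const.prodMk measurable_id))).aestronglyMeasurable
  have hd0 : (0 : ℝ) ≤ d := Nat.cast_nonneg d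
  -- the three homogeneous bounds on the derivatives
  have hVM : volume (Metric.ball (0 : E) 1) + M ≠ ⊤ :=
    ENNReal.add_ne_top.2 ⟨measure_ball_lt_top.ne, ENNReal.coe_ne_top⟩
  obtain ⟨B, hB⟩ : ∃ B : ℝ≥0,
      ENNReal.ofReal (C ^ 2) * (volume (Metric.ball (0 : E) 1) + M) = B :=
    ⟨_, (ENNReal.coe_toNNReal (ENNReal.mul_ne_top ENNReal.ofReal_ne_top hVM)).symm⟩
  have hB0 : ENNReal.ofReal (C ^ 2) * M ≤ B := by
    rw [← hB]; exact mul_le_mul_right le_add_self _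
  have A1 : ∀ᵐ t, ∀ s < t, ∀ i, ∫⁻ x, ‖x‖ₑ ^ μ 0 * ‖DK i t s x‖ₑ ^ 2 ≤
      B * ENNReal.ofReal ((t - s) ^ (γ * (μ 0 - d - 2) - 1)) := by
    filter_upwards [hb0] with t ht s hst i
    have h1 := setLIntegral_weight_dilate_le (g := DK i t s) (F := F 0 t s) (C := C) (τ := t - s)
      (σ := σ 0) (κ := κ 0) (μ := μ 0) (ρ := 0) (M := M) (by linarith) (by linarith [hμ 0])
      ((ht s hst).mono fun x hx => hx i)
      (by simpa using hM0 t s hst)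
    simp only [mul_zero, norm_nonneg, ofPred_true, Measure.restrict_univ] at h1
    refine h1.trans ?_
    rw [ENNReal.ofReal_mul (by positivity), mul_right_comm]
    have e : κ 0 * (μ 0 + d) - 2 * σ 0 = γ * (μ 0 - d - 2) - 1 := by linarith
    rw [e]
    exact mul_le_mul_left hB0 _
  have A2 : ∀ᵐ t, ∀ s < t, ∀ i j, ∀ ν, 0 ≤ ν → ν ≤ μ 1 →
      ∫⁻ x, ‖x‖ₑ ^ ν * ‖D2K i j t s x‖ₑ ^ 2 ≤
      B * ENNReal.ofReal ((t - s) ^ (γ * (ν - d - 4) - 1)) := by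
    filter_upwards [hb1] with t ht s hst i j ν hν hνμ
    have h1 := lintegral_weight_min_le hd (γ := γ) (μ := μ 1) (M := M) (τ := t - s) (by linarith)
      hC.le ((ht s hst).mono fun x hx => hx i j) (hM1 t s hst) hν hνμ
      (by rw [hr1, hγdef]; ring)
    rw [hB] at h1
    convert h1 using 4
    linarith
  have A3 : ∀ᵐ t, ∀ s < t, ∀ i, ∀ ν, 0 ≤ ν → ν ≤ μ 2 →
      ∫⁻ x, ‖x‖ₑ ^ ν * ‖dtDK i t s x‖ₑ ^ 2 ≤
      B * ENNReal.ofReal ((t - s) ^ (γ * (ν - d - 2) - 3)) := by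
    filter_upwards [hb2] with t ht s hst i ν hν hνμ
    have h1 := lintegral_weight_min_le hd (γ := γ) (μ := μ 2) (M := M) (τ := t - s) (by linarith)
      hC.le ((ht s hst).mono fun x hx => hx i) (hM2 t s hst) hν hνμ
      (by rw [hr2, hγdef]; ring)
    rw [hB] at h1
    convert h1 using 4
    linarith
  -- the first derivatives in `x`, by Hardy's inequality
  have hDm : ∀ᵐ t, ∀ s < t, ∀ i, AEStronglyMeasurable (DK i t s) volume := by
    filter_upwards [hder.weak_DK] with t ht s hst i
    exact (locallyIntegrableOn_univ.1
      (ht s hst i).locallyIntegrableOn_deriv).aestronglyMeasurable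
  have A4 : ∀ᵐ t, ∀ s < t, ∀ i, ∀ ν, 0 ≤ ν → ν + 2 ≤ μ 1 →
      ∫⁻ x, ‖x‖ₑ ^ ν * ‖DK i t s x‖ₑ ^ 2 ≤
      4 * (d * (d * (B * ENNReal.ofReal ((t - s) ^ (γ * (ν - d - 2) - 1))))) := by
    filter_upwards [A1, A2, hder.weak_D2K, hDm] with t h1 h2 h3 h4 s hst i ν hν hνμ
    have hv : VanishesAtInfinity (DK i t s) :=
      vanishesAtInfinity_of_lintegral_ne_top hd (h4 s hst i) (κ := μ 0) (by linarith [hμ 0])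
        (ne_top_of_le_ne_top (ENNReal.mul_ne_top ENNReal.coe_ne_top ENNReal.ofReal_ne_top)
          (h1 s hst i))
    refine hv.lintegral_le_of_forall hd (g := fun j => D2K i j t s) (h3 s hst i) (fun j => ?_) hν
      fun j => ?_
    · have := (h3 s hst i j).locallyIntegrableOn_deriv.aestronglyMeasurable
      rwa [Measure.restrict_eq_self_of_ae_mem
        (s := {(0 : E)}ᶜ) (Measure.ae_ne volume (0 : E))] at this
    · convert h2 s hst i j (ν + 2) (by linarith) hνμ using 4
      ring
  have hloc : ∀ s, ∀ᵐ t, s < t → LocallyIntegrable (K t s) volume := by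
    intro s
    have := (ae_restrict_iff' measurableSet_Ioi).1 (hFT s)
    filter_upwards [this] with t ht hst
    exact (ht hst).locallyIntegrable_left
  -- the kernel vanishes at infinity since its Fourier transform is locally integrable
  have hvan : ∀ s, ∀ᵐ t, s < t → VanishesAtInfinity (K t s) := by
    intro s
    have hm : Measurable (Function.uncurry fun t => Khat t s) :=
      hKhat.comp (measurable_fst.prodMk (measurable_const.prodMk measurable_snd))
    have h1 := (ae_restrict_iff' measurableSet_Ioi).1 (hFT s)
    have h2 := (ae_restrict_iff' measurableSet_Ioi).1
      (ae_integrable_fourier_of_lintegral_sq_le hm (hC₀ s))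
    filter_upwards [h1, h2] with t ht1 ht2 hst
    exact (ht1 hst).vanishesAtInfinity hd (ht2 hst) (hKm' t s)
  -- Hardy's inequality trades one derivative for two powers of the weight
  set ν : Fin 3 → ℝ := fun n => μ n - 2 with hνdef
  have hν : ∀ n, (d : ℝ) < ν n := fun n => by simp only [hνdef]; linarith [hμ n]
  -- the constants in the bounds on the kernel and on its increments in space and in time
  set N₀ : ℝ≥0∞ := 4 * (d * (d * B)) with hN₀
  set N₁ : ℝ → ℝ≥0∞ := fun κ =>
    2 ^ κ * ((1 + ENNReal.ofReal (A ^ κ)) * (d * (d * N₀))) with hN₁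
  set N₂ : ℝ → ℝ≥0∞ := fun κ => 4 * (d * (d * (2 ^ |γ * (κ - d) - 3| * B))) with hN₂
  have hdt : (d : ℝ≥0∞) ≠ ⊤ := ENNReal.natCast_ne_top d
  have hN₀t : N₀ ≠ ⊤ := ENNReal.mul_ne_top (by norm_num)
    (ENNReal.mul_ne_top hdt (ENNReal.mul_ne_top hdt ENNReal.coe_ne_top))
  have hN₁t : ∀ κ, 0 ≤ κ → N₁ κ ≠ ⊤ := fun κ hκ =>
    ENNReal.mul_ne_top (ENNReal.rpow_ne_top_of_nonneg hκ (by norm_num))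
      (ENNReal.mul_ne_top (ENNReal.add_ne_top.2 ⟨ENNReal.one_ne_top, ENNReal.ofReal_ne_top⟩)
        (ENNReal.mul_ne_top hdt (ENNReal.mul_ne_top hdt hN₀t)))
  have hN₂t : ∀ κ, N₂ κ ≠ ⊤ := fun κ => ENNReal.mul_ne_top (by norm_num)
    (ENNReal.mul_ne_top hdt (ENNReal.mul_ne_top hdt (ENNReal.mul_ne_top
      (ENNReal.rpow_ne_top_of_nonneg (abs_nonneg _) (by norm_num)) ENNReal.coe_ne_top)))
  obtain ⟨N, hN⟩ : ∃ N : ℝ≥0, (N : ℝ≥0∞) = N₀ + (N₁ 0 + N₁ (ν 1)) + (N₂ 0 + N₂ (ν 2)) := by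
    refine ⟨_, ENNReal.coe_toNNReal ?_⟩
    exact ENNReal.add_ne_top.2 ⟨ENNReal.add_ne_top.2 ⟨hN₀t, ENNReal.add_ne_top.2
      ⟨hN₁t _ le_rfl, hN₁t _ (hd0.trans (hν 1).le)⟩⟩, ENNReal.add_ne_top.2 ⟨hN₂t _, hN₂t _⟩⟩
  have hN0 : N₀ ≤ N := by
    rw [hN, add_assoc]; exact le_self_add
  have hN1 : ∀ κ, κ = 0 ∨ κ = ν 1 → N₁ κ ≤ N := by
    rintro κ (rfl | rfl) <;> rw [hN]
    · exact (le_self_add.trans le_add_self).trans le_self_add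
    · exact (le_add_self.trans le_add_self).trans le_self_add
  have hN2 : ∀ κ, κ = 0 ∨ κ = ν 2 → N₂ κ ≤ N := by
    rintro κ (rfl | rfl) <;> rw [hN]
    · exact le_self_add.trans le_add_self
    · exact le_add_self.trans le_add_self
  refine ⟨γ, ν, N, hγ, hν, hloc, fun s => ?_, fun s => ?_, fun s h hh => ?_⟩
  · filter_upwards [hvan s, A1, hder.weak_DK, hDm] with t h1 h2 h3 h4 hst
    have := (h1 hst).lintegral_le_of_forall hd (g := fun i => DK i t s)
      (fun i => (h3 s hst i).mono (subset_univ _)) (h4 s hst) (κ := ν 0) (hd0.trans (hν 0).le)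
      (B := B * ENNReal.ofReal ((t - s) ^ (γ * (μ 0 - d - 2) - 1)))
      (fun i => by simpa [hνdef] using h2 s hst i)
    refine this.trans ?_
    have e : γ * (μ 0 - d - 2) - 1 = γ * (ν 0 - d) - 1 := by simp only [hνdef]; ring
    rw [e, ← mul_assoc (d : ℝ≥0∞) B, ← mul_assoc (d : ℝ≥0∞) (d * B), ← mul_assoc 4]
    exact mul_le_mul_left hN0 _
  · filter_upwards [A4, hder.weak_DK, hDm] with t h1 h2 h3 hst v hv κ hκ
    have hτ : 0 < t - s := by linarith
    have hκ0 : 0 ≤ κ := by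
      rcases hκ with rfl | rfl
      exacts [le_rfl, hd0.trans (hν 1).le]
    have hκμ : κ + 2 ≤ μ 1 := by
      rcases hκ with rfl | rfl
      · linarith [hμ 1]
      · simp [hνdef]
    -- the derivative in the direction `v` inherits the bounds on the partial derivatives
    have hdir : ∀ κ', 0 ≤ κ' → κ' + 2 ≤ μ 1 →
        ∫⁻ x, ‖x‖ₑ ^ κ' * ‖∑ i, v i • DK i t s x‖ₑ ^ 2 ≤
          ‖v‖ₑ ^ 2 * (d * (d * N₀)) * ENNReal.ofReal ((t - s) ^ (γ * (κ' - d - 2) - 1)) := by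
      intro κ' hκ'0 hκ'
      calc ∫⁻ x, ‖x‖ₑ ^ κ' * ‖∑ i, v i • DK i t s x‖ₑ ^ 2
          ≤ ∫⁻ x, ‖v‖ₑ ^ 2 * (d * ∑ i, ‖x‖ₑ ^ κ' * ‖DK i t s x‖ₑ ^ 2) := by
            refine lintegral_mono fun x => ?_
            have e1 : ‖∑ i, v i • DK i t s x‖ₑ ≤ ‖v‖ₑ * ∑ i, ‖DK i t s x‖ₑ := by
              rw [Finset.mul_sum]
              refine (enorm_sum_le _ _).trans (Finset.sum_le_sum fun i _ => ?_)
              rw [enorm_smul]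
              exact mul_le_mul_left (enorm_coord_le v i) _
            refine (mul_le_mul_right (pow_le_pow_left₀ zero_le e1 2) _).trans ?_
            rw [mul_pow, ← Finset.mul_sum, mul_left_comm, mul_left_comm (d : ℝ≥0∞)]
            refine mul_le_mul_right (mul_le_mul_right ?_ _) _
            simpa using sq_sum_enorm_le Finset.univ fun i => ‖DK i t s x‖ₑ
        _ = ‖v‖ₑ ^ 2 * (d * ∑ i, ∫⁻ x, ‖x‖ₑ ^ κ' * ‖DK i t s x‖ₑ ^ 2) := by
            rw [lintegral_const_mul' _ _ (ENNReal.pow_ne_top enorm_ne_top),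
              lintegral_const_mul' _ _ hdt, lintegral_finsetSum']
            intro i _
            exact ((measurable_enorm.pow_const _).aemeasurable).mul ((h3 s hst i).enorm.pow_const 2)
        _ ≤ ‖v‖ₑ ^ 2 * (d * (d * (N₀ *
              ENNReal.ofReal ((t - s) ^ (γ * (κ' - d - 2) - 1))))) := by
            refine mul_le_mul_right (mul_le_mul_right ?_ _) _
            refine (Finset.sum_le_sum fun i _ => h1 s hst i κ' hκ'0 hκ').trans (le_of_eq ?_)
            simp only [Finset.sum_const, Finset.card_univ, Fintype.card_fin, nsmul_eq_mul, hN₀,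
              mul_assoc]
        _ = _ := by simp only [mul_assoc]
    have hmain := (HasWeakDerivOn.sum_coord hd (h2 s hst) v).lintegral_weight_translate_sub_le hκ0
    refine hmain.trans ?_
    have hvκ : ‖v‖ₑ ^ κ ≤ ENNReal.ofReal (A ^ κ) * ENNReal.ofReal ((t - s) ^ (γ * κ)) := by
      rw [enorm_rpow_eq_ofReal _ hκ0, ← ENNReal.ofReal_mul (by positivity), Real.rpow_mul hτ.le,
        ← Real.mul_rpow hA (by positivity)]
      exact ENNReal.ofReal_le_ofReal (Real.rpow_le_rpow (norm_nonneg _) hv hκ0)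
    have h0 := hdir 0 le_rfl (by linarith [hμ 1])
    simp only [ENNReal.rpow_zero, one_mul] at h0
    have e2 : ENNReal.ofReal ((t - s) ^ (γ * κ)) *
        ENNReal.ofReal ((t - s) ^ (γ * (0 - d - 2) - 1)) =
        ENNReal.ofReal ((t - s) ^ (γ * (κ - d - 2) - 1)) := by
      rw [← ENNReal.ofReal_mul (by positivity), ← Real.rpow_add hτ]
      congr 2
      ring
    calc 2 ^ κ * ((∫⁻ x, ‖x‖ₑ ^ κ * ‖∑ i, v i • DK i t s x‖ₑ ^ 2) +
          ‖v‖ₑ ^ κ * ∫⁻ x, ‖∑ i, v i • DK i t s x‖ₑ ^ 2)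
        ≤ 2 ^ κ * (‖v‖ₑ ^ 2 * (d * (d * N₀)) *
            ENNReal.ofReal ((t - s) ^ (γ * (κ - d - 2) - 1)) +
            (ENNReal.ofReal (A ^ κ) * ENNReal.ofReal ((t - s) ^ (γ * κ))) *
              (‖v‖ₑ ^ 2 * (d * (d * N₀)) *
                ENNReal.ofReal ((t - s) ^ (γ * (0 - d - 2) - 1)))) := by
          refine mul_le_mul_right (add_le_add (hdir κ hκ0 hκμ) ?_) _
          exact mul_le_mul' hvκ h0
      _ = N₁ κ * (‖v‖ₑ ^ 2 * ENNReal.ofReal ((t - s) ^ (γ * (κ - d - 2) - 1))) := by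
          rw [← e2, hN₁]
          ring
      _ ≤ N * ENNReal.ofReal (‖v‖ ^ 2 * (t - s) ^ (γ * (κ - d - 2) - 1)) := by
          rw [ENNReal.ofReal_mul (by positivity), ← enorm_sq_eq_ofReal]
          exact mul_le_mul_left (hN1 κ hκ) _
  · -- the time increments of the first derivatives, and Hardy's inequality
    have htime : ∀ κ, 0 ≤ κ → κ + 2 ≤ μ 2 → ∀ i, ∀ᵐ t, h ≤ t - s →
        ∫⁻ x, ‖x‖ₑ ^ (κ + 2) * ‖DK i (t + h) s x - DK i t s x‖ₑ ^ 2 ≤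
          2 ^ |γ * (κ - d) - 3| * B * ENNReal.ofReal (h ^ 2 * (t - s) ^ (γ * (κ - d) - 3)) := by
      intro κ hκ0 hκμ i
      refine (hder.weak_dtDK s i).lintegral_weight_time_sub_le (u := fun t => DK i t s)
        (g := fun t => dtDK i t s) ?_ hh
      filter_upwards [A3] with t ht hst
      convert ht s hst i (κ + 2) (by linarith) hκμ using 4
      ring
    have hshift : ∀ {P : ℝ → Prop}, (∀ᵐ t, P t) → ∀ᵐ t, P (t + h) := fun hP =>
      (measurePreserving_add_right volume h).quasiMeasurePreserving.ae hP
    filter_upwards [ae_all_iff.2 (htime 0 le_rfl (by linarith [hμ 2])),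
      ae_all_iff.2 (htime (ν 2) (hd0.trans (hν 2).le) (by simp [hνdef])), hder.weak_DK,
      hshift hder.weak_DK, hvan s, hshift (hvan s), hloc s, hshift (hloc s), hDm, hshift hDm]
      with t h1 h2 h3 h3' h4 h4' h5 h5' h6 h6' hht κ hκ
    have hst : s < t := by linarith
    have hst' : s < t + h := by linarith
    have hκ0 : 0 ≤ κ := by
      rcases hκ with rfl | rfl
      exacts [le_rfl, hd0.trans (hν 2).le]
    have hb : ∀ i, ∫⁻ x, ‖x‖ₑ ^ (κ + 2) * ‖DK i (t + h) s x - DK i t s x‖ₑ ^ 2 ≤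
        2 ^ |γ * (κ - d) - 3| * B * ENNReal.ofReal (h ^ 2 * (t - s) ^ (γ * (κ - d) - 3)) := by
      rcases hκ with rfl | rfl
      exacts [fun i => h1 i hht, fun i => h2 i hht]
    have hv := VanishesAtInfinity.sub (h5' hst') (h5 hst) (h4' hst') (h4 hst)
    have := hv.lintegral_le_of_forall hd (g := fun i x => DK i (t + h) s x - DK i t s x)
      (fun i => ((h3' s hst' i).sub (h3 s hst i)).mono (subset_univ _))
      (fun i => (h6' s hst' i).sub (h6 s hst i)) hκ0 hb
    refine this.trans ?_
    rw [← mul_assoc (d : ℝ≥0∞) (_ * _), ← mul_assoc (d : ℝ≥0∞) (_ * _), ← mul_assoc 4]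
    exact mul_le_mul_left (hN2 κ hκ) _

end KernelBounds

/-! ### Convolution and the maximal function -/

section Convolution

variable {d : ℕ}

local notation "E" => EuclideanSpace ℝ (Fin d)

/-- Convolution with a kernel that is concentrated, in the weighted `L₂` sense, at the scale `r` is
controlled by the maximal function of the square. -/
theorem exists_sq_lintegral_convolution_le {ν A : ℝ} (hν : (d : ℝ) < ν) (hA : 0 ≤ A) :
    ∃ N : ℝ≥0, ∀ k v : E → ℝ≥0∞, Measurable k → Measurable v → ∀ r : ℝ, 0 < r → ∀ B : ℝ≥0∞,
      ∫⁻ y, k y ^ 2 ≤ B * ENNReal.ofReal (r ^ (-(d : ℝ))) →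
      ∫⁻ y, ‖y‖ₑ ^ ν * k y ^ 2 ≤ B * ENNReal.ofReal (r ^ (ν - d)) →
      ∀ x x' : E, ‖x - x'‖ ≤ A * r →
        (∫⁻ y, k y * v (x - y)) ^ 2 ≤ N * B * maximalFunction (fun y => v y ^ 2) x' := by
  obtain ⟨N₀, hN₀⟩ := exists_lintegral_mul_decay_le E (ν := ν)
    (by rw [finrank_euclideanSpace_fin]; exact hν)
  have hν0 : 0 ≤ ν := (Nat.cast_nonneg d).trans hν.le
  obtain ⟨N, hN⟩ : ∃ N : ℝ≥0, (N : ℝ≥0∞) =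
      (2 ^ ν * 2) * (ENNReal.ofReal ((1 + A) ^ ν) * N₀) := by
    refine ⟨_, ENNReal.coe_toNNReal ?_⟩
    exact ENNReal.mul_ne_top (ENNReal.mul_ne_top (ENNReal.rpow_ne_top_of_nonneg hν0 (by norm_num))
      (by norm_num)) (ENNReal.mul_ne_top ENNReal.ofReal_ne_top ENNReal.coe_ne_top)
  refine ⟨N, fun k v hk hv r hr B h0 hB x x' hxx' => ?_⟩
  -- Cauchy–Schwarz with the weight `w ^ 2`, `w y = (1 + ‖y‖ / r) ^ (ν / 2)`
  set w : E → ℝ≥0∞ := fun y => ENNReal.ofReal ((1 + ‖y‖ / r) ^ (ν / 2)) with hw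
  set w' : E → ℝ≥0∞ := fun y => ENNReal.ofReal ((1 + ‖y‖ / r) ^ (-(ν / 2))) with hw'
  have hp : ∀ y : E, 0 < 1 + ‖y‖ / r := fun y => by positivity
  have hww : ∀ y, w y * w' y = 1 := fun y => by
    simp only [hw, hw']
    rw [← ENNReal.ofReal_mul (by positivity), ← Real.rpow_add (hp y)]
    simp
  have hw2 : ∀ y, w y ^ 2 = ENNReal.ofReal ((1 + ‖y‖ / r) ^ ν) := fun y => by
    simp only [hw]
    rw [← ENNReal.ofReal_pow (by positivity), ← Real.rpow_natCast, ← Real.rpow_mul (hp y).le]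
    norm_num
  have hw'2 : ∀ y, w' y ^ 2 = ENNReal.ofReal ((1 + ‖y‖ / r) ^ (-ν)) := fun y => by
    simp only [hw']
    rw [← ENNReal.ofReal_pow (by positivity), ← Real.rpow_natCast, ← Real.rpow_mul (hp y).le]
    norm_num
  have hwm : Measurable w := by fun_prop
  have hw'm : Measurable w' := by fun_prop
  have hvx : Measurable fun y => v (x - y) := hv.comp (measurable_const.sub measurable_id)
  have hcs := sq_lintegral_mul_le (ν := volume) (f := fun y => k y * w y)
    (g := fun y => v (x - y) * w' y) (hk.mul hwm).aemeasurable (hvx.mul hw'm).aemeasurable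
  have e1 : ∫⁻ y, k y * v (x - y) = ∫⁻ y, k y * w y * (v (x - y) * w' y) := by
    refine lintegral_congr fun y => ?_
    rw [mul_mul_mul_comm, hww, mul_one]
  rw [e1]
  refine hcs.trans ?_
  have e2 : ∫⁻ y, (k y * w y) ^ 2 ≤ (2 ^ ν * 2) * (B * ENNReal.ofReal (r ^ (-(d : ℝ)))) := by
    calc ∫⁻ y, (k y * w y) ^ 2
        ≤ ∫⁻ y, 2 ^ ν * (k y ^ 2 + ENNReal.ofReal (r ^ (-ν)) * (‖y‖ₑ ^ ν * k y ^ 2)) := by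
          refine lintegral_mono fun y => ?_
          rw [mul_pow, hw2, ← mul_assoc (ENNReal.ofReal _), mul_comm (k y ^ 2), ← one_add_mul,
            ← mul_assoc]
          refine mul_le_mul_left ?_ _
          have h := ENNReal_add_rpow_le 1 (ENNReal.ofReal (‖y‖ / r)) hν0
          rw [← ENNReal.ofReal_rpow_of_nonneg (hp y).le hν0,
            ENNReal.ofReal_add zero_le_one (by positivity), ENNReal.ofReal_one]
          refine h.trans (le_of_eq ?_)
          rw [ENNReal.one_rpow, ENNReal.ofReal_rpow_of_nonneg (by positivity) hν0,
            enorm_rpow_eq_ofReal _ hν0, ← ENNReal.ofReal_mul (by positivity),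
            Real.div_rpow (norm_nonneg _) hr.le, Real.rpow_neg hr.le, div_eq_inv_mul]
      _ = 2 ^ ν * ((∫⁻ y, k y ^ 2) +
            ENNReal.ofReal (r ^ (-ν)) * ∫⁻ y, ‖y‖ₑ ^ ν * k y ^ 2) := by
          rw [lintegral_const_mul' _ _ (ENNReal.rpow_ne_top_of_nonneg hν0 (by norm_num)),
            lintegral_add_left (hk.pow_const 2), lintegral_const_mul' _ _ ENNReal.ofReal_ne_top]
      _ ≤ 2 ^ ν * (B * ENNReal.ofReal (r ^ (-(d : ℝ))) +
            ENNReal.ofReal (r ^ (-ν)) * (B * ENNReal.ofReal (r ^ (ν - d)))) := by gcongr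
      _ = _ := by
          rw [mul_left_comm (ENNReal.ofReal (r ^ (-ν))), ← ENNReal.ofReal_mul (by positivity),
            ← Real.rpow_add hr, show -ν + (ν - d) = -(d : ℝ) by ring]
          ring
  have e3 : ∫⁻ y, (v (x - y) * w' y) ^ 2 ≤ ENNReal.ofReal ((1 + A) ^ ν) *
      (N₀ * ENNReal.ofReal (r ^ d) * maximalFunction (fun y => v y ^ 2) x') := by
    have hswap := lintegral_sub_left_eq_self (μ := (volume : Measure E))
      (fun y => (v y * w' (x - y)) ^ 2) x
    simp only [sub_sub_cancel] at hswap
    rw [hswap]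
    have h4 := hN₀ (fun y => v y ^ 2) (hv.pow_const 2) x' r hr
    rw [finrank_euclideanSpace_fin] at h4
    refine le_trans ?_ (mul_le_mul_right h4 _)
    rw [← lintegral_const_mul' _ _ ENNReal.ofReal_ne_top]
    refine lintegral_mono fun y => ?_
    rw [mul_pow, hw'2, mul_left_comm, ← ENNReal.ofReal_mul (by positivity)]
    refine mul_le_mul_right (ENNReal.ofReal_le_ofReal ?_) _
    have h5 : 1 + ‖y - x'‖ / r ≤ (1 + A) * (1 + ‖x - y‖ / r) := by
      have h6 : ‖y - x'‖ ≤ ‖x - y‖ + A * r := by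
        calc ‖y - x'‖ = ‖(x - x') - (x - y)‖ := by congr 1; abel
          _ ≤ ‖x - x'‖ + ‖x - y‖ := norm_sub_le _ _
          _ ≤ _ := by linarith
      have h7 : ‖y - x'‖ / r ≤ ‖x - y‖ / r + A := by
        rw [div_add' _ _ _ hr.ne']
        exact div_le_div_of_nonneg_right h6 hr.le
      have h8 : 0 ≤ A * (‖x - y‖ / r) := by positivity
      linarith
    have h9 : 0 < 1 + ‖y - x'‖ / r := by positivity
    have h10 : 0 < 1 + ‖x - y‖ / r := hp _
    rw [Real.rpow_neg h10.le, Real.rpow_neg h9.le, ← div_eq_mul_inv, le_div_iff₀ (by positivity),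
      inv_mul_le_iff₀ (by positivity), mul_comm, ← Real.mul_rpow (by positivity) h10.le]
    exact Real.rpow_le_rpow h9.le h5 hν0
  refine (mul_le_mul' e2 e3).trans (le_of_eq ?_)
  have e4 : ENNReal.ofReal (r ^ (-(d : ℝ))) * ENNReal.ofReal (r ^ d) = 1 := by
    rw [← ENNReal.ofReal_mul (by positivity), Real.rpow_neg hr.le, Real.rpow_natCast,
      inv_mul_cancel₀ (by positivity), ENNReal.ofReal_one]
  rw [hN]
  calc 2 ^ ν * 2 * (B * ENNReal.ofReal (r ^ (-(d : ℝ)))) * (ENNReal.ofReal ((1 + A) ^ ν) *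
        (N₀ * ENNReal.ofReal (r ^ d) * maximalFunction (fun y => v y ^ 2) x'))
      = 2 ^ ν * 2 * (ENNReal.ofReal ((1 + A) ^ ν) * N₀) * B *
          maximalFunction (fun y => v y ^ 2) x' *
          (ENNReal.ofReal (r ^ (-(d : ℝ))) * ENNReal.ofReal (r ^ d)) := by ring
    _ = _ := by rw [e4, mul_one]

/-- Away from the singularity of the kernel a single weighted bound suffices. -/
theorem exists_sq_lintegral_convolution_le_of_vanish {ν A : ℝ} (hν : (d : ℝ) < ν) (hA : 0 ≤ A) :
    ∃ N : ℝ≥0, ∀ k v : E → ℝ≥0∞, Measurable k → Measurable v → ∀ r : ℝ, 0 < r → ∀ B : ℝ≥0∞,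
      ∫⁻ y, ‖y‖ₑ ^ ν * k y ^ 2 ≤ B * ENNReal.ofReal (r ^ (ν - d)) →
      ∀ x x' : E, ‖x - x'‖ ≤ A * r → (∀ y, ‖y‖ < r → v (x - y) = 0) →
        (∫⁻ y, k y * v (x - y)) ^ 2 ≤ N * B * maximalFunction (fun y => v y ^ 2) x' := by
  obtain ⟨N, hN⟩ := exists_sq_lintegral_convolution_le hν hA
  have hν0 : 0 ≤ ν := (Nat.cast_nonneg d).trans hν.le
  refine ⟨N, fun k v hk hv r hr B hB x x' hxx' hvan => ?_⟩
  have hS : MeasurableSet {y : E | r ≤ ‖y‖} :=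
    (isClosed_le continuous_const continuous_norm).measurableSet
  set k' : E → ℝ≥0∞ := {y : E | r ≤ ‖y‖}.indicator k with hk'
  have hle : ∀ y, k' y ≤ k y := fun y => indicator_le_self _ _ y
  have e1 : ∫⁻ y, k y * v (x - y) = ∫⁻ y, k' y * v (x - y) := by
    refine lintegral_congr fun y => ?_
    by_cases hy : r ≤ ‖y‖
    · rw [hk', indicator_of_mem (by exact hy)]
    · rw [hvan y (not_le.1 hy), mul_zero, mul_zero]
  rw [e1]
  refine hN k' v (hk.indicator hS) hv r hr B ?_ ?_ x x' hxx'
  · calc ∫⁻ y, k' y ^ 2 ≤ ∫⁻ y, ENNReal.ofReal (r ^ (-ν)) * (‖y‖ₑ ^ ν * k y ^ 2) := by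
          refine lintegral_mono fun y => ?_
          by_cases hy : r ≤ ‖y‖
          · rw [hk', indicator_of_mem (by exact hy), ← mul_assoc, enorm_rpow_eq_ofReal _ hν0,
              ← ENNReal.ofReal_mul (by positivity)]
            refine le_mul_of_one_le_left zero_le ?_
            rw [ENNReal.one_le_ofReal, Real.rpow_neg hr.le,
              le_inv_mul_iff₀ (Real.rpow_pos_of_pos hr _), mul_one]
            exact Real.rpow_le_rpow hr.le hy hν0
          · rw [hk', indicator_of_notMem (by exact hy)]
            simp
      _ ≤ ENNReal.ofReal (r ^ (-ν)) * (B * ENNReal.ofReal (r ^ (ν - d))) := by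
          rw [lintegral_const_mul' _ _ ENNReal.ofReal_ne_top]
          exact mul_le_mul_right hB _
      _ = _ := by
          rw [mul_left_comm, ← ENNReal.ofReal_mul (by positivity), ← Real.rpow_add hr,
            show -ν + (ν - d) = -(d : ℝ) by ring]
  · refine le_trans (lintegral_mono fun y => ?_) hB
    exact mul_le_mul_right (pow_le_pow_left₀ zero_le (hle y) 2) _

end Convolution

/-! ### Sources close in time -/

section Near

variable {d : ℕ}

local notation "E" => EuclideanSpace ℝ (Fin d)

lemma maximalFunction_mono {V : Type*} [NormedAddCommGroup V] [NormedSpace ℝ V] [MeasureSpace V]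
    {u v : V → ℝ≥0∞} (h : ∀ y, u y ≤ v y) (x : V) : maximalFunction u x ≤ maximalFunction v x :=
  iSup_mono fun _ => mul_le_mul_right (lintegral_mono h) _

/-- Integrals over balls of arbitrary radius are controlled by the dyadic maximal function. -/
theorem exists_setLIntegral_ball_le (V : Type*) [NormedAddCommGroup V] [NormedSpace ℝ V]
    [MeasureSpace V] [BorelSpace V] [FiniteDimensional ℝ V] [(volume : Measure V).IsAddHaarMeasure] :
    ∃ N : ℝ≥0, ∀ u : V → ℝ≥0∞, Measurable u → ∀ (x : V) (r : ℝ), 0 < r →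
      ∫⁻ y in Metric.ball x r, u y ≤
        N * ENNReal.ofReal (r ^ Module.finrank ℝ V) * maximalFunction u x := by
  set ν : ℝ := Module.finrank ℝ V + 1 with hν
  have hν0 : 0 ≤ ν := by positivity
  obtain ⟨N, hN⟩ := exists_lintegral_mul_decay_le V (ν := ν) (by linarith)
  refine ⟨Real.toNNReal (2 ^ ν) * N, fun u hu x r hr => ?_⟩
  have h1 := hN u hu x r hr
  rw [ENNReal.coe_mul, mul_assoc (_ : ℝ≥0∞) (N : ℝ≥0∞), mul_assoc]
  refine le_trans ?_ (mul_le_mul_right h1 _)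
  rw [← lintegral_const_mul' _ _ ENNReal.coe_ne_top]
  refine le_trans ?_ (setLIntegral_le_lintegral (Metric.ball x r) _)
  refine setLIntegral_mono' measurableSet_ball fun y hy => ?_
  rw [mul_left_comm]
  refine le_mul_of_one_le_right zero_le ?_
  change 1 ≤ ENNReal.ofReal _ * _
  rw [← ENNReal.ofReal_mul (by positivity), ENNReal.one_le_ofReal]
  rw [Metric.mem_ball, dist_eq_norm] at hy
  have h2 : 0 < 1 + ‖y - x‖ / r := by positivity
  have h3 : 1 + ‖y - x‖ / r ≤ 2 := by
    have : ‖y - x‖ / r ≤ 1 := (div_le_one hr).2 hy.le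
    linarith
  rw [Real.rpow_neg h2.le, ← div_eq_mul_inv, one_le_div (by positivity)]
  exact Real.rpow_le_rpow h2.le h3 hν0

/-- The convolution of a scalar kernel with a vector-valued function. -/
noncomputable def conv {𝕜 : Type*} [RCLike 𝕜] {H : Type*} [NormedAddCommGroup H]
    [InnerProductSpace 𝕜 H] [NormedSpace ℝ H] (k : E → 𝕜) (u : E → H) (x : E) : H :=
  ∫ y, k y • u (x - y)

set_option linter.unusedSectionVars false

variable {𝕜 : Type*} [RCLike 𝕜] {H : Type*} [NormedAddCommGroup H]
    [InnerProductSpace 𝕜 H] [NormedSpace ℝ H]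

lemma integrable_conv {k : E → 𝕜} (hk : LocallyIntegrable k volume) {u : E → H}
    (hu : Continuous u) (huc : HasCompactSupport u) (x : E) :
    Integrable (fun y => k y • u (x - y)) volume :=
  huc.convolutionExists_right (ContinuousLinearMap.lsmul 𝕜 𝕜) hk hu x

lemma enorm_conv_le (k : E → 𝕜) (u : E → H) (x : E) :
    ‖conv k u x‖ₑ ≤ ∫⁻ y, ‖k y‖ₑ * ‖u (x - y)‖ₑ := by
  refine (enorm_integral_le_lintegral_enorm _).trans (le_of_eq ?_)
  simp only [enorm_smul]

lemma enorm_add_sq_le {V : Type*} [NormedAddCommGroup V] (a b : V) :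
    ‖a + b‖ₑ ^ 2 ≤ 2 * ‖a‖ₑ ^ 2 + 2 * ‖b‖ₑ ^ 2 := by
  rw [enorm_sq_eq_ofReal, enorm_sq_eq_ofReal, enorm_sq_eq_ofReal,
    show (2 : ℝ≥0∞) = ENNReal.ofReal 2 by simp, ← ENNReal.ofReal_mul zero_le_two,
    ← ENNReal.ofReal_mul zero_le_two, ← ENNReal.ofReal_add (by positivity) (by positivity)]
  refine ENNReal.ofReal_le_ofReal ?_
  have h := norm_add_le a b
  nlinarith [norm_nonneg (a + b), sq_nonneg (‖a‖ - ‖b‖)]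

/-- Joint measurability of the convolution in time and space. -/
lemma stronglyMeasurable_conv {K : ℝ → ℝ → E → 𝕜}
    (hK : Measurable fun z : ℝ × ℝ × E => K z.1 z.2.1 z.2.2) {f : ℝ × E → H} (hf : Continuous f) :
    StronglyMeasurable fun z : ℝ × ℝ × E => conv (K z.1 z.2.1) (fun y => f (z.2.1, y)) z.2.2 := by
  refine StronglyMeasurable.integral_prod_right
    (f := fun (z : ℝ × ℝ × E) y => K z.1 z.2.1 y • f (z.2.1, z.2.2 - y)) ?_
  have h1 : Measurable fun w : (ℝ × ℝ × E) × E => K w.1.1 w.1.2.1 w.2 :=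
    hK.comp (f := fun w : (ℝ × ℝ × E) × E => (w.1.1, w.1.2.1, w.2)) (by fun_prop)
  have h2 : Continuous fun w : (ℝ × ℝ × E) × E => f (w.1.2.1, w.1.2.2 - w.2) :=
    hf.comp (by fun_prop)
  exact h1.stronglyMeasurable.smul h2.stronglyMeasurable

/-- The part of the square function coming from sources close in time: near the point in space
the `L₂` bound applies, and away from it the decay of the kernel. -/
theorem KernelEstimates.exists_near_le {K : ℝ → ℝ → E → 𝕜}
    (hKm : Measurable fun z : ℝ × ℝ × E => K z.1 z.2.1 z.2.2) {γ A : ℝ} (hγ : 0 < γ) (hA : 0 ≤ A)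
    {ν : Fin 3 → ℝ} {N₁ C₀ : ℝ≥0} (hest : KernelEstimates K γ ν A N₁)
    (hL2 : ∀ s, ∀ u : E → H, ContDiff ℝ ∞ u → HasCompactSupport u →
      ∫⁻ t in Ioi s, ∫⁻ x, ‖conv (K t s) u x‖ₑ ^ 2 ≤ C₀ * ∫⁻ x, ‖u x‖ₑ ^ 2) :
    ∃ N : ℝ≥0, ∀ u : E → H, ContDiff ℝ ∞ u → HasCompactSupport u → ∀ (s R : ℝ), 0 < R →
      ∀ Q : Set E, MeasurableSet Q → (∀ x ∈ Q, ∀ x' ∈ Q, ‖x - x'‖ ≤ A * R ^ γ) →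
      ENNReal.ofReal ((R ^ γ) ^ d) ≤ volume Q → ∀ x' ∈ Q,
      ∫⁻ t in Ioo s (s + 2 * R), ∫⁻ x in Q, ‖conv (K t s) u x‖ₑ ^ 2 ≤
        N * volume Q * maximalFunction (fun y => ‖u y‖ₑ ^ 2) x' := by
  obtain ⟨Nb, hNb⟩ := exists_setLIntegral_ball_le E
  obtain ⟨Nc, hNc⟩ := exists_sq_lintegral_convolution_le_of_vanish (hest.dim_lt 0) hA
  have hν0 : 0 < ν 0 - d := by linarith [hest.dim_lt 0]
  set q : ℝ := γ * (ν 0 - d) with hq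
  have hq0 : 0 < q := mul_pos hγ hν0
  obtain ⟨N, hN⟩ : ∃ N : ℝ≥0, (N : ℝ≥0∞) =
      2 * (C₀ * (Nb * ENNReal.ofReal ((2 * (A + 1)) ^ d))) +
      2 * (Nc * (N₁ * ENNReal.ofReal (q⁻¹ * 2 ^ q))) := by
    refine ⟨_, ENNReal.coe_toNNReal ?_⟩
    refine ENNReal.add_ne_top.2 ⟨?_, ?_⟩
    · exact ENNReal.mul_ne_top (by norm_num) (ENNReal.mul_ne_top ENNReal.coe_ne_top
        (ENNReal.mul_ne_top ENNReal.coe_ne_top ENNReal.ofReal_ne_top))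
    · exact ENNReal.mul_ne_top (by norm_num) (ENNReal.mul_ne_top ENNReal.coe_ne_top
        (ENNReal.mul_ne_top ENNReal.coe_ne_top ENNReal.ofReal_ne_top))
  refine ⟨N, fun u hu huc s R hR Q hQ hdiam hvol x' hx' => ?_⟩
  set r : ℝ := R ^ γ with hr
  have hr0 : 0 < r := Real.rpow_pos_of_pos hR _
  set Mu : ℝ≥0∞ := maximalFunction (fun y => ‖u y‖ₑ ^ 2) x' with hMu
  -- cut-off at scale `r` around `x'`
  have hA1 : 0 < (A + 1) * r := by positivity
  let ζ : ContDiffBump x' := ⟨(A + 1) * r, 2 * ((A + 1) * r), hA1, by linarith⟩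
  set u₁ : E → H := fun y => ζ y • u y with hu₁
  set u₂ : E → H := fun y => (1 - ζ y) • u y with hu₂
  have hζs : ContDiff ℝ ∞ ζ := ζ.contDiff
  have hu₁s : ContDiff ℝ ∞ u₁ := hζs.smul hu
  have hu₂s : ContDiff ℝ ∞ u₂ := (contDiff_const.sub hζs).smul hu
  have hu₁c : HasCompactSupport u₁ := huc.smul_left
  have hu₂c : HasCompactSupport u₂ := huc.smul_left
  have hu₁le : ∀ y, ‖u₁ y‖ₑ ≤ ‖u y‖ₑ := fun y => by
    simp only [hu₁, enorm_smul]
    refine mul_le_of_le_one_left zero_le ?_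
    rw [Real.enorm_of_nonneg ζ.nonneg]
    exact ENNReal.ofReal_le_one.2 ζ.le_one
  have hu₂le : ∀ y, ‖u₂ y‖ₑ ≤ ‖u y‖ₑ := fun y => by
    simp only [hu₂, enorm_smul]
    refine mul_le_of_le_one_left zero_le ?_
    rw [Real.enorm_of_nonneg (sub_nonneg.2 ζ.le_one)]
    exact ENNReal.ofReal_le_one.2 (sub_le_self _ ζ.nonneg)
  have hsplit : ∀ᵐ t, s < t → ∀ x, ‖conv (K t s) u x‖ₑ ^ 2 ≤
      2 * ‖conv (K t s) u₁ x‖ₑ ^ 2 + 2 * ‖conv (K t s) u₂ x‖ₑ ^ 2 := by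
    filter_upwards [hest.locallyIntegrable s] with t ht hst x
    have e : conv (K t s) u x = conv (K t s) u₁ x + conv (K t s) u₂ x := by
      unfold conv
      rw [← integral_add (integrable_conv (ht hst) hu₁s.continuous hu₁c x)
        (integrable_conv (ht hst) hu₂s.continuous hu₂c x)]
      refine integral_congr_ae (Filter.Eventually.of_forall fun y => ?_)
      simp only [hu₁, hu₂]
      rw [← smul_add, ← add_smul, add_sub_cancel, one_smul]
    rw [e]
    exact enorm_add_sq_le _ _
  have hmeas : ∀ {w : E → H}, Continuous w →
      Measurable fun z : ℝ × E => ‖conv (K z.1 s) w z.2‖ₑ ^ 2 := by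
    intro w hw
    have h := stronglyMeasurable_conv hKm (f := fun z : ℝ × E => w z.2) (hw.comp continuous_snd)
    have hp : Measurable fun z : ℝ × E => (z.1, s, z.2) := by fun_prop
    exact (h.comp_measurable hp).enorm.pow_const 2
  -- the local part
  have hloc : ∫⁻ t in Ioo s (s + 2 * R), ∫⁻ x in Q, ‖conv (K t s) u₁ x‖ₑ ^ 2 ≤
      C₀ * (Nb * ENNReal.ofReal ((2 * (A + 1)) ^ d)) * volume Q * Mu := by
    calc ∫⁻ t in Ioo s (s + 2 * R), ∫⁻ x in Q, ‖conv (K t s) u₁ x‖ₑ ^ 2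
        ≤ ∫⁻ t in Ioi s, ∫⁻ x, ‖conv (K t s) u₁ x‖ₑ ^ 2 :=
          (lintegral_mono_set Ioo_subset_Ioi_self).trans
            (lintegral_mono fun t => setLIntegral_le_lintegral _ _)
      _ ≤ C₀ * ∫⁻ x, ‖u₁ x‖ₑ ^ 2 := hL2 s u₁ hu₁s hu₁c
      _ ≤ C₀ * ∫⁻ x in Metric.ball x' (2 * ((A + 1) * r)), ‖u x‖ₑ ^ 2 := by
          refine mul_le_mul_right ?_ _
          rw [← lintegral_indicator measurableSet_ball]
          refine lintegral_mono fun y => ?_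
          by_cases hy : y ∈ Metric.ball x' (2 * ((A + 1) * r))
          · rw [indicator_of_mem hy]
            exact pow_le_pow_left₀ zero_le (hu₁le y) 2
          · have : ζ y = 0 := by
              have := ζ.support_eq
              by_contra hne
              have hmem : y ∈ Function.support ζ := hne
              rw [this] at hmem
              exact hy hmem
            simp [hu₁, this]
      _ ≤ C₀ * (Nb * ENNReal.ofReal ((2 * ((A + 1) * r)) ^ d) * Mu) := by
          refine mul_le_mul_right ?_ _
          have := hNb (fun y => ‖u y‖ₑ ^ 2) (hu.continuous.enorm.measurable.pow_const 2) x'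
            (2 * ((A + 1) * r)) (by positivity)
          rwa [finrank_euclideanSpace_fin] at this
      _ = C₀ * (Nb * ENNReal.ofReal ((2 * (A + 1)) ^ d)) * ENNReal.ofReal (r ^ d) * Mu := by
          rw [← mul_assoc 2, mul_pow, ENNReal.ofReal_mul (by positivity)]
          ring
      _ ≤ _ := by gcongr
  -- the remote part
  have hrem : ∫⁻ t in Ioo s (s + 2 * R), ∫⁻ x in Q, ‖conv (K t s) u₂ x‖ₑ ^ 2 ≤
      Nc * (N₁ * ENNReal.ofReal (q⁻¹ * 2 ^ q)) * volume Q * Mu := by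
    have hpt : ∀ᵐ t, t ∈ Ioo s (s + 2 * R) → ∫⁻ x in Q, ‖conv (K t s) u₂ x‖ₑ ^ 2 ≤
        Nc * (N₁ * ENNReal.ofReal (r ^ (-(ν 0 - d)) * (t - s) ^ (q - 1))) * Mu * volume Q := by
      filter_upwards [hest.weight s] with t ht hst
      have hτ : 0 < t - s := by linarith [hst.1]
      rw [← setLIntegral_const]
      refine setLIntegral_mono' hQ fun x hx => ?_
      refine (pow_le_pow_left₀ zero_le (enorm_conv_le _ _ _) 2).trans ?_
      have hkm : Measurable fun y => ‖K t s y‖ₑ :=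
        (hKm.comp (f := fun y : E => (t, s, y)) (by fun_prop)).enorm
      refine (hNc (fun y => ‖K t s y‖ₑ) (fun y => ‖u₂ y‖ₑ) hkm
        (hu₂s.continuous.enorm.measurable) r hr0
        (N₁ * ENNReal.ofReal (r ^ (-(ν 0 - d)) * (t - s) ^ (q - 1))) ?_ x x' (hdiam x hx x' hx')
        ?_).trans (mul_le_mul_right (maximalFunction_mono
          (fun y => pow_le_pow_left₀ zero_le (hu₂le y) 2) x') _)
      · refine (ht hst.1).trans (le_of_eq ?_)
        rw [mul_assoc, ← ENNReal.ofReal_mul (by positivity), mul_right_comm, ← Real.rpow_add hr0,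
          neg_add_cancel, Real.rpow_zero, one_mul]
      · intro y hy
        have h1 : x - y ∈ Metric.closedBall x' ((A + 1) * r) := by
          rw [mem_closedBall_iff_norm]
          calc ‖x - y - x'‖ = ‖(x - x') - y‖ := by congr 1; abel
            _ ≤ ‖x - x'‖ + ‖y‖ := norm_sub_le _ _
            _ ≤ A * r + r := add_le_add (hdiam x hx x' hx') hy.le
            _ = _ := by ring
        have h2 : ζ (x - y) = 1 := ζ.one_of_mem_closedBall h1
        simp [hu₂, h2]
    refine (setLIntegral_mono_ae ?_ hpt).trans ?_
    · exact Measurable.aemeasurable (by fun_prop)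
    -- the singularity at `t = s` is integrable because `q > 0`
    have e1 : ∫⁻ t in Ioo s (s + 2 * R), ENNReal.ofReal ((t - s) ^ (q - 1)) =
        ENNReal.ofReal (q⁻¹ * (2 * R) ^ q) := by
      have h := lintegral_Ioo_rpow_sub_one hq0 (b := 2 * R) (by positivity)
      have h2 : ∫⁻ t in Ioo s (s + 2 * R), ENNReal.ofReal ((t - s) ^ (q - 1)) =
          ∫⁻ l in Ioo 0 (2 * R), ENNReal.ofReal (l ^ (q - 1)) := by
        rw [← lintegral_indicator measurableSet_Ioo, ← lintegral_indicator measurableSet_Ioo,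
          ← lintegral_sub_right_eq_self ((Ioo 0 (2 * R)).indicator _) s]
        refine lintegral_congr fun t => ?_
        have : t ∈ Ioo s (s + 2 * R) ↔ t - s ∈ Ioo 0 (2 * R) := by
          simp only [mem_Ioo]
          constructor <;> rintro ⟨h1, h2⟩ <;> constructor <;> linarith
        by_cases ht : t ∈ Ioo s (s + 2 * R)
        · rw [indicator_of_mem ht, indicator_of_mem (this.1 ht)]
        · rw [indicator_of_notMem ht, indicator_of_notMem (fun h => ht (this.2 h))]
      have h3 : ∫⁻ l in Ioo 0 (2 * R), ENNReal.ofReal (q * l ^ (q - 1)) =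
          ENNReal.ofReal q * ∫⁻ l in Ioo 0 (2 * R), ENNReal.ofReal (l ^ (q - 1)) := by
        rw [← lintegral_const_mul' _ _ ENNReal.ofReal_ne_top]
        refine lintegral_congr fun l => ?_
        rw [ENNReal.ofReal_mul hq0.le]
      rw [h2, ENNReal.ofReal_mul (by positivity), ← h, h3, ← mul_assoc,
        ← ENNReal.ofReal_mul (by positivity), inv_mul_cancel₀ hq0.ne', ENNReal.ofReal_one, one_mul]
    have e2 : ∀ t : ℝ, Nc * (N₁ * ENNReal.ofReal (r ^ (-(ν 0 - d)) * (t - s) ^ (q - 1))) * Mu *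
        volume Q = (Nc * (N₁ * ENNReal.ofReal (r ^ (-(ν 0 - d)))) * Mu * volume Q) *
          ENNReal.ofReal ((t - s) ^ (q - 1)) := by
      intro t
      rw [ENNReal.ofReal_mul (by positivity)]
      ring
    simp only [e2]
    rw [lintegral_const_mul _ (by fun_prop), e1]
    refine le_of_eq ?_
    have e3 : ENNReal.ofReal (r ^ (-(ν 0 - d))) * ENNReal.ofReal (q⁻¹ * (2 * R) ^ q) =
        ENNReal.ofReal (q⁻¹ * 2 ^ q) := by
      rw [← ENNReal.ofReal_mul (by positivity), hr, ← Real.rpow_mul hR.le,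
        Real.mul_rpow zero_le_two hR.le, mul_neg, Real.rpow_neg hR.le, ← hq]
      congr 1
      have : R ^ q ≠ 0 := (Real.rpow_pos_of_pos hR _).ne'
      field_simp
    rw [← e3]
    ring
  calc ∫⁻ t in Ioo s (s + 2 * R), ∫⁻ x in Q, ‖conv (K t s) u x‖ₑ ^ 2
      ≤ ∫⁻ t in Ioo s (s + 2 * R), (2 * (∫⁻ x in Q, ‖conv (K t s) u₁ x‖ₑ ^ 2) +
          2 * ∫⁻ x in Q, ‖conv (K t s) u₂ x‖ₑ ^ 2) := by
        refine lintegral_mono_ae ((ae_restrict_iff' measurableSet_Ioo).2 ?_)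
        filter_upwards [hsplit] with t ht hst
        rw [← lintegral_const_mul' _ _ (by norm_num), ← lintegral_const_mul' _ _ (by norm_num),
          ← lintegral_add_left]
        · exact lintegral_mono fun x => ht hst.1 x
        · exact ((hmeas hu₁s.continuous).comp (measurable_const.prodMk measurable_id)).const_mul 2
    _ = 2 * (∫⁻ t in Ioo s (s + 2 * R), ∫⁻ x in Q, ‖conv (K t s) u₁ x‖ₑ ^ 2) +
          2 * ∫⁻ t in Ioo s (s + 2 * R), ∫⁻ x in Q, ‖conv (K t s) u₂ x‖ₑ ^ 2 := by
        rw [lintegral_add_left, lintegral_const_mul' _ _ (by norm_num),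
          lintegral_const_mul' _ _ (by norm_num)]
        exact ((hmeas hu₁s.continuous).lintegral_prod_right').const_mul 2
    _ ≤ 2 * (C₀ * (Nb * ENNReal.ofReal ((2 * (A + 1)) ^ d)) * volume Q * Mu) +
          2 * (Nc * (N₁ * ENNReal.ofReal (q⁻¹ * 2 ^ q)) * volume Q * Mu) := by gcongr
    _ = _ := by rw [hN]; ring

end Near

/-! ### Sources remote in time -/

section Far

variable {d : ℕ}

local notation "E" => EuclideanSpace ℝ (Fin d)

set_option linter.unusedSectionVars false

variable {𝕜 : Type*} [RCLike 𝕜] {H : Type*} [NormedAddCommGroup H]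
    [InnerProductSpace 𝕜 H] [NormedSpace ℝ H]

lemma conv_sub_left {k k' : E → 𝕜} (hk : LocallyIntegrable k volume)
    (hk' : LocallyIntegrable k' volume) {u : E → H} (hu : Continuous u)
    (huc : HasCompactSupport u) (x : E) :
    conv k u x - conv k' u x = conv (fun y => k y - k' y) u x := by
  unfold conv
  rw [← integral_sub (integrable_conv hk hu huc x) (integrable_conv hk' hu huc x)]
  simp only [sub_smul]

lemma conv_add_right (k : E → 𝕜) (u : E → H) (x v : E) :
    conv k u (x + v) = conv (fun y => k (y + v)) u x := by
  unfold conv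
  rw [← integral_add_right_eq_self _ v]
  refine integral_congr_ae (Filter.Eventually.of_forall fun y => ?_)
  simp only [add_sub_add_right_eq_sub]

lemma locallyIntegrable_translate {k : E → 𝕜} (hk : LocallyIntegrable k volume) (v : E) :
    LocallyIntegrable (fun y => k (y + v)) volume := by
  rw [locallyIntegrable_iff] at hk ⊢
  intro S hS
  have h := hk _ (hS.image (continuous_add_const v))
  exact ((measurePreserving_add_right volume v).integrableOn_image
    (Homeomorph.addRight v).measurableEmbedding).1 h

/-- The increments of the convolution in space are controlled by the maximal function. -/
theorem KernelEstimates.exists_space_le {K : ℝ → ℝ → E → 𝕜}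
    (hKm : Measurable fun z : ℝ × ℝ × E => K z.1 z.2.1 z.2.2) {γ A : ℝ} (hA : 0 ≤ A)
    {ν : Fin 3 → ℝ} {N₁ : ℝ≥0} (hest : KernelEstimates K γ ν A N₁) :
    ∃ N : ℝ≥0, ∀ u : E → H, ContDiff ℝ ∞ u → HasCompactSupport u → ∀ s, ∀ᵐ t, s < t →
      ∀ x x' y : E, ‖x - x'‖ ≤ A * (t - s) ^ γ → ‖x' - y‖ ≤ A * (t - s) ^ γ →
        ‖conv (K t s) u x - conv (K t s) u x'‖ₑ ^ 2 ≤
          N * ENNReal.ofReal (‖x - x'‖ ^ 2 * (t - s) ^ (-(2 * γ) - 1)) *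
            maximalFunction (fun y => ‖u y‖ₑ ^ 2) y := by
  obtain ⟨Nc, hNc⟩ := exists_sq_lintegral_convolution_le (hest.dim_lt 1) hA
  refine ⟨Nc * N₁, fun u hu huc s => ?_⟩
  filter_upwards [hest.space s, hest.locallyIntegrable s] with t ht htl hst x x' y hxx' hxy
  have hτ : 0 < t - s := by linarith
  have e1 : conv (K t s) u x - conv (K t s) u x' =
      conv (fun z => K t s (z + (x - x')) - K t s z) u x' := by
    rw [← conv_sub_left (locallyIntegrable_translate (htl hst) _) (htl hst) hu.continuous huc,
      ← conv_add_right, add_sub_cancel]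
  have hkm : Measurable fun z => K t s z := hKm.comp (f := fun y : E => (t, s, y)) (by fun_prop)
  have hkm' : Measurable fun z => K t s (z + (x - x')) :=
    hkm.comp (measurable_id.add_const _)
  have h := hNc (fun z => ‖K t s (z + (x - x')) - K t s z‖ₑ) (fun z => ‖u z‖ₑ)
    (hkm'.sub hkm).enorm hu.continuous.enorm.measurable ((t - s) ^ γ)
    (Real.rpow_pos_of_pos hτ _)
    (N₁ * ENNReal.ofReal (‖x - x'‖ ^ 2 * (t - s) ^ (-(2 * γ) - 1))) ?_ ?_ x' y hxy
  · rw [e1]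
    refine (pow_le_pow_left₀ zero_le (enorm_conv_le _ _ _) 2).trans (h.trans (le_of_eq ?_))
    rw [ENNReal.coe_mul]
    ring
  · have := ht hst (x - x') hxx' 0 (Or.inl rfl)
    simp only [ENNReal.rpow_zero, one_mul] at this
    refine this.trans (le_of_eq ?_)
    rw [mul_assoc, ← ENNReal.ofReal_mul (by positivity), ← Real.rpow_mul hτ.le, mul_assoc,
      ← Real.rpow_add hτ]
    ring_nf
  · refine (ht hst (x - x') hxx' (ν 1) (Or.inr rfl)).trans (le_of_eq ?_)
    rw [mul_assoc, ← ENNReal.ofReal_mul (by positivity), ← Real.rpow_mul hτ.le, mul_assoc,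
      ← Real.rpow_add hτ]
    ring_nf

/-- The increments of the convolution in time are controlled by the maximal function. -/
theorem KernelEstimates.exists_time_le {K : ℝ → ℝ → E → 𝕜}
    (hKm : Measurable fun z : ℝ × ℝ × E => K z.1 z.2.1 z.2.2) {γ A : ℝ} (hA : 0 ≤ A)
    {ν : Fin 3 → ℝ} {N₁ : ℝ≥0} (hest : KernelEstimates K γ ν A N₁) :
    ∃ N : ℝ≥0, ∀ u : E → H, ContDiff ℝ ∞ u → HasCompactSupport u → ∀ s h, 0 < h → ∀ᵐ t,
      h ≤ t - s → ∀ x y : E, ‖x - y‖ ≤ A * (t - s) ^ γ →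
        ‖conv (K (t + h) s) u x - conv (K t s) u x‖ₑ ^ 2 ≤
          N * ENNReal.ofReal (h ^ 2 * (t - s) ^ (-3 : ℝ)) *
            maximalFunction (fun y => ‖u y‖ₑ ^ 2) y := by
  obtain ⟨Nc, hNc⟩ := exists_sq_lintegral_convolution_le (hest.dim_lt 2) hA
  refine ⟨Nc * N₁, fun u hu huc s h hh => ?_⟩
  have hshift : ∀ᵐ t, s < t + h → LocallyIntegrable (K (t + h) s) volume :=
    (measurePreserving_add_right volume h).quasiMeasurePreserving.ae (hest.locallyIntegrable s)
  filter_upwards [hest.time s h hh, hest.locallyIntegrable s, hshift] with t ht htl htl' hht x y hxy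
  have hτ : 0 < t - s := by linarith
  have hkm : ∀ t, Measurable fun z => K t s z := fun t =>
    hKm.comp (f := fun y : E => (t, s, y)) (by fun_prop)
  have h := hNc (fun z => ‖K (t + h) s z - K t s z‖ₑ) (fun z => ‖u z‖ₑ)
    ((hkm _).sub (hkm _)).enorm hu.continuous.enorm.measurable ((t - s) ^ γ)
    (Real.rpow_pos_of_pos hτ _)
    (N₁ * ENNReal.ofReal (h ^ 2 * (t - s) ^ (-3 : ℝ))) ?_ ?_ x y hxy
  · rw [conv_sub_left (htl' (by linarith)) (htl (by linarith)) hu.continuous huc]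
    refine (pow_le_pow_left₀ zero_le (enorm_conv_le _ _ _) 2).trans (h.trans (le_of_eq ?_))
    rw [ENNReal.coe_mul]
    ring
  · have := ht hht 0 (Or.inl rfl)
    simp only [ENNReal.rpow_zero, one_mul] at this
    refine this.trans (le_of_eq ?_)
    rw [mul_assoc, ← ENNReal.ofReal_mul (by positivity), ← Real.rpow_mul hτ.le, mul_assoc,
      ← Real.rpow_add hτ]
    ring_nf
  · refine (ht hht (ν 2) (Or.inr rfl)).trans (le_of_eq ?_)
    rw [mul_assoc, ← ENNReal.ofReal_mul (by positivity), ← Real.rpow_mul hτ.le, mul_assoc,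
      ← Real.rpow_add hτ]
    ring_nf

/-- A double integral over a square can be estimated along the diagonals. -/
lemma setLIntegral_setLIntegral_le_of_shift {φ : ℝ × ℝ → ℝ≥0∞} (hφ : Measurable φ) {I : Set ℝ}
    (hI : MeasurableSet I) {b : ℝ≥0∞}
    (h : ∀ h ≠ 0, ∀ᵐ t, t ∈ I → t + h ∈ I → φ (t, t + h) ≤ b) :
    ∫⁻ t in I, ∫⁻ t' in I, φ (t, t') ≤ b * volume I ^ 2 := by
  have key : ∀ φ : ℝ × ℝ → ℝ≥0∞, Measurable φ → ∫⁻ t in I, ∫⁻ t' in I, φ (t, t') =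
      ∫⁻ h, ∫⁻ t, (I ×ˢ I).indicator φ (t, t + h) := by
    intro φ hφ
    have hm : Measurable ((I ×ˢ I).indicator φ) := hφ.indicator (hI.prod hI)
    rw [lintegral_lintegral_swap (f := fun h t => (I ×ˢ I).indicator φ (t, t + h))
      (hm.comp (f := fun p : ℝ × ℝ => (p.2, p.2 + p.1)) (by fun_prop)).aemeasurable,
      ← lintegral_indicator hI]
    refine lintegral_congr fun t => ?_
    rw [lintegral_add_left_eq_self (fun t' => (I ×ˢ I).indicator φ (t, t')) t]
    by_cases ht : t ∈ I
    · rw [indicator_of_mem ht, ← lintegral_indicator hI]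
      refine lintegral_congr fun t' => ?_
      by_cases ht' : t' ∈ I <;> simp [indicator, ht, ht']
    · simp [indicator, ht]
  have hb := key (fun _ => b) measurable_const
  rw [key φ hφ]
  calc ∫⁻ h, ∫⁻ t, (I ×ˢ I).indicator φ (t, t + h)
      ≤ ∫⁻ h, ∫⁻ t, (I ×ˢ I).indicator (fun _ => b) (t, t + h) := by
        refine lintegral_mono_ae ?_
        filter_upwards [Measure.ae_ne volume (0 : ℝ)] with h' hh
        refine lintegral_mono_ae ?_
        filter_upwards [h h' hh] with t ht
        by_cases hmem : (t, t + h') ∈ I ×ˢ I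
        · rw [indicator_of_mem hmem, indicator_of_mem hmem]
          exact ht hmem.1 hmem.2
        · rw [indicator_of_notMem hmem]
          exact zero_le
    _ = _ := by
        rw [← hb]
        simp only [lintegral_const, Measure.restrict_apply_univ]
        ring

/-- The oscillation, over a parabolic-type box, of the part of the convolution coming from a remote
source time `s`. -/
theorem KernelEstimates.exists_far_slice_le {K : ℝ → ℝ → E → 𝕜}
    (hKm : Measurable fun z : ℝ × ℝ × E => K z.1 z.2.1 z.2.2) {γ A : ℝ} (hγ : 0 < γ) (hA : 0 ≤ A)
    {ν : Fin 3 → ℝ} {N₁ : ℝ≥0} (hest : KernelEstimates K γ ν A N₁) :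
    ∃ N : ℝ≥0, ∀ u : E → H, ContDiff ℝ ∞ u → HasCompactSupport u → ∀ s a R : ℝ, 0 < R →
      s ≤ a - R → ∀ Q : Set E, MeasurableSet Q → (∀ x ∈ Q, ∀ x' ∈ Q, ‖x - x'‖ ≤ A * R ^ γ) →
      ∀ y ∈ Q,
      ∫⁻ z in Ico a (a + R) ×ˢ Q, ∫⁻ z' in Ico a (a + R) ×ˢ Q,
        ‖conv (K z.1 s) u z.2 - conv (K z'.1 s) u z'.2‖ₑ ^ 2 ≤
        N * ENNReal.ofReal (R ^ (2 * γ) * (a - s) ^ (-(2 * γ) - 1) + R ^ 2 * (a - s) ^ (-3 : ℝ)) *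
          maximalFunction (fun y => ‖u y‖ₑ ^ 2) y * (volume (Ico a (a + R) ×ˢ Q)) ^ 2 := by
  obtain ⟨Ns, hNs⟩ := hest.exists_space_le (H := H) hKm hA
  obtain ⟨Nt, hNt⟩ := hest.exists_time_le (H := H) hKm hA
  obtain ⟨N, hN⟩ : ∃ N : ℝ≥0, (N : ℝ≥0∞) = 2 * (Ns * ENNReal.ofReal (A ^ 2)) + 2 * Nt := by
    refine ⟨_, ENNReal.coe_toNNReal (ENNReal.add_ne_top.2 ⟨?_, ?_⟩)⟩
    · exact ENNReal.mul_ne_top (by norm_num) (ENNReal.mul_ne_top ENNReal.coe_ne_top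
        ENNReal.ofReal_ne_top)
    · exact ENNReal.mul_ne_top (by norm_num) ENNReal.coe_ne_top
  refine ⟨N, fun u hu huc s a R hR hsa Q hQ hdiam y hy => ?_⟩
  set I : Set ℝ := Ico a (a + R) with hI
  set Mu : ℝ≥0∞ := maximalFunction (fun y => ‖u y‖ₑ ^ 2) y with hMu
  have hτ0 : R ≤ a - s := by linarith
  have hτ0' : 0 < a - s := by linarith
  have hIm : MeasurableSet I := measurableSet_Ico
  set g : ℝ × E → H := fun z => conv (K z.1 s) u z.2 with hg
  have hgm : StronglyMeasurable g := by
    have h := stronglyMeasurable_conv hKm (f := fun z : ℝ × E => u z.2)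
      (hu.continuous.comp continuous_snd)
    have hp : Measurable fun z : ℝ × E => (z.1, s, z.2) := by fun_prop
    exact h.comp_measurable hp
  have hdist : ∀ t, a ≤ t → ∀ x ∈ Q, ∀ x' ∈ Q, ‖x - x'‖ ≤ A * (t - s) ^ γ := by
    intro t ht x hx x' hx'
    refine (hdiam x hx x' hx').trans (mul_le_mul_of_nonneg_left ?_ hA)
    exact Real.rpow_le_rpow hR.le (by linarith) hγ.le
  set βs : ℝ≥0∞ := Ns * ENNReal.ofReal (A ^ 2 * (R ^ (2 * γ) * (a - s) ^ (-(2 * γ) - 1))) * Mu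
    with hβs
  set βt : ℝ≥0∞ := Nt * ENNReal.ofReal (R ^ 2 * (a - s) ^ (-3 : ℝ)) * Mu with hβt
  -- comparison in space, at a common time
  have hspace : ∀ᵐ t, t ∈ I → ∀ x ∈ Q, ∀ x' ∈ Q, ‖g (t, x) - g (t, x')‖ₑ ^ 2 ≤ βs := by
    filter_upwards [hNs u hu huc s] with t ht htI x hx x' hx'
    have hat : a ≤ t := htI.1
    refine (ht (by linarith) x x' y (hdist t hat x hx x' hx') (hdist t hat x' hx' y hy)).trans ?_
    refine mul_le_mul_left (mul_le_mul_right (ENNReal.ofReal_le_ofReal ?_) _) _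
    rw [← mul_assoc]
    refine mul_le_mul ?_ (Real.rpow_le_rpow_of_nonpos hτ0' (by linarith) (by linarith))
      (Real.rpow_nonneg (by linarith) _) (by positivity)
    have h1 := pow_le_pow_left₀ (norm_nonneg _) (hdiam x hx x' hx') 2
    refine h1.trans (le_of_eq ?_)
    rw [mul_pow, mul_comm 2 γ, Real.rpow_mul hR.le]
    norm_cast
  -- comparison in time, at a common point in space
  have htime : ∀ h, 0 < h → ∀ᵐ t, t ∈ I → t + h ∈ I →
      ∫⁻ x in Q, ‖g (t + h, x) - g (t, x)‖ₑ ^ 2 ≤ βt * volume Q := by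
    intro h hh
    filter_upwards [hNt u hu huc s h hh] with t ht htI htI'
    have hat : a ≤ t := htI.1
    have hhR : h ≤ R := by linarith [htI'.2]
    rw [← setLIntegral_const]
    refine setLIntegral_mono' hQ fun x hx => ?_
    refine (ht (by linarith) x y (hdist t hat x hx y hy)).trans ?_
    refine mul_le_mul_left (mul_le_mul_right (ENNReal.ofReal_le_ofReal ?_) _) _
    exact mul_le_mul (pow_le_pow_left₀ hh.le hhR 2)
      (Real.rpow_le_rpow_of_nonpos hτ0' (by linarith) (by norm_num))
      (Real.rpow_nonneg (by linarith) _) (by positivity)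
  set φ : ℝ × ℝ → ℝ≥0∞ := fun p => ∫⁻ x in Q, ‖g (p.1, x) - g (p.2, x)‖ₑ ^ 2 with hφ
  have hφm : Measurable φ := by
    have h1 : Measurable fun w : (ℝ × ℝ) × E => (w.1.1, w.2) := by fun_prop
    have h2 : Measurable fun w : (ℝ × ℝ) × E => (w.1.2, w.2) := by fun_prop
    exact Measurable.lintegral_prod_right'
      (((hgm.comp_measurable h1).sub (hgm.comp_measurable h2)).enorm.pow_const 2)
  -- pairs of times are grouped by their difference `h`, which avoids the null set `h = 0`
  have hT : ∫⁻ t in I, ∫⁻ t' in I, φ (t, t') ≤ βt * volume Q * volume I ^ 2 := by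
    refine setLIntegral_setLIntegral_le_of_shift hφm hIm fun h hne => ?_
    rcases lt_or_gt_of_ne hne with hneg | hpos
    · have h1 := (measurePreserving_add_right volume h).quasiMeasurePreserving.ae
        (htime (-h) (by linarith))
      filter_upwards [h1] with t ht htI htI'
      have := ht htI' (by simpa using htI)
      simpa [hφ] using this
    · filter_upwards [htime h hpos] with t ht htI htI'
      refine le_trans (le_of_eq (lintegral_congr fun x => ?_)) (ht htI htI')
      rw [← enorm_neg, neg_sub]
  have hvol : volume (I ×ˢ Q) = volume I * volume Q := by
    rw [Measure.volume_eq_prod, Measure.prod_prod]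
  have hrestr : (volume : Measure (ℝ × E)).restrict (I ×ˢ Q) =
      (volume.restrict I).prod (volume.restrict Q) := by
    rw [Measure.volume_eq_prod, Measure.prod_restrict]
  have hm4 : ∀ {p q : (ℝ × E) × (ℝ × E) → ℝ × E}, Measurable p → Measurable q →
      Measurable fun w => ‖g (p w) - g (q w)‖ₑ ^ 2 := fun hp hq =>
    ((hgm.comp_measurable hp).sub (hgm.comp_measurable hq)).enorm.pow_const 2
  have hmS : Measurable fun w : (ℝ × E) × (ℝ × E) => ‖g w.1 - g (w.1.1, w.2.2)‖ₑ ^ 2 :=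
    hm4 (p := fun w => w.1) (q := fun w => (w.1.1, w.2.2)) (by fun_prop) (by fun_prop)
  have hmT : Measurable fun w : (ℝ × E) × (ℝ × E) => ‖g (w.1.1, w.2.2) - g w.2‖ₑ ^ 2 :=
    hm4 (p := fun w => (w.1.1, w.2.2)) (q := fun w => w.2) (by fun_prop) (by fun_prop)
  have hS' : ∫⁻ z in I ×ˢ Q, ∫⁻ z' in I ×ˢ Q, ‖g z - g (z.1, z'.2)‖ₑ ^ 2 ≤
      βs * (volume I * volume Q) ^ 2 := by
    have h1 : ∀ᵐ z : ℝ × E, z ∈ I ×ˢ Q → ∫⁻ z' in I ×ˢ Q, ‖g z - g (z.1, z'.2)‖ₑ ^ 2 ≤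
        βs * volume (I ×ˢ Q) := by
      have h2 : ∀ᵐ z : ℝ × E, z.1 ∈ I → ∀ x ∈ Q, ∀ x' ∈ Q, ‖g (z.1, x) - g (z.1, x')‖ₑ ^ 2 ≤ βs :=
        Measure.quasiMeasurePreserving_fst.ae hspace
      filter_upwards [h2] with z hz hzP
      rw [← setLIntegral_const]
      exact setLIntegral_mono' (hIm.prod hQ) fun z' hz' => hz hzP.1 z.2 hzP.2 z'.2 hz'.2
    refine (setLIntegral_mono_ae measurable_const.aemeasurable h1).trans (le_of_eq ?_)
    rw [setLIntegral_const, hvol]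
    ring
  have hT' : ∫⁻ z in I ×ˢ Q, ∫⁻ z' in I ×ˢ Q, ‖g (z.1, z'.2) - g z'‖ₑ ^ 2 ≤
      βt * (volume I * volume Q) ^ 2 := by
    have e1 : ∀ t, ∫⁻ z' in I ×ˢ Q, ‖g (t, z'.2) - g z'‖ₑ ^ 2 = ∫⁻ t' in I, φ (t, t') := by
      intro t
      have hmt : Measurable fun z' : ℝ × E => ‖g (t, z'.2) - g z'‖ₑ ^ 2 :=
        hmT.comp (f := fun z' : ℝ × E => ((t, (0 : E)), z')) (by fun_prop)
      rw [hrestr, lintegral_prod _ hmt.aemeasurable]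
    have e2 : Measurable fun t => ∫⁻ t' in I, φ (t, t') := hφm.lintegral_prod_right'
    simp only [e1]
    have e3 : Measurable fun z : ℝ × E => ∫⁻ t' in I, φ (z.1, t') := e2.comp measurable_fst
    rw [hrestr, lintegral_prod _ e3.aemeasurable]
    simp only [lintegral_const, Measure.restrict_apply_univ]
    rw [lintegral_mul_const _ e2]
    refine (mul_le_mul_left hT _).trans (le_of_eq ?_)
    ring
  -- compare `z` and `z'` through the point with the time of `z` and the place of `z'`
  calc ∫⁻ z in I ×ˢ Q, ∫⁻ z' in I ×ˢ Q, ‖g z - g z'‖ₑ ^ 2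
      ≤ ∫⁻ z in I ×ˢ Q, (2 * (∫⁻ z' in I ×ˢ Q, ‖g z - g (z.1, z'.2)‖ₑ ^ 2) +
          2 * ∫⁻ z' in I ×ˢ Q, ‖g (z.1, z'.2) - g z'‖ₑ ^ 2) := by
        refine lintegral_mono fun z => ?_
        rw [← lintegral_const_mul' _ _ (by norm_num), ← lintegral_const_mul' _ _ (by norm_num),
          ← lintegral_add_left]
        · refine lintegral_mono fun z' => ?_
          have := enorm_add_sq_le (g z - g (z.1, z'.2)) (g (z.1, z'.2) - g z')
          rwa [sub_add_sub_cancel] at this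
        · exact (hmS.comp (measurable_const.prodMk measurable_id)).const_mul 2
    _ = 2 * (∫⁻ z in I ×ˢ Q, ∫⁻ z' in I ×ˢ Q, ‖g z - g (z.1, z'.2)‖ₑ ^ 2) +
          2 * ∫⁻ z in I ×ˢ Q, ∫⁻ z' in I ×ˢ Q, ‖g (z.1, z'.2) - g z'‖ₑ ^ 2 := by
        rw [lintegral_add_left, lintegral_const_mul' _ _ (by norm_num),
          lintegral_const_mul' _ _ (by norm_num)]
        exact (Measurable.lintegral_prod_right' hmS).const_mul 2
    _ ≤ 2 * (βs * (volume I * volume Q) ^ 2) + 2 * (βt * (volume I * volume Q) ^ 2) := by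
        gcongr
    _ ≤ _ := by
        rw [hvol, hN, hβs, hβt, ENNReal.ofReal_mul (by positivity),
          ENNReal.ofReal_add (by positivity) (by positivity)]
        set X := ENNReal.ofReal (R ^ (2 * γ) * (a - s) ^ (-(2 * γ) - 1))
        set Y := ENNReal.ofReal (R ^ 2 * (a - s) ^ (-3 : ℝ))
        rw [show 2 * (Ns * (ENNReal.ofReal (A ^ 2) * X) * Mu * (volume I * volume Q) ^ 2) +
            2 * (Nt * Y * Mu * (volume I * volume Q) ^ 2) =
          (2 * (Ns * ENNReal.ofReal (A ^ 2)) * X + 2 * Nt * Y) * Mu * (volume I * volume Q) ^ 2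
          by ring]
        refine mul_le_mul_left (mul_le_mul_left ?_ _) _
        rw [add_mul, mul_add, mul_add]
        exact add_le_add le_self_add le_add_self

end Far

/-! ### Averages and oscillation over boxes in space-time -/

section Boxes

variable {d : ℕ}

local notation "E" => EuclideanSpace ℝ (Fin d)

set_option linter.unusedSectionVars false

variable {𝕜 : Type*} [RCLike 𝕜] {H : Type*} [NormedAddCommGroup H]
    [InnerProductSpace 𝕜 H] [NormedSpace ℝ H]

/-- The iterated maximal function, in space and then in time. -/
noncomputable def mixedMaximal (g : ℝ × E → ℝ≥0∞) (z : ℝ × E) : ℝ≥0∞ :=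
  maximalFunction (fun s => maximalFunction (fun y => g (s, y)) z.2) z.1

/-- The convolution `(K(t,s,·) * f(s,·))(x)` as a function of the source time `s`, extended by zero
to `s ≥ t`. -/
noncomputable def causalConv (K : ℝ → ℝ → E → 𝕜) (f : ℝ × E → H) (z : ℝ × E) (s : ℝ) : H :=
  (Iio z.1).indicator (fun s => conv (K z.1 s) (fun y => f (s, y)) z.2) s

lemma stronglyMeasurable_causalConv {K : ℝ → ℝ → E → 𝕜}
    (hK : Measurable fun z : ℝ × ℝ × E => K z.1 z.2.1 z.2.2) {f : ℝ × E → H} (hf : Continuous f) :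
    StronglyMeasurable fun w : (ℝ × E) × ℝ => causalConv K f w.1 w.2 := by
  have h1 : StronglyMeasurable fun w : (ℝ × E) × ℝ =>
      conv (K w.1.1 w.2) (fun y => f (w.2, y)) w.1.2 :=
    (stronglyMeasurable_conv hK hf).comp_measurable
      (g := fun w : (ℝ × E) × ℝ => (w.1.1, w.2, w.1.2)) (by fun_prop)
  have hS : MeasurableSet {w : (ℝ × E) × ℝ | w.2 < w.1.1} :=
    measurableSet_lt (by fun_prop) (by fun_prop)
  exact h1.indicator hS

lemma hasCompactSupport_slice {f : ℝ × E → H} (hf : HasCompactSupport f) (s : ℝ) :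
    HasCompactSupport fun y => f (s, y) := by
  refine HasCompactSupport.of_support_subset_isCompact (hf.isCompact.image continuous_snd) ?_
  intro y hy
  exact ⟨(s, y), subset_tsupport f hy, rfl⟩

lemma contDiff_slice {f : ℝ × E → H} (hf : ContDiff ℝ ∞ f) (s : ℝ) :
    ContDiff ℝ ∞ fun y => f (s, y) := hf.comp (contDiff_const.prodMk contDiff_id)

/-- The contribution of the sources close in time to the average of the square function over a
box. -/
theorem KernelEstimates.exists_near_total_le {K : ℝ → ℝ → E → 𝕜}
    (hKm : Measurable fun z : ℝ × ℝ × E => K z.1 z.2.1 z.2.2) {γ A : ℝ} (hγ : 0 < γ) (hA : 0 ≤ A)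
    {ν : Fin 3 → ℝ} {N₁ C₀ : ℝ≥0} (hest : KernelEstimates K γ ν A N₁)
    (hL2 : ∀ s, ∀ u : E → H, ContDiff ℝ ∞ u → HasCompactSupport u →
      ∫⁻ t in Ioi s, ∫⁻ x, ‖conv (K t s) u x‖ₑ ^ 2 ≤ C₀ * ∫⁻ x, ‖u x‖ₑ ^ 2) :
    ∃ N : ℝ≥0, ∀ f : ℝ × E → H, ContDiff ℝ ∞ f → HasCompactSupport f → ∀ a R : ℝ, 0 < R →
      ∀ Q : Set E, MeasurableSet Q → (∀ x ∈ Q, ∀ x' ∈ Q, ‖x - x'‖ ≤ A * R ^ γ) →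
      ENNReal.ofReal ((R ^ γ) ^ d) ≤ volume Q → ∀ z₀ ∈ Ico a (a + R) ×ˢ Q,
      ∫⁻ z in Ico a (a + R) ×ˢ Q, ∫⁻ s in Ioi (a - R), ‖causalConv K f z s‖ₑ ^ 2 ≤
        N * volume (Ico a (a + R) ×ˢ Q) * mixedMaximal (fun z => ‖f z‖ₑ ^ 2) z₀ := by
  obtain ⟨N₀, hN₀⟩ := hest.exists_near_le hKm hγ hA hL2
  obtain ⟨Nb, hNb⟩ := exists_setLIntegral_ball_le ℝ
  refine ⟨N₀ * (Nb * 2), fun f hf hfc a R hR Q hQ hdiam hvolQ z₀ hz₀ => ?_⟩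
  set I : Set ℝ := Ico a (a + R) with hI
  have hIm : MeasurableSet I := measurableSet_Ico
  have hcm : Measurable fun w : (ℝ × E) × ℝ => ‖causalConv K f w.1 w.2‖ₑ ^ 2 :=
    (stronglyMeasurable_causalConv hKm hf.continuous).enorm.pow_const 2
  have hrestr : (volume : Measure (ℝ × E)).restrict (I ×ˢ Q) =
      (volume.restrict I).prod (volume.restrict Q) := by
    rw [Measure.volume_eq_prod, Measure.prod_restrict]
  have hvol : volume (I ×ˢ Q) = ENNReal.ofReal R * volume Q := by
    rw [Measure.volume_eq_prod, Measure.prod_prod, hI, Real.volume_Ico, add_sub_cancel_left]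
  set U : ℝ → ℝ≥0∞ := fun s => maximalFunction (fun y => ‖f (s, y)‖ₑ ^ 2) z₀.2 with hU
  have hUm : Measurable U :=
    (measurable_maximalFunction_prod (u := fun z : ℝ × E => ‖f z‖ₑ ^ 2)
      (hf.continuous.enorm.measurable.pow_const 2)).comp
      (g := fun z : ℝ × E => maximalFunction (fun y => ‖f (z.1, y)‖ₑ ^ 2) z.2)
      (f := fun s : ℝ => (s, z₀.2)) (by fun_prop)
  -- for a fixed source time, the integral over the box
  have hslice : ∀ s, s ∈ Ioi (a - R) → ∫⁻ z in I ×ˢ Q, ‖causalConv K f z s‖ₑ ^ 2 ≤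
      (Iio (a + R)).indicator (fun s => N₀ * volume Q * U s) s := by
    intro s hs
    have hms : Measurable fun z : ℝ × E => ‖causalConv K f z s‖ₑ ^ 2 :=
      hcm.comp (f := fun z : ℝ × E => (z, s)) (by fun_prop)
    by_cases hsR : s < a + R
    · rw [indicator_of_mem (by exact hsR), hrestr, lintegral_prod _ hms.aemeasurable]
      refine le_trans ?_ (hN₀ (fun y => f (s, y)) (contDiff_slice hf s)
        (hasCompactSupport_slice hfc s) s R hR Q hQ hdiam hvolQ z₀.2 hz₀.2)
      rw [← lintegral_indicator hIm, ← lintegral_indicator measurableSet_Ioo]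
      refine lintegral_mono fun t => ?_
      by_cases ht : t ∈ I
      · rw [indicator_of_mem ht]
        by_cases hst : s < t
        · have : t ∈ Ioo s (s + 2 * R) := ⟨hst, by
            have h1 : a - R < s := hs
            linarith [ht.2]⟩
          rw [indicator_of_mem this]
          refine le_of_eq (lintegral_congr fun x => ?_)
          simp [causalConv, hst]
        · simp [causalConv, hst]
      · rw [indicator_of_notMem ht]
        exact zero_le
    · rw [indicator_of_notMem (by exact hsR), hrestr, lintegral_prod _ hms.aemeasurable,
        ← lintegral_indicator hIm]
      refine le_of_eq (lintegral_eq_zero_of_ae_eq_zero (Filter.Eventually.of_forall fun t => ?_))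
      by_cases ht : t ∈ I
      · have : ¬ s < t := by linarith [ht.2, not_lt.1 hsR]
        simp [causalConv, this]
      · simp [ht]
  calc ∫⁻ z in I ×ˢ Q, ∫⁻ s in Ioi (a - R), ‖causalConv K f z s‖ₑ ^ 2
      = ∫⁻ s in Ioi (a - R), ∫⁻ z in I ×ˢ Q, ‖causalConv K f z s‖ₑ ^ 2 :=
        lintegral_lintegral_swap hcm.aemeasurable
    _ ≤ ∫⁻ s in Ioi (a - R), (Iio (a + R)).indicator (fun s => N₀ * volume Q * U s) s :=
        setLIntegral_mono' measurableSet_Ioi hslice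
    _ ≤ ∫⁻ s in Metric.ball z₀.1 (2 * R), N₀ * volume Q * U s := by
        rw [← lintegral_indicator measurableSet_Ioi, ← lintegral_indicator measurableSet_ball]
        refine lintegral_mono fun s => ?_
        by_cases h1 : s ∈ Ioi (a - R) ∧ s < a + R
        · have h2 : s ∈ Metric.ball z₀.1 (2 * R) := by
            have h3 : a - R < s := h1.1
            have h4 : a ≤ z₀.1 := hz₀.1.1
            have h5 : z₀.1 < a + R := hz₀.1.2
            rw [Metric.mem_ball, Real.dist_eq, abs_lt]
            constructor <;> linarith [h1.2]
          rw [indicator_of_mem h1.1, indicator_of_mem (by exact h1.2), indicator_of_mem h2]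
        · rw [not_and] at h1
          by_cases h2 : s ∈ Ioi (a - R)
          · rw [indicator_of_mem h2, indicator_of_notMem (by exact h1 h2)]
            exact zero_le
          · rw [indicator_of_notMem h2]
            exact zero_le
    _ = N₀ * volume Q * ∫⁻ s in Metric.ball z₀.1 (2 * R), U s := lintegral_const_mul _ hUm
    _ ≤ N₀ * volume Q * (Nb * ENNReal.ofReal ((2 * R) ^ 1) * maximalFunction U z₀.1) := by
        refine mul_le_mul_right ?_ _
        have := hNb U hUm z₀.1 (2 * R) (by positivity)
        rwa [Module.finrank_self] at this
    _ = _ := by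
        rw [hvol, pow_one, ENNReal.ofReal_mul zero_le_two, mixedMaximal]
        push_cast
        rw [ENNReal.ofReal_ofNat]
        ring

/-- The oscillation over a box of the contribution of the sources remote in time. -/
theorem KernelEstimates.exists_far_total_le {K : ℝ → ℝ → E → 𝕜}
    (hKm : Measurable fun z : ℝ × ℝ × E => K z.1 z.2.1 z.2.2) {γ A : ℝ} (hγ : 0 < γ) (hA : 0 ≤ A)
    {ν : Fin 3 → ℝ} {N₁ : ℝ≥0} (hest : KernelEstimates K γ ν A N₁) :
    ∃ N : ℝ≥0, ∀ f : ℝ × E → H, ContDiff ℝ ∞ f → HasCompactSupport f → ∀ a R : ℝ, 0 < R →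
      ∀ Q : Set E, MeasurableSet Q → (∀ x ∈ Q, ∀ x' ∈ Q, ‖x - x'‖ ≤ A * R ^ γ) →
      ∀ z₀ ∈ Ico a (a + R) ×ˢ Q,
      ∫⁻ z in Ico a (a + R) ×ˢ Q, ∫⁻ z' in Ico a (a + R) ×ˢ Q, ∫⁻ s in Iic (a - R),
        ‖causalConv K f z s - causalConv K f z' s‖ₑ ^ 2 ≤
        N * (volume (Ico a (a + R) ×ˢ Q)) ^ 2 * mixedMaximal (fun z => ‖f z‖ₑ ^ 2) z₀ := by
  obtain ⟨N₀, hN₀⟩ := hest.exists_far_slice_le (H := H) hKm hγ hA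
  obtain ⟨Na, hNa⟩ := exists_lintegral_mul_decay_le ℝ (ν := 2 * γ + 1)
    (by rw [Module.finrank_self]; push_cast; linarith)
  obtain ⟨Nb, hNb⟩ := exists_lintegral_mul_decay_le ℝ (ν := 3)
    (by rw [Module.finrank_self]; norm_num)
  obtain ⟨N, hN⟩ : ∃ N : ℝ≥0, (N : ℝ≥0∞) =
      N₀ * (ENNReal.ofReal (3 ^ (2 * γ + 1)) * Na + ENNReal.ofReal (3 ^ (3 : ℝ)) * Nb) := by
    refine ⟨_, ENNReal.coe_toNNReal ?_⟩
    exact ENNReal.mul_ne_top ENNReal.coe_ne_top (ENNReal.add_ne_top.2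
      ⟨ENNReal.mul_ne_top ENNReal.ofReal_ne_top ENNReal.coe_ne_top,
        ENNReal.mul_ne_top ENNReal.ofReal_ne_top ENNReal.coe_ne_top⟩)
  refine ⟨N, fun f hf hfc a R hR Q hQ hdiam z₀ hz₀ => ?_⟩
  set P : Set (ℝ × E) := Ico a (a + R) ×ˢ Q with hP
  have hPm : MeasurableSet P := measurableSet_Ico.prod hQ
  have hcs := stronglyMeasurable_causalConv hKm hf.continuous
  have hm : Measurable fun w : ((ℝ × E) × (ℝ × E)) × ℝ =>
      ‖causalConv K f w.1.1 w.2 - causalConv K f w.1.2 w.2‖ₑ ^ 2 :=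
    ((hcs.comp_measurable (g := fun w : ((ℝ × E) × (ℝ × E)) × ℝ => (w.1.1, w.2))
      (by fun_prop)).sub (hcs.comp_measurable
      (g := fun w : ((ℝ × E) × (ℝ × E)) × ℝ => (w.1.2, w.2)) (by fun_prop))).enorm.pow_const 2
  set U : ℝ → ℝ≥0∞ := fun s => maximalFunction (fun y => ‖f (s, y)‖ₑ ^ 2) z₀.2 with hU
  have hUm : Measurable U :=
    (measurable_maximalFunction_prod (u := fun z : ℝ × E => ‖f z‖ₑ ^ 2)
      (hf.continuous.enorm.measurable.pow_const 2)).comp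
      (g := fun z : ℝ × E => maximalFunction (fun y => ‖f (z.1, y)‖ₑ ^ 2) z.2)
      (f := fun s : ℝ => (s, z₀.2)) (by fun_prop)
  have hswap : ∫⁻ z in P, ∫⁻ z' in P, ∫⁻ s in Iic (a - R),
      ‖causalConv K f z s - causalConv K f z' s‖ₑ ^ 2 =
      ∫⁻ s in Iic (a - R), ∫⁻ z in P, ∫⁻ z' in P,
        ‖causalConv K f z s - causalConv K f z' s‖ₑ ^ 2 := by
    have h1 : ∀ z, ∫⁻ z' in P, ∫⁻ s in Iic (a - R),
        ‖causalConv K f z s - causalConv K f z' s‖ₑ ^ 2 = ∫⁻ s in Iic (a - R), ∫⁻ z' in P,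
        ‖causalConv K f z s - causalConv K f z' s‖ₑ ^ 2 := by
      intro z
      exact lintegral_lintegral_swap (hm.comp
        (f := fun w : (ℝ × E) × ℝ => ((z, w.1), w.2)) (by fun_prop)).aemeasurable
    simp only [h1]
    refine lintegral_lintegral_swap
      (f := fun z s => ∫⁻ z' in P, ‖causalConv K f z s - causalConv K f z' s‖ₑ ^ 2) ?_
    have h2 : Measurable fun w : ((ℝ × E) × ℝ) × (ℝ × E) =>
        ‖causalConv K f w.1.1 w.1.2 - causalConv K f w.2 w.1.2‖ₑ ^ 2 :=
      hm.comp (f := fun w : ((ℝ × E) × ℝ) × (ℝ × E) => ((w.1.1, w.2), w.1.2)) (by fun_prop)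
    exact h2.lintegral_prod_right'.aemeasurable
  rw [hswap]
  set X : ℝ → ℝ≥0∞ := fun s => ENNReal.ofReal ((1 + ‖s - z₀.1‖ / R) ^ (-(2 * γ + 1))) with hX
  set Y : ℝ → ℝ≥0∞ := fun s => ENNReal.ofReal ((1 + ‖s - z₀.1‖ / R) ^ (-(3 : ℝ))) with hY
  have hXm : Measurable X := by fun_prop
  have hYm : Measurable Y := by fun_prop
  set cX : ℝ≥0∞ := ENNReal.ofReal (3 ^ (2 * γ + 1) * R⁻¹) with hcX
  set cY : ℝ≥0∞ := ENNReal.ofReal (3 ^ (3 : ℝ) * R⁻¹) with hcY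
  -- the decay in the source time, as a decay away from the time of the base point
  have hdec : ∀ s, s ≤ a - R → ENNReal.ofReal (R ^ (2 * γ) * (a - s) ^ (-(2 * γ) - 1) +
      R ^ 2 * (a - s) ^ (-3 : ℝ)) ≤ cX * X s + cY * Y s := by
    intro s hs
    have hτ : R ≤ a - s := by linarith
    have hτ0 : 0 < a - s := by linarith
    have h4 : a ≤ z₀.1 := hz₀.1.1
    have h5 : z₀.1 < a + R := hz₀.1.2
    have hp : 0 < 1 + ‖s - z₀.1‖ / R := by positivity
    have h6 : 1 + ‖s - z₀.1‖ / R ≤ 3 * ((a - s) / R) := by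
      rw [Real.norm_eq_abs, abs_of_nonpos (by linarith), ← mul_div_assoc, ← div_self hR.ne',
        ← add_div]
      exact div_le_div_of_nonneg_right (by linarith) hR.le
    have key : ∀ q : ℝ, 0 ≤ q → R ^ (q - 1) * (a - s) ^ (-q) ≤
        3 ^ q * R⁻¹ * (1 + ‖s - z₀.1‖ / R) ^ (-q) := by
      intro q hq
      have h7 := Real.rpow_le_rpow hp.le h6 hq
      rw [Real.mul_rpow (by norm_num) (by positivity), Real.div_rpow hτ0.le hR.le] at h7
      have hRq : 0 < R ^ q := Real.rpow_pos_of_pos hR _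
      have hτq : 0 < (a - s) ^ q := Real.rpow_pos_of_pos hτ0 _
      have hpq : 0 < (1 + ‖s - z₀.1‖ / R) ^ q := Real.rpow_pos_of_pos hp _
      rw [Real.rpow_neg hτ0.le, Real.rpow_neg hp.le, Real.rpow_sub hR, Real.rpow_one]
      rw [← div_eq_mul_inv, ← div_eq_mul_inv, div_le_div_iff₀ hτq hpq]
      have h8 : (1 + ‖s - z₀.1‖ / R) ^ q * R ^ q ≤ 3 ^ q * (a - s) ^ q := by
        rw [← mul_div_assoc, le_div_iff₀ hRq] at h7
        exact h7
      calc R ^ q / R * (1 + ‖s - z₀.1‖ / R) ^ q = ((1 + ‖s - z₀.1‖ / R) ^ q * R ^ q) * R⁻¹ := by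
            rw [div_eq_mul_inv]; ring
        _ ≤ (3 ^ q * (a - s) ^ q) * R⁻¹ := mul_le_mul_of_nonneg_right h8 (by positivity)
        _ = _ := by ring
    rw [ENNReal.ofReal_add (by positivity) (by positivity), hcX, hcY, hX, hY]
    refine add_le_add ?_ ?_
    · rw [← ENNReal.ofReal_mul (by positivity)]
      refine ENNReal.ofReal_le_ofReal ?_
      have := key (2 * γ + 1) (by positivity)
      rw [show -(2 * γ) - 1 = -(2 * γ + 1) by ring]
      rwa [add_sub_cancel_right] at this
    · rw [← ENNReal.ofReal_mul (by positivity)]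
      refine ENNReal.ofReal_le_ofReal ?_
      have := key 3 (by norm_num)
      rwa [show (3 : ℝ) - 1 = ((2 : ℕ) : ℝ) by norm_num, Real.rpow_natCast] at this
  calc ∫⁻ s in Iic (a - R), ∫⁻ z in P, ∫⁻ z' in P,
        ‖causalConv K f z s - causalConv K f z' s‖ₑ ^ 2
      ≤ ∫⁻ s in Iic (a - R), N₀ * (volume P) ^ 2 * (cX * (U s * X s) + cY * (U s * Y s)) := by
        refine setLIntegral_mono' measurableSet_Iic fun s hs => ?_
        have hs' : s ≤ a - R := hs
        have hcc : ∀ z ∈ P, causalConv K f z s = conv (K z.1 s) (fun y => f (s, y)) z.2 := by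
          intro z hz
          have : s < z.1 := by
            have h1 : a ≤ z.1 := hz.1.1
            linarith
          simp [causalConv, this]
        have e1 : ∫⁻ z in P, ∫⁻ z' in P, ‖causalConv K f z s - causalConv K f z' s‖ₑ ^ 2 =
            ∫⁻ z in P, ∫⁻ z' in P, ‖conv (K z.1 s) (fun y => f (s, y)) z.2 -
              conv (K z'.1 s) (fun y => f (s, y)) z'.2‖ₑ ^ 2 := by
          refine setLIntegral_congr_fun hPm fun z hz => ?_
          refine setLIntegral_congr_fun hPm fun z' hz' => ?_
          simp only [hcc z hz, hcc z' hz']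
        rw [e1]
        refine (hN₀ (fun y => f (s, y)) (contDiff_slice hf s) (hasCompactSupport_slice hfc s) s a R
          hR hs' Q hQ hdiam z₀.2 hz₀.2).trans ?_
        calc N₀ * ENNReal.ofReal (R ^ (2 * γ) * (a - s) ^ (-(2 * γ) - 1) +
              R ^ 2 * (a - s) ^ (-3 : ℝ)) * U s * (volume P) ^ 2
            ≤ N₀ * (cX * X s + cY * Y s) * U s * (volume P) ^ 2 := by
              gcongr
              exact hdec s hs'
          _ = _ := by ring
    _ ≤ ∫⁻ s, N₀ * (volume P) ^ 2 * (cX * (U s * X s) + cY * (U s * Y s)) :=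
        setLIntegral_le_lintegral _ _
    _ = N₀ * (volume P) ^ 2 * (cX * (∫⁻ s, U s * X s) + cY * ∫⁻ s, U s * Y s) := by
        have h1 : Measurable fun s => U s * X s := hUm.mul hXm
        have h2 : Measurable fun s => U s * Y s := hUm.mul hYm
        have h3 : Measurable fun s => cX * (U s * X s) := h1.const_mul _
        have h4 : Measurable fun s => cX * (U s * X s) + cY * (U s * Y s) :=
          h3.add (h2.const_mul _)
        rw [lintegral_const_mul _ h4, lintegral_add_left h3, lintegral_const_mul _ h1,
          lintegral_const_mul _ h2]
    _ ≤ N₀ * (volume P) ^ 2 * (cX * (Na * ENNReal.ofReal R * maximalFunction U z₀.1) +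
          cY * (Nb * ENNReal.ofReal R * maximalFunction U z₀.1)) := by
        have h1 := hNa U hUm z₀.1 R hR
        have h2 := hNb U hUm z₀.1 R hR
        rw [Module.finrank_self, pow_one] at h1 h2
        gcongr
    _ = _ := by
        have hRR : ENNReal.ofReal R⁻¹ * ENNReal.ofReal R = 1 := by
          rw [← ENNReal.ofReal_mul (by positivity), inv_mul_cancel₀ hR.ne', ENNReal.ofReal_one]
        rw [hcX, hcY, ENNReal.ofReal_mul (by positivity), ENNReal.ofReal_mul (by positivity), hN,
          mixedMaximal]
        calc _ = N₀ * (ENNReal.ofReal (3 ^ (2 * γ + 1)) * Na + ENNReal.ofReal (3 ^ (3 : ℝ)) * Nb) *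
              (volume P) ^ 2 * maximalFunction U z₀.1 * (ENNReal.ofReal R⁻¹ * ENNReal.ofReal R) := by
              ring
          _ = _ := by rw [hRR, mul_one]

end Boxes

/-! ### A good-`λ` inequality for nested partitions -/

section GoodLambda

/-- A nested family of partitions of a measure space into cells: `c n z` is the cell of level `n`
containing `z`, all cells of level `n` have the measure `v n`, finer levels have larger `n`, and
passing to the parent cell multiplies the measure by at most `D`. Their measures are unbounded
at coarse levels, and they shrink to their points at fine ones. -/
structure CellFamily {α : Type*} [MeasureSpace α] [TopologicalSpace α] (c : ℤ → α → Set α)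
    (v : ℤ → ℝ≥0∞) (D : ℝ≥0) : Prop where
  mem_self : ∀ n z, z ∈ c n z
  eq_of_mem : ∀ n z w, w ∈ c n z → c n w = c n z
  measurableSet : ∀ n z, MeasurableSet (c n z)
  subset_of_le : ∀ n n' z, n ≤ n' → c n' z ⊆ c n z
  countable : ∀ n, (range (c n)).Countable
  volume_eq : ∀ n z, volume (c n z) = v n
  ne_zero : ∀ n, v n ≠ 0
  ne_top : ∀ n, v n ≠ ⊤
  parent_le : ∀ n, v (n - 1) ≤ D * v n
  large : ∀ C : ℝ≥0∞, C ≠ ⊤ → ∃ n₀, ∀ n < n₀, C ≤ v n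
  small : ∀ (U : Set α), IsOpen U → ∀ z ∈ U, ∃ j, 0 ≤ j ∧ c j z ⊆ U

namespace CellFamily

variable {α : Type*} [MeasureSpace α] [TopologicalSpace α] {c : ℤ → α → Set α}
  {v : ℤ → ℝ≥0∞} {D : ℝ≥0}

/-- A union of cells of one level is the disjoint union of countably many of them. -/
lemma measurableSet_of_saturated (hc : CellFamily c v D) {n : ℤ} {A : Set α}
    (hA : ∀ z ∈ A, c n z ⊆ A) : MeasurableSet A := by
  have : A = ⋃ S ∈ c n '' A, S := by
    ext z
    simp only [mem_iUnion, exists_prop, mem_image, exists_exists_and_eq_and]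
    exact ⟨fun h => ⟨z, h, hc.mem_self n z⟩, fun ⟨w, hw, hz⟩ => hA w hw hz⟩
  rw [this]
  refine MeasurableSet.biUnion ((hc.countable n).mono (image_subset_range _ _)) ?_
  rintro S ⟨w, -, rfl⟩
  exact hc.measurableSet n w

/-- Measures are compared on a union of cells of one level by comparing them on each cell. -/
lemma measure_le_of_saturated (hc : CellFamily c v D) {μ₁ μ₂ : Measure α} {n : ℤ} {A : Set α}
    (hA : ∀ z ∈ A, c n z ⊆ A) (h : ∀ z ∈ A, μ₁ (c n z) ≤ μ₂ (c n z)) : μ₁ A ≤ μ₂ A := by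
  have hU : A = ⋃ S ∈ c n '' A, S := by
    ext z
    simp only [mem_iUnion, exists_prop, mem_image, exists_exists_and_eq_and]
    exact ⟨fun h => ⟨z, h, hc.mem_self n z⟩, fun ⟨w, hw, hz⟩ => hA w hw hz⟩
  have hcount : (c n '' A).Countable := (hc.countable n).mono (image_subset_range _ _)
  have hdisj : (c n '' A).PairwiseDisjoint id := by
    rintro _ ⟨w, -, rfl⟩ _ ⟨w', -, rfl⟩ hne
    refine Set.disjoint_left.2 fun z hz hz' => hne ?_
    rw [← hc.eq_of_mem n w z hz, ← hc.eq_of_mem n w' z hz']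
  have hm : ∀ S ∈ c n '' A, MeasurableSet S := by
    rintro S ⟨w, -, rfl⟩
    exact hc.measurableSet n w
  have e : ∀ μ : Measure α, μ A = ∑' S : (c n '' A), μ S := by
    intro μ
    conv_lhs => rw [hU]
    exact measure_biUnion hcount hdisj hm
  rw [e, e]
  refine ENNReal.tsum_le_tsum ?_
  rintro ⟨S, w, hw, rfl⟩
  exact h w hw

/-- Comparison of two measures on the set where a property of cells holds at some level, by
comparing them on the cells where it holds for the first time. -/
theorem measure_le_of_first (hc : CellFamily c v D) {μ₁ μ₂ : Measure α} {p : ℤ → α → Prop}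
    (hp : ∀ n z w, w ∈ c n z → p n z → p n w) (n₀ : ℤ)
    (h : ∀ n ≥ n₀, ∀ z, p n z → (∀ i, n₀ ≤ i → i < n → ¬ p i z) → μ₁ (c n z) ≤ μ₂ (c n z)) :
    μ₁ {z | ∃ n ≥ n₀, p n z} ≤ μ₂ {z | ∃ n ≥ n₀, p n z} ∧
      MeasurableSet {z | ∃ n ≥ n₀, p n z} := by
  set B : ℕ → Set α := fun k => {z | p (n₀ + k) z ∧ ∀ i, n₀ ≤ i → i < n₀ + k → ¬ p i z} with hB
  have hU : {z | ∃ n ≥ n₀, p n z} = ⋃ k, B k := by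
    ext z
    simp only [mem_ofPred_eq, mem_iUnion, hB]
    constructor
    · rintro ⟨n, hn, hpn⟩
      classical
      have hex : ∃ k : ℕ, p (n₀ + k) z := ⟨(n - n₀).toNat, by
        rwa [Int.toNat_of_nonneg (by linarith), add_sub_cancel]⟩
      refine ⟨Nat.find hex, Nat.find_spec hex, fun i hi hi' hpi => ?_⟩
      refine Nat.find_min hex (m := (i - n₀).toNat) (by omega) ?_
      rwa [Int.toNat_of_nonneg (by linarith), add_sub_cancel]
    · rintro ⟨k, hk, -⟩
      exact ⟨n₀ + k, by simp, hk⟩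
  have hsat : ∀ k, ∀ z ∈ B k, c (n₀ + k) z ⊆ B k := by
    rintro k z ⟨hz, hz'⟩ w hw
    refine ⟨hp _ z w hw hz, fun i hi hi' hpi => hz' i hi hi' ?_⟩
    have hw' : w ∈ c i z := hc.subset_of_le _ _ _ hi'.le hw
    refine hp i w z ?_ hpi
    rw [hc.eq_of_mem _ _ _ hw']
    exact hc.mem_self _ _
  have hm : ∀ k, MeasurableSet (B k) := fun k => hc.measurableSet_of_saturated (hsat k)
  have hdisj : Pairwise (Function.onFun Disjoint B) := by
    have : ∀ k l, k < l → Disjoint (B k) (B l) := by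
      intro k l hkl
      refine Set.disjoint_left.2 fun z hz hz' => ?_
      exact hz'.2 (n₀ + k) (by simp) (by simpa using hkl) hz.1
    intro k l hkl
    rcases lt_or_gt_of_ne hkl with h | h
    · exact this k l h
    · exact (this l k h).symm
  rw [hU]
  refine ⟨?_, MeasurableSet.iUnion hm⟩
  rw [measure_iUnion hdisj hm, measure_iUnion hdisj hm]
  refine ENNReal.tsum_le_tsum fun k => hc.measure_le_of_saturated (hsat k) ?_
  rintro z ⟨hz, hz'⟩
  exact h _ (by simp) z hz hz'

/-- The set where some cell average of `h` exceeds `l`. -/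
def levelSet (c : ℤ → α → Set α) (v : ℤ → ℝ≥0∞) (h : α → ℝ≥0∞) (l : ℝ≥0∞) : Set α :=
  {z | ∃ n, l * v n < ∫⁻ w in c n z, h w}

lemma exists_levelSet_eq (hc : CellFamily c v D) {h : α → ℝ≥0∞} (hh : ∫⁻ z, h z ≠ ⊤) {l : ℝ≥0∞}
    (hl : l ≠ 0) (hlt : l ≠ ⊤) : ∃ n₀, (∀ n < n₀, ∀ z, ¬ l * v n < ∫⁻ w in c n z, h w) ∧
      levelSet c v h l = {z | ∃ n ≥ n₀, l * v n < ∫⁻ w in c n z, h w} := by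
  obtain ⟨n₀, hn₀⟩ := hc.large (l⁻¹ * ∫⁻ z, h z) (ENNReal.mul_ne_top (ENNReal.inv_ne_top.2 hl) hh)
  have key : ∀ n < n₀, ∀ z, ¬ l * v n < ∫⁻ w in c n z, h w := by
    intro n hn z
    refine not_lt.2 ((setLIntegral_le_lintegral _ _).trans ?_)
    have h1 := mul_le_mul_right (hn₀ n hn) l
    rwa [← mul_assoc, ENNReal.mul_inv_cancel hl hlt, one_mul] at h1
  refine ⟨n₀, key, ?_⟩
  ext z
  refine ⟨fun ⟨n, hn⟩ => ⟨n, ?_, hn⟩, fun ⟨n, _, hn⟩ => ⟨n, hn⟩⟩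
  by_contra hlt
  exact key n (not_le.1 hlt) z hn

lemma average_congr (hc : CellFamily c v D) {h : α → ℝ≥0∞} (l : ℝ≥0∞) (n : ℤ) (z w : α)
    (hw : w ∈ c n z) (hz : l * v n < ∫⁻ w in c n z, h w) : l * v n < ∫⁻ y in c n w, h y := by
  rwa [hc.eq_of_mem n z w hw]

lemma measurableSet_levelSet (hc : CellFamily c v D) {h : α → ℝ≥0∞} (hh : ∫⁻ z, h z ≠ ⊤)
    {l : ℝ≥0∞} (hl : l ≠ 0) (hlt : l ≠ ⊤) : MeasurableSet (levelSet c v h l) := by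
  obtain ⟨n₀, -, e⟩ := hc.exists_levelSet_eq hh hl hlt
  rw [e]
  exact (hc.measure_le_of_first (μ₁ := 0) (μ₂ := 0)
    (fun n z w hw hz => hc.average_congr (h := h) l n z w hw hz) n₀ fun _ _ _ _ _ => le_rfl).2

/-- The weak type inequality for cell averages. -/
lemma mul_measure_levelSet_le (hc : CellFamily c v D) {h : α → ℝ≥0∞}
    (hh : ∫⁻ z, h z ≠ ⊤) {l : ℝ≥0∞} (hl : l ≠ 0) (hlt : l ≠ ⊤) :
    l * volume (levelSet c v h l) ≤ ∫⁻ z, h z := by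
  obtain ⟨n₀, -, e⟩ := hc.exists_levelSet_eq hh hl hlt
  have := (hc.measure_le_of_first (μ₁ := l • volume) (μ₂ := volume.withDensity h)
    (fun n z w hw hz => hc.average_congr (h := h) l n z w hw hz) n₀ fun n _ z hz _ => by
      rw [withDensity_apply _ (hc.measurableSet n z), Measure.smul_apply, smul_eq_mul,
        hc.volume_eq]
      exact hz.le)
  rw [← e] at this
  have h2 := this.1
  rw [withDensity_apply _ this.2, Measure.smul_apply, smul_eq_mul] at h2
  exact h2.trans (setLIntegral_le_lintegral _ _)

/-- Off the level set the function itself does not exceed the level: a set of density points is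
covered by small cells inside an open set of nearly the same measure. -/
theorem ae_le_of_notMem_levelSet [OpensMeasurableSpace α] [SigmaFinite (volume : Measure α)]
    [(volume : Measure α).OuterRegular]
    (hc : CellFamily c v D) {h : α → ℝ≥0∞} (hm : Measurable h) (hh : ∫⁻ z, h z ≠ ⊤) {l : ℝ≥0∞}
    (hl : l ≠ 0) (hlt : l ≠ ⊤) : ∀ᵐ z, z ∉ levelSet c v h l → h z ≤ l := by
  have hE := (hc.measurableSet_levelSet hh hl hlt).compl
  have key : ∀ S : Set α, MeasurableSet S → volume S < ⊤ → S ⊆ (levelSet c v h l)ᶜ →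
      ∫⁻ z in S, h z ≤ l * volume S := by
    intro S hS hSt hSE
    have : ∀ ε : ℝ≥0, 0 < ε → ∫⁻ z in S, h z ≤ l * (volume S + ε) := by
      intro ε hε
      obtain ⟨U, hSU, hU, hUε⟩ := S.exists_isOpen_lt_add hSt.ne (ε := ε) (by exact_mod_cast hε.ne')
      have h1 := hc.measure_le_of_first (μ₁ := volume.withDensity h) (μ₂ := l • volume)
        (p := fun n z => c n z ⊆ U ∧ (c n z ∩ S).Nonempty) (fun n z w hw hz => by
          rwa [hc.eq_of_mem n z w hw]) 0 (fun n _ z hz _ => by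
          obtain ⟨-, y, hyc, hyS⟩ := hz
          rw [withDensity_apply _ (hc.measurableSet n z), Measure.smul_apply, smul_eq_mul,
            hc.volume_eq, ← hc.eq_of_mem n z y hyc]
          by_contra hlt'
          exact hSE hyS ⟨n, not_le.1 hlt'⟩)
      set W : Set α := {z | ∃ n ≥ 0, c n z ⊆ U ∧ (c n z ∩ S).Nonempty} with hW
      have hSW : S ⊆ W := fun z hz => by
        obtain ⟨j, hj, hjU⟩ := hc.small U hU z (hSU hz)
        exact ⟨j, hj, hjU, z, hc.mem_self j z, hz⟩
      have hWU : W ⊆ U := fun z ⟨n, _, hn, _⟩ => hn (hc.mem_self n z)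
      calc ∫⁻ z in S, h z ≤ ∫⁻ z in W, h z := lintegral_mono_set hSW
        _ = volume.withDensity h W := (withDensity_apply _ h1.2).symm
        _ ≤ (l • volume) W := h1.1
        _ = l * volume W := by rw [Measure.smul_apply, smul_eq_mul]
        _ ≤ l * (volume S + ε) := mul_le_mul_right ((measure_mono hWU).trans hUε.le) _
    have h2 : l * volume S ≠ ⊤ := ENNReal.mul_ne_top hlt hSt.ne
    refine ENNReal.le_of_forall_pos_le_add fun ε hε _ => ?_
    have hε' : (ε : ℝ≥0∞) / l ≠ ⊤ := ENNReal.div_ne_top ENNReal.coe_ne_top hl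
    have hε0 : (ε : ℝ≥0∞) / l ≠ 0 :=
      (ENNReal.div_pos (by exact_mod_cast hε.ne') hlt).ne'
    have h3 := this ((ε : ℝ≥0∞) / l).toNNReal (ENNReal.toNNReal_pos hε0 hε')
    rw [ENNReal.coe_toNNReal hε', mul_add, ENNReal.mul_div_cancel hl hlt] at h3
    exact h3
  have h4 : h ≤ᵐ[volume.restrict (levelSet c v h l)ᶜ] fun _ => l := by
    refine ae_le_of_forall_setLIntegral_le_of_sigmaFinite hm fun S hS hSt => ?_
    rw [Measure.restrict_restrict hS, setLIntegral_const]
    refine key _ (hS.inter hE) ?_ inter_subset_right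
    rwa [Measure.restrict_apply hS] at hSt
  exact (ae_restrict_iff' hE).1 h4

/-- The good-`λ` inequality: where the controlling function `m` is small, the level set at a higher
level occupies a small portion of the level set. -/
theorem measure_levelSet_inter_le (hc : CellFamily c v D) {h m : α → ℝ≥0∞}
    (hm : Measurable m) (hh : ∫⁻ z, h z ≠ ⊤) {N : ℝ≥0}
    (hosc : ∀ n z, ∀ z₀ ∈ c n z, ∃ o : α → ℝ≥0∞, Measurable o ∧
      (∀ w ∈ c n z, h w ≤ 2 * ((v n)⁻¹ * ∫⁻ y in c n z, h y) + o w) ∧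
      ∫⁻ w in c n z, o w ≤ N * v n * m z₀)
    {l : ℝ≥0∞} (hl : l ≠ 0) (hlt : l ≠ ⊤) (δ : ℝ≥0) :
    volume (levelSet c v h (4 * l) ∩ {z | m z ≤ δ * l}) ≤
      (N * D * δ : ℝ≥0) * volume (levelSet c v h l) := by
  obtain ⟨n₀, hn₀, e⟩ := hc.exists_levelSet_eq hh hl hlt
  set T : Set α := levelSet c v h (4 * l) ∩ {z | m z ≤ δ * l} with hT
  have hl4 : 4 * l ≠ 0 := mul_ne_zero (by norm_num) hl
  have hl4t : 4 * l ≠ ⊤ := ENNReal.mul_ne_top (by norm_num) hlt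
  have hTm : MeasurableSet T := (hc.measurableSet_levelSet hh hl4 hl4t).inter
    (measurableSet_le hm measurable_const)
  have hsub : levelSet c v h (4 * l) ⊆ levelSet c v h l := by
    rintro z ⟨n, hn⟩
    refine ⟨n, lt_of_le_of_lt ?_ hn⟩
    exact mul_le_mul_left (le_mul_of_one_le_left zero_le (by norm_num)) _
  have main := hc.measure_le_of_first (μ₁ := volume.restrict T)
    (μ₂ := ((N * D * δ : ℝ≥0) : ℝ≥0∞) • volume)
    (fun n z w hw hz => hc.average_congr (h := h) l n z w hw hz) n₀ ?_
  · rw [← e, Measure.smul_apply, smul_eq_mul, Measure.restrict_apply' hTm,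
      inter_eq_self_of_subset_right (inter_subset_left.trans hsub)] at main
    exact main.1
  intro n hn z hz hfirst
  rw [Measure.restrict_apply' hTm, Measure.smul_apply, smul_eq_mul, hc.volume_eq]
  -- a cell where the average exceeds `l` for the first time
  by_cases hne : (c n z ∩ T).Nonempty
  swap
  · rw [not_nonempty_iff_eq_empty.1 hne, measure_empty]
    exact zero_le
  obtain ⟨z₀, hz₀c, hz₀T⟩ := hne
  have hz₀m : m z₀ ≤ δ * l := hz₀T.2
  have hbefore : ∀ i < n, ∫⁻ w in c i z, h w ≤ l * v i := by
    intro i hi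
    by_cases hi0 : n₀ ≤ i
    · exact not_lt.1 (hfirst i hi0 hi)
    · exact not_lt.1 (hn₀ i (not_le.1 hi0) z)
  have hpar : c n z ⊆ c (n - 1) z := hc.subset_of_le _ _ _ (by linarith)
  obtain ⟨o, hom, ho, hoN⟩ := hosc (n - 1) z z₀ (hpar hz₀c)
  have hho : ∀ w ∈ c (n - 1) z, h w ≤ 2 * l + o w := by
    intro w hw
    refine (ho w hw).trans (add_le_add (mul_le_mul_right ?_ _) le_rfl)
    have h1 := mul_le_mul_right (hbefore (n - 1) (by linarith)) (v (n - 1))⁻¹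
    rwa [mul_left_comm, ENNReal.inv_mul_cancel (hc.ne_zero _) (hc.ne_top _), mul_one] at h1
  -- inside it, cells with large averages of `h` have large averages of `o`
  set p : ℤ → α → Prop := fun j w => c j w ⊆ c n z ∧ l * v j ≤ ∫⁻ y in c j w, o y with hp
  have hcover : c n z ∩ T ⊆ {w | ∃ j ≥ n, p j w} := by
    rintro w ⟨hwc, ⟨j, hj⟩, -⟩
    have hnj : n ≤ j := by
      by_contra hjn
      have hw' : w ∈ c j z := hc.subset_of_le _ _ _ (not_le.1 hjn).le hwc
      rw [hc.eq_of_mem _ _ _ hw'] at hj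
      refine absurd (hj.trans_le (hbefore j (not_le.1 hjn))) (not_lt.2 ?_)
      exact mul_le_mul_left (le_mul_of_one_le_left zero_le (by norm_num)) _
    have hsub' : c j w ⊆ c n z := by
      rw [← hc.eq_of_mem _ _ _ hwc]
      exact hc.subset_of_le _ _ _ hnj
    refine ⟨j, hnj, hsub', ?_⟩
    have h1 : ∫⁻ y in c j w, h y ≤ 2 * l * v j + ∫⁻ y in c j w, o y := by
      calc ∫⁻ y in c j w, h y ≤ ∫⁻ y in c j w, (2 * l + o y) :=
            setLIntegral_mono' (hc.measurableSet j w) fun y hy => hho y (hpar (hsub' hy))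
        _ = _ := by
            rw [lintegral_add_left measurable_const, setLIntegral_const, hc.volume_eq]
    by_contra hlt'
    have hlt'' := not_le.1 hlt'
    have hvj : l * v j ≠ ⊤ := ENNReal.mul_ne_top hlt (hc.ne_top j)
    have h2 : ∫⁻ y in c j w, h y ≤ 4 * l * v j := by
      refine h1.trans ?_
      calc 2 * l * v j + ∫⁻ y in c j w, o y ≤ 2 * l * v j + l * v j := by gcongr
        _ = 3 * (l * v j) := by ring
        _ ≤ 4 * (l * v j) := by gcongr; norm_num
        _ = _ := by ring
    exact absurd hj (not_lt.2 h2)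
  have hweak := hc.measure_le_of_first (μ₁ := l • volume) (μ₂ := volume.withDensity o) (p := p)
    (fun j y w hw hy => by
      simp only [hp]
      rw [hc.eq_of_mem _ _ _ hw]
      exact hy) n (fun j _ y hy _ => by
      rw [withDensity_apply _ (hc.measurableSet j y), Measure.smul_apply, smul_eq_mul,
        hc.volume_eq]
      exact hy.2)
  have hW : {w | ∃ j ≥ n, p j w} ⊆ c n z := fun w ⟨j, _, hj, _⟩ => hj (hc.mem_self j w)
  have hfin : l * volume (c n z ∩ T) ≤ l * ((N * D * δ : ℝ≥0) * v n) := by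
    calc l * volume (c n z ∩ T) ≤ l * volume {w | ∃ j ≥ n, p j w} :=
          mul_le_mul_right (measure_mono hcover) _
      _ ≤ volume.withDensity o {w | ∃ j ≥ n, p j w} := by
          have := hweak.1
          rwa [Measure.smul_apply, smul_eq_mul] at this
      _ ≤ ∫⁻ w in c (n - 1) z, o w := by
          rw [withDensity_apply _ hweak.2]
          exact lintegral_mono_set (hW.trans hpar)
      _ ≤ N * v (n - 1) * m z₀ := hoN
      _ ≤ N * (D * v n) * (δ * l) := mul_le_mul' (mul_le_mul_right (hc.parent_le n) _) hz₀m
      _ = _ := by push_cast; ring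
  exact (ENNReal.mul_le_mul_iff_right hl hlt).1 hfin

lemma le_two_mul_of_le_half_add {a b : ℝ≥0∞} (ha : a ≠ ⊤) (h : a ≤ a / 2 + b) : a ≤ 2 * b := by
  have h2 : a / 2 ≠ ⊤ := ENNReal.div_ne_top ha (by norm_num)
  have h1 : a / 2 + a / 2 ≤ a / 2 + b := by rwa [ENNReal.add_halves]
  have h3 := (ENNReal.add_le_add_iff_left h2).1 h1
  calc a = 2 * (a / 2) := by rw [ENNReal.mul_div_cancel (by norm_num) (by norm_num)]
    _ ≤ 2 * b := mul_le_mul_right h3 _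

/-- A function whose excess over twice its average on every cell is controlled in the mean by `m`
is bounded by `m` in `L_q`. -/
theorem exists_lintegral_rpow_le [OpensMeasurableSpace α] [SigmaFinite (volume : Measure α)]
    [(volume : Measure α).OuterRegular] (hc : CellFamily c v D) {q : ℝ} (hq : 1 < q) (N : ℝ≥0) :
    ∃ N' : ℝ≥0, ∀ h m : α → ℝ≥0∞, Measurable h → Measurable m → ∫⁻ z, h z ≠ ⊤ →
      (∀ n z, ∀ z₀ ∈ c n z, ∃ o : α → ℝ≥0∞, Measurable o ∧
        (∀ w ∈ c n z, h w ≤ 2 * ((v n)⁻¹ * ∫⁻ y in c n z, h y) + o w) ∧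
        ∫⁻ w in c n z, o w ≤ N * v n * m z₀) →
      ∫⁻ z, h z ^ q ≤ N' * ∫⁻ z, m z ^ q := by
  have hq0 : 0 < q := by linarith
  -- `δ` makes the good-`λ` term absorbable
  set δ : ℝ≥0 := (2 * 4 ^ q * (N * D + 1))⁻¹ with hδ
  have hδ0 : 0 < δ := by positivity
  have hδN : (4 : ℝ≥0) ^ q * (N * D * δ) ≤ 1 / 2 := by
    have h4 : (0 : ℝ≥0) < 4 ^ q := by positivity
    rw [hδ, ← mul_assoc, ← div_eq_mul_inv, div_le_div_iff₀ (by positivity) (by norm_num)]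
    generalize (4 : ℝ≥0) ^ q = b
    calc b * (N * D) * 2 ≤ b * (N * D + 1) * 2 := by gcongr; simp
      _ = _ := by ring
  have hδN' : (4 : ℝ≥0∞) ^ q * (N * D * δ : ℝ≥0) ≤ 1 / 2 := by
    have h1 : (((4 : ℝ≥0) ^ q * (N * D * δ) : ℝ≥0) : ℝ≥0∞) ≤ ((1 / 2 : ℝ≥0) : ℝ≥0∞) := by
      exact_mod_cast hδN
    rw [ENNReal.coe_mul, ENNReal.coe_rpow_of_nonneg _ hq0.le] at h1
    simpa using h1
  refine ⟨2 * 4 ^ q * (δ⁻¹) ^ q, fun h m hh hm hfin hosc => ?_⟩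
  set e : ℝ → ℝ≥0∞ := fun l => volume (levelSet c v h (ENNReal.ofReal l)) with he
  have hem : Measurable e := by
    refine Antitone.measurable fun l l' hll => measure_mono ?_
    rintro z ⟨n, hn⟩
    exact ⟨n, lt_of_le_of_lt (mul_le_mul_left (ENNReal.ofReal_le_ofReal hll) _) hn⟩
  set Φ : ℝ → ℝ≥0∞ := fun L => ∫⁻ l in Ioo 0 L, ENNReal.ofReal (q * l ^ (q - 1)) * e l with hΦ
  have hwm : Measurable fun l : ℝ => ENNReal.ofReal (q * l ^ (q - 1)) := by fun_prop
  -- the truncated integral is finite, so that half of it can be subtracted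
  have hΦfin : ∀ L, 0 < L → Φ L ≠ ⊤ := by
    intro L hL
    have h1 : Φ L ≤ ∫⁻ l in Ioo 0 L,
        (ENNReal.ofReal (q / (q - 1)) * ∫⁻ z, h z) *
          ENNReal.ofReal ((q - 1) * l ^ ((q - 1) - 1)) := by
      refine setLIntegral_mono' measurableSet_Ioo fun l hl => ?_
      have hl0 : 0 < l := hl.1
      have h2 := hc.mul_measure_levelSet_le hfin (l := ENNReal.ofReal l)
        (by simpa using hl0) ENNReal.ofReal_ne_top
      have e1 : ENNReal.ofReal (q * l ^ (q - 1)) = ENNReal.ofReal (q / (q - 1)) *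
          ENNReal.ofReal ((q - 1) * l ^ ((q - 1) - 1)) * ENNReal.ofReal l := by
        have hq1 : 0 < q - 1 := by linarith
        rw [← ENNReal.ofReal_mul (by positivity), ← ENNReal.ofReal_mul (by positivity)]
        congr 1
        have : l ^ (q - 1) = l ^ (q - 1 - 1) * l := by
          rw [← Real.rpow_add_one hl0.ne']
          congr 1
          ring
        rw [this]
        field_simp
      rw [e1, mul_assoc, mul_right_comm (ENNReal.ofReal (q / (q - 1)))]
      exact mul_le_mul' (mul_le_mul_right h2 _) le_rfl |>.trans' (le_of_eq (by ring))
    refine ne_top_of_le_ne_top ?_ h1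
    rw [lintegral_const_mul _ (by fun_prop), lintegral_Ioo_rpow_sub_one (by linarith) hL.le]
    exact ENNReal.mul_ne_top (ENNReal.mul_ne_top ENNReal.ofReal_ne_top hfin) ENNReal.ofReal_ne_top
  -- integrate the good-`λ` inequality against `q l^{q-1}` over a bounded range of levels
  have hstep : ∀ L, 0 < L → Φ (4 * L) ≤ Φ (4 * L) / 2 +
      4 ^ q * ((δ⁻¹ : ℝ≥0) ^ q * ∫⁻ z, m z ^ q) := by
    intro L hL
    have e1 : Φ (4 * L) = 4 ^ q *
        ∫⁻ l in Ioo 0 L, ENNReal.ofReal (q * l ^ (q - 1)) * e (4 * l) := by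
      have h1 := lintegral_comp_smul_of_pos (V := ℝ) ((Ioo 0 (4 * L)).indicator fun l =>
        ENNReal.ofReal (q * l ^ (q - 1)) * e l) (c := 4) (by norm_num)
      rw [lintegral_indicator measurableSet_Ioo, Module.finrank_self, Nat.cast_one,
        Real.rpow_neg_one] at h1
      have h2 : Φ (4 * L) = 4 * ∫⁻ l, (Ioo 0 (4 * L)).indicator (fun l =>
          ENNReal.ofReal (q * l ^ (q - 1)) * e l) ((4 : ℝ) • l) := by
        rw [h1, ← mul_assoc, show (4 : ℝ≥0∞) = ENNReal.ofReal 4 by simp,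
          ← ENNReal.ofReal_mul (by norm_num)]
        norm_num [hΦ]
      rw [h2, ← lintegral_const_mul' _ _ (by norm_num), ← lintegral_const_mul' _ _
        (ENNReal.rpow_ne_top_of_nonneg hq0.le (by norm_num)), ← lintegral_indicator measurableSet_Ioo]
      refine lintegral_congr fun l => ?_
      by_cases hl : l ∈ Ioo 0 L
      · have hl' : (4 : ℝ) • l ∈ Ioo 0 (4 * L) := by
          rw [smul_eq_mul]
          exact ⟨by linarith [hl.1], by linarith [hl.2]⟩
        rw [indicator_of_mem hl, indicator_of_mem hl', smul_eq_mul, ← mul_assoc, ← mul_assoc]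
        congr 1
        rw [show (4 : ℝ≥0∞) = ENNReal.ofReal 4 by simp, ENNReal.ofReal_rpow_of_pos (by norm_num),
          ← ENNReal.ofReal_mul (by norm_num), ← ENNReal.ofReal_mul (by positivity)]
        congr 1
        rw [Real.mul_rpow (by norm_num) hl.1.le, Real.rpow_sub_one (by norm_num)]
        ring
      · have hl' : (4 : ℝ) • l ∉ Ioo 0 (4 * L) := by
          rw [smul_eq_mul]
          exact fun h => hl ⟨by linarith [h.1], by linarith [h.2]⟩
        rw [indicator_of_notMem hl, indicator_of_notMem hl', mul_zero]
    have e2 : ∫⁻ l in Ioo 0 L, ENNReal.ofReal (q * l ^ (q - 1)) * e (4 * l) ≤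
        (N * D * δ : ℝ≥0) * Φ L + (δ⁻¹ : ℝ≥0) ^ q * ∫⁻ z, m z ^ q := by
      have e3 : (δ⁻¹ : ℝ≥0) ^ q * ∫⁻ z, m z ^ q = ∫⁻ l in Ioi (0 : ℝ),
          ENNReal.ofReal (q * l ^ (q - 1)) *
            volume {z | ENNReal.ofReal l < ((δ⁻¹ : ℝ≥0) : ℝ≥0∞) * m z} := by
        rw [← lintegral_rpow_eq_lintegral_measure hq0 (hm.const_mul _),
          ← lintegral_const_mul' _ _ (ENNReal.rpow_ne_top_of_nonneg hq0.le ENNReal.coe_ne_top)]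
        refine lintegral_congr fun z => ?_
        rw [ENNReal.mul_rpow_of_nonneg _ _ hq0.le]
      have hwe : Measurable fun l => ENNReal.ofReal (q * l ^ (q - 1)) * e l := hwm.mul hem
      simp only [hΦ]
      rw [e3, ← lintegral_const_mul _ hwe]
      refine le_trans ?_ (add_le_add le_rfl (lintegral_mono_set (Ioo_subset_Ioi_self (a := L))))
      rw [← lintegral_add_left (hwe.const_mul _)]
      refine setLIntegral_mono' measurableSet_Ioo fun l hl => ?_
      have hl0 : ENNReal.ofReal l ≠ 0 := by simpa using hl.1
      have h1 := hc.measure_levelSet_inter_le hm hfin hosc hl0 ENNReal.ofReal_ne_top δ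
      have h2 : e (4 * l) ≤ (N * D * δ : ℝ≥0) * e l +
          volume {z | ENNReal.ofReal l < ((δ⁻¹ : ℝ≥0) : ℝ≥0∞) * m z} := by
        rw [he]
        simp only
        rw [ENNReal.ofReal_mul (by norm_num), ENNReal.ofReal_ofNat]
        refine le_trans (measure_mono (t := (levelSet c v h (4 * ENNReal.ofReal l) ∩
          {z | m z ≤ δ * ENNReal.ofReal l}) ∪
          {z | ENNReal.ofReal l < ((δ⁻¹ : ℝ≥0) : ℝ≥0∞) * m z}) fun z hz => ?_)
          ((measure_union_le _ _).trans (add_le_add h1 le_rfl))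
        by_cases hz' : m z ≤ δ * ENNReal.ofReal l
        · exact Or.inl ⟨hz, hz'⟩
        · refine Or.inr ?_
          rw [mem_ofPred_eq]
          by_contra hcon
          refine hz' ?_
          have h3 := mul_le_mul_right (not_lt.1 hcon) (δ : ℝ≥0∞)
          rwa [← mul_assoc, ← ENNReal.coe_mul, mul_inv_cancel₀ hδ0.ne', ENNReal.coe_one,
            one_mul] at h3
      refine (mul_le_mul_right h2 _).trans (le_of_eq ?_)
      ring
    have e4 : Φ L ≤ Φ (4 * L) := lintegral_mono_set (Ioo_subset_Ioo_right (by linarith))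
    calc Φ (4 * L) ≤ 4 ^ q * ((N * D * δ : ℝ≥0) * Φ L + (δ⁻¹ : ℝ≥0) ^ q * ∫⁻ z, m z ^ q) := by
          conv_lhs => rw [e1]
          exact mul_le_mul_right e2 _
      _ = (4 ^ q * (N * D * δ : ℝ≥0)) * Φ L + 4 ^ q * ((δ⁻¹ : ℝ≥0) ^ q * ∫⁻ z, m z ^ q) := by
          ring
      _ ≤ 1 / 2 * Φ (4 * L) + 4 ^ q * ((δ⁻¹ : ℝ≥0) ^ q * ∫⁻ z, m z ^ q) :=
          add_le_add (mul_le_mul' hδN' e4) le_rfl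
      _ = _ := by rw [one_div, ENNReal.div_eq_inv_mul]
  have hbound : ∀ L, 0 < L → Φ (4 * L) ≤ (2 * 4 ^ q * (δ⁻¹) ^ q : ℝ≥0) * ∫⁻ z, m z ^ q := by
    intro L hL
    refine (le_two_mul_of_le_half_add (hΦfin _ (by positivity)) (hstep L hL)).trans (le_of_eq ?_)
    rw [ENNReal.coe_mul, ENNReal.coe_mul, ENNReal.coe_rpow_of_nonneg _ hq0.le,
      ENNReal.coe_rpow_of_nonneg _ hq0.le]
    push_cast
    ring
  rw [lintegral_rpow_eq_lintegral_measure hq0 hh]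
  have hle : ∫⁻ l in Ioi (0 : ℝ), ENNReal.ofReal (q * l ^ (q - 1)) *
      volume {z | ENNReal.ofReal l < h z} ≤
      ∫⁻ l in Ioi (0 : ℝ), ENNReal.ofReal (q * l ^ (q - 1)) * e l := by
    refine setLIntegral_mono' measurableSet_Ioi fun l hl => mul_le_mul_right ?_ _
    have hl0 : ENNReal.ofReal l ≠ 0 := by simpa using hl
    refine measure_mono_ae ?_
    filter_upwards [hc.ae_le_of_notMem_levelSet hh hfin hl0 ENNReal.ofReal_ne_top] with z hz hlz
    by_contra hcon
    exact absurd hlz (not_lt.2 (hz hcon))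
  refine hle.trans ?_
  have hU : Ioi (0 : ℝ) = ⋃ k : ℕ, Ioo 0 (4 * ((k : ℝ) + 1)) := by
    ext l
    simp only [mem_Ioi, mem_iUnion, mem_Ioo]
    refine ⟨fun hl => ?_, fun ⟨_, h, _⟩ => h⟩
    obtain ⟨k, hk⟩ := exists_nat_gt l
    exact ⟨k, hl, by linarith⟩
  rw [hU, setLIntegral_iUnion_of_directed]
  · exact iSup_le fun k => hbound _ (by positivity)
  · refine Monotone.directed_le fun k k' hkk => Ioo_subset_Ioo_right ?_
    have : (k : ℝ) ≤ k' := by exact_mod_cast hkk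
    linarith

end CellFamily

end GoodLambda

/-! ### Oscillation of the square function -/

section SquareFunction

variable {d : ℕ}

local notation "E" => EuclideanSpace ℝ (Fin d)

variable {𝕜 : Type*} [RCLike 𝕜] {H : Type*} [NormedAddCommGroup H]
    [InnerProductSpace 𝕜 H] [NormedSpace ℝ H]

/-- The square of the square function. -/
noncomputable def squareEnergy (K : ℝ → ℝ → E → 𝕜) (f : ℝ × E → H) (z : ℝ × E) : ℝ≥0∞ :=
  ∫⁻ s, ‖causalConv K f z s‖ₑ ^ 2

lemma squareEnergy_eq_setLIntegral (K : ℝ → ℝ → E → 𝕜) (f : ℝ × E → H) (z : ℝ × E) :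
    squareEnergy K f z =
      ∫⁻ s in Iio z.1, ‖conv (K z.1 s) (fun y => f (s, y)) z.2‖ₑ ^ 2 := by
  rw [squareEnergy, ← lintegral_indicator measurableSet_Iio]
  refine lintegral_congr fun s => ?_
  by_cases hs : s ∈ Iio z.1
  · rw [causalConv, indicator_of_mem hs, indicator_of_mem hs]
  · rw [causalConv, indicator_of_notMem hs, indicator_of_notMem hs]
    simp

lemma squareFunction_eq_rpow (K : ℝ → ℝ → E → 𝕜) (f : ℝ × E → H) (z : ℝ × E) :
    squareFunction K f z = squareEnergy K f z ^ (1 / 2 : ℝ) := by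
  rw [squareEnergy_eq_setLIntegral]
  rfl

lemma measurable_squareEnergy {K : ℝ → ℝ → E → 𝕜}
    (hK : Measurable fun z : ℝ × ℝ × E => K z.1 z.2.1 z.2.2) {f : ℝ × E → H} (hf : Continuous f) :
    Measurable (squareEnergy K f) :=
  ((stronglyMeasurable_causalConv hK hf).enorm.pow_const 2).lintegral_prod_right'

/-- The square function is bounded in `L_2` by the bound on the Fourier transform of the kernel. -/
theorem lintegral_squareEnergy_le {K : ℝ → ℝ → E → 𝕜}
    (hK : Measurable fun z : ℝ × ℝ × E => K z.1 z.2.1 z.2.2) {C₀ : ℝ≥0}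
    (hL2 : ∀ s, ∀ u : E → H, ContDiff ℝ ∞ u → HasCompactSupport u →
      ∫⁻ t in Ioi s, ∫⁻ x, ‖conv (K t s) u x‖ₑ ^ 2 ≤ C₀ * ∫⁻ x, ‖u x‖ₑ ^ 2)
    {f : ℝ × E → H} (hf : ContDiff ℝ ∞ f) (hfc : HasCompactSupport f) :
    ∫⁻ z, squareEnergy K f z ≤ C₀ * ∫⁻ z, ‖f z‖ₑ ^ 2 := by
  have hm : Measurable fun w : (ℝ × E) × ℝ => ‖causalConv K f w.1 w.2‖ₑ ^ 2 :=
    (stronglyMeasurable_causalConv hK hf.continuous).enorm.pow_const 2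
  have hfm : Measurable fun z : ℝ × E => ‖f z‖ₑ ^ 2 := by
    exact hf.continuous.enorm.measurable.pow_const 2
  calc ∫⁻ z, squareEnergy K f z = ∫⁻ s, ∫⁻ z, ‖causalConv K f z s‖ₑ ^ 2 :=
        lintegral_lintegral_swap hm.aemeasurable
    _ = ∫⁻ s, ∫⁻ t, ∫⁻ x, ‖causalConv K f (t, x) s‖ₑ ^ 2 := by
        refine lintegral_congr fun s => ?_
        have h1 : Measurable fun z : ℝ × E => ‖causalConv K f z s‖ₑ ^ 2 :=
          hm.comp (f := fun z => (z, s)) (by fun_prop)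
        rw [Measure.volume_eq_prod, lintegral_prod _ h1.aemeasurable]
    _ = ∫⁻ s, ∫⁻ t in Ioi s, ∫⁻ x, ‖conv (K t s) (fun y => f (s, y)) x‖ₑ ^ 2 := by
        refine lintegral_congr fun s => ?_
        rw [← lintegral_indicator measurableSet_Ioi]
        refine lintegral_congr fun t => ?_
        by_cases ht : s < t
        · rw [indicator_of_mem (mem_Ioi.2 ht)]
          refine lintegral_congr fun x => ?_
          rw [causalConv, indicator_of_mem (mem_Iio.2 ht)]
        · rw [indicator_of_notMem (by simpa using ht)]
          simp [causalConv, ht]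
    _ ≤ ∫⁻ s, C₀ * ∫⁻ x, ‖f (s, x)‖ₑ ^ 2 :=
        lintegral_mono fun s => hL2 s _ (contDiff_slice hf s) (hasCompactSupport_slice hfc s)
    _ = C₀ * ∫⁻ z, ‖f z‖ₑ ^ 2 := by
        rw [lintegral_const_mul' _ _ ENNReal.coe_ne_top, Measure.volume_eq_prod,
          lintegral_prod _ hfm.aemeasurable]

/-- Over a box whose dimensions match the scaling of the kernel, the squared square function
exceeds twice its average by an amount controlled in the mean by the iterated maximal function of
`‖f‖²` at any point of the box. -/
theorem KernelEstimates.exists_oscillation_le {K : ℝ → ℝ → E → 𝕜}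
    (hKm : Measurable fun z : ℝ × ℝ × E => K z.1 z.2.1 z.2.2) {γ A : ℝ} (hγ : 0 < γ) (hA : 0 ≤ A)
    {ν : Fin 3 → ℝ} {N₁ C₀ : ℝ≥0} (hest : KernelEstimates K γ ν A N₁)
    (hL2 : ∀ s, ∀ u : E → H, ContDiff ℝ ∞ u → HasCompactSupport u →
      ∫⁻ t in Ioi s, ∫⁻ x, ‖conv (K t s) u x‖ₑ ^ 2 ≤ C₀ * ∫⁻ x, ‖u x‖ₑ ^ 2) :
    ∃ N : ℝ≥0, ∀ f : ℝ × E → H, ContDiff ℝ ∞ f → HasCompactSupport f → ∀ a R : ℝ, 0 < R →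
      ∀ Q : Set E, MeasurableSet Q → (∀ x ∈ Q, ∀ x' ∈ Q, ‖x - x'‖ ≤ A * R ^ γ) →
      ENNReal.ofReal ((R ^ γ) ^ d) ≤ volume Q → volume Q ≠ ⊤ → ∀ z₀ ∈ Ico a (a + R) ×ˢ Q,
      ∃ o : ℝ × E → ℝ≥0∞, Measurable o ∧
        (∀ w ∈ Ico a (a + R) ×ˢ Q, squareEnergy K f w ≤
          2 * ((volume (Ico a (a + R) ×ˢ Q))⁻¹ * ∫⁻ y in Ico a (a + R) ×ˢ Q, squareEnergy K f y) +
            o w) ∧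
        ∫⁻ w in Ico a (a + R) ×ˢ Q, o w ≤
          N * volume (Ico a (a + R) ×ˢ Q) * mixedMaximal (fun z => ‖f z‖ₑ ^ 2) z₀ := by
  obtain ⟨Nn, hNn⟩ := hest.exists_near_total_le hKm hγ hA hL2
  obtain ⟨Nf, hNf⟩ := hest.exists_far_total_le (H := H) hKm hγ hA
  refine ⟨2 * (Nf + 4 * Nn), fun f hf hfc a R hR Q hQ hdiam hvol hfin z₀ hz₀ => ?_⟩
  have near := hNn f hf hfc a R hR Q hQ hdiam hvol z₀ hz₀
  have far := hNf f hf hfc a R hR Q hQ hdiam z₀ hz₀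
  set P : Set (ℝ × E) := Ico a (a + R) ×ˢ Q with hP
  set M := mixedMaximal (fun z => ‖f z‖ₑ ^ 2) z₀
  have hPvol : volume P = ENNReal.ofReal R * volume Q := by
    rw [hP, Measure.volume_eq_prod, Measure.prod_prod, Real.volume_Ico, add_sub_cancel_left]
  have hP0 : volume P ≠ 0 := by
    rw [hPvol]
    refine mul_ne_zero (by simpa using hR) (ne_of_gt (lt_of_lt_of_le ?_ hvol))
    rw [ENNReal.ofReal_pos]
    positivity
  have hPtop : volume P ≠ ⊤ := by
    rw [hPvol]
    exact ENNReal.mul_ne_top ENNReal.ofReal_ne_top hfin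
  have hsm := stronglyMeasurable_causalConv (H := H) hKm hf.continuous
  have hm1 : Measurable fun w : (ℝ × E) × ℝ => ‖causalConv K f w.1 w.2‖ₑ ^ 2 :=
    hsm.enorm.pow_const 2
  have hm : Measurable fun w : ((ℝ × E) × (ℝ × E)) × ℝ =>
      ‖causalConv K f w.1.1 w.2 - causalConv K f w.1.2 w.2‖ₑ ^ 2 :=
    ((hsm.comp_measurable (g := fun w : ((ℝ × E) × (ℝ × E)) × ℝ => (w.1.1, w.2))
      (by fun_prop)).sub (hsm.comp_measurable
        (g := fun w : ((ℝ × E) × (ℝ × E)) × ℝ => (w.1.2, w.2)) (by fun_prop))).enorm.pow_const 2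
  set W : ℝ × E → ℝ × E → ℝ≥0∞ := fun z z' =>
    ∫⁻ s, ‖causalConv K f z s - causalConv K f z' s‖ₑ ^ 2 with hW
  have hWm : Measurable fun w : (ℝ × E) × (ℝ × E) => W w.1 w.2 := hm.lintegral_prod_right'
  have hWm' : Measurable fun z => ∫⁻ z' in P, W z z' := hWm.lintegral_prod_right'
  have hSm := measurable_squareEnergy hKm hf.continuous
  have hSnear : Measurable fun z : ℝ × E => ∫⁻ s in Ioi (a - R), ‖causalConv K f z s‖ₑ ^ 2 :=
    hm1.lintegral_prod_right'
  -- the oscillation of the square function is dominated by the mean of `W z` over the box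
  refine ⟨fun z => 2 * ((volume P)⁻¹ * ∫⁻ z' in P, W z z'),
    (hWm'.const_mul _).const_mul _, fun z _ => ?_, ?_⟩
  · have h1 : ∀ z', squareEnergy K f z ≤ 2 * squareEnergy K f z' + 2 * W z z' := by
      intro z'
      have h2 : Measurable fun s => 2 * ‖causalConv K f z' s‖ₑ ^ 2 :=
        (hm1.comp (f := fun s => (z', s)) (by fun_prop)).const_mul 2
      rw [squareEnergy, squareEnergy, hW, ← lintegral_const_mul' _ _ (by norm_num),
        ← lintegral_const_mul' _ _ (by norm_num), ← lintegral_add_left h2]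
      refine lintegral_mono fun s => ?_
      have h3 := enorm_add_sq_le (causalConv K f z' s) (causalConv K f z s - causalConv K f z' s)
      rwa [add_sub_cancel] at h3
    have h4 : volume P * squareEnergy K f z ≤
        2 * (∫⁻ z' in P, squareEnergy K f z') + 2 * ∫⁻ z' in P, W z z' := by
      have h5 := lintegral_mono (μ := volume.restrict P) h1
      rwa [lintegral_const, Measure.restrict_apply_univ, lintegral_add_left (hSm.const_mul 2),
        lintegral_const_mul' _ _ (by norm_num), lintegral_const_mul' _ _ (by norm_num),
        mul_comm (squareEnergy K f z)] at h5
    have h6 := mul_le_mul_right h4 (volume P)⁻¹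
    rw [← mul_assoc, ENNReal.inv_mul_cancel hP0 hPtop, one_mul] at h6
    refine h6.trans (le_of_eq ?_)
    ring
  -- for sources with `s ≤ a - R` the increments are used, for later sources only the size
  · have h1 : ∀ z z', W z z' ≤
        (∫⁻ s in Iic (a - R), ‖causalConv K f z s - causalConv K f z' s‖ₑ ^ 2) +
          (2 * (∫⁻ s in Ioi (a - R), ‖causalConv K f z s‖ₑ ^ 2) +
            2 * ∫⁻ s in Ioi (a - R), ‖causalConv K f z' s‖ₑ ^ 2) := by
      intro z z'
      have h2 : Measurable fun s => 2 * ‖causalConv K f z s‖ₑ ^ 2 :=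
        (hm1.comp (f := fun s => (z, s)) (by fun_prop)).const_mul 2
      rw [hW]
      simp only
      rw [← lintegral_add_compl _ (measurableSet_Iic (a := a - R)), compl_Iic]
      refine add_le_add le_rfl ?_
      rw [← lintegral_const_mul' _ _ (by norm_num), ← lintegral_const_mul' _ _ (by norm_num),
        ← lintegral_add_left h2]
      refine lintegral_mono fun s => ?_
      have h3 := enorm_add_sq_le (causalConv K f z s) (-causalConv K f z' s)
      rwa [enorm_neg, ← sub_eq_add_neg] at h3
    set S : ℝ × E → ℝ≥0∞ := fun z => ∫⁻ s in Ioi (a - R), ‖causalConv K f z s‖ₑ ^ 2 with hS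
    have h2 : ∀ z, ∫⁻ z' in P, W z z' ≤
        (∫⁻ z' in P, ∫⁻ s in Iic (a - R), ‖causalConv K f z s - causalConv K f z' s‖ₑ ^ 2) +
          (2 * S z * volume P + 2 * ∫⁻ z' in P, S z') := by
      intro z
      have hc : Measurable fun _ : ℝ × E => 2 * S z := measurable_const
      refine (lintegral_mono (h1 z)).trans (le_of_eq ?_)
      have h3 : Measurable fun z' => 2 * S z + 2 * S z' := hc.add (hSnear.const_mul 2)
      rw [lintegral_add_right _ h3, lintegral_add_left hc, lintegral_const,
        Measure.restrict_apply_univ, lintegral_const_mul' _ _ (by norm_num)]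
    have h3 : ∫⁻ z in P, ∫⁻ z' in P, W z z' ≤ (Nf + 4 * Nn) * volume P ^ 2 * M := by
      have hd : Measurable fun z => 2 * S z * volume P + 2 * ∫⁻ z' in P, S z' :=
        ((hSnear.const_mul 2).mul_const _).add_const _
      have hd' : Measurable fun z => 2 * S z * volume P := (hSnear.const_mul 2).mul_const _
      refine (lintegral_mono h2).trans ?_
      rw [lintegral_add_right _ hd, lintegral_add_left hd', lintegral_const,
        Measure.restrict_apply_univ, lintegral_mul_const' _ _ hPtop,
        lintegral_const_mul' _ _ (by norm_num)]
      calc _ ≤ Nf * volume P ^ 2 * M + (2 * (Nn * volume P * M) * volume P +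
            2 * (Nn * volume P * M) * volume P) := by gcongr
        _ = _ := by ring
    rw [lintegral_const_mul' _ _ (by norm_num),
      lintegral_const_mul' _ _ (ENNReal.inv_ne_top.2 hP0)]
    calc 2 * ((volume P)⁻¹ * ∫⁻ z in P, ∫⁻ z' in P, W z z')
        ≤ 2 * ((volume P)⁻¹ * ((Nf + 4 * Nn) * volume P ^ 2 * M)) := by gcongr
      _ = 2 * (Nf + 4 * Nn) * (((volume P)⁻¹ * volume P) * volume P) * M := by ring
      _ = _ := by
          rw [ENNReal.inv_mul_cancel hP0 hPtop, one_mul]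
          push_cast
          ring

end SquareFunction

/-! ### Anisotropic dyadic boxes -/

section Cells

/-- The index of the dyadic interval of length `2⁻ᵏ` containing `t`. -/
noncomputable def dyadicIndex (k : ℤ) (t : ℝ) : ℤ := ⌊(2 : ℝ) ^ k * t⌋

lemma dyadicIndex_eq_iff {k j : ℤ} {t : ℝ} :
    dyadicIndex k t = j ↔ t ∈ Ico (j * (2 : ℝ) ^ (-k)) (j * (2 : ℝ) ^ (-k) + 2 ^ (-k)) := by
  have h : (0 : ℝ) < 2 ^ k := by positivity
  have e : (2 : ℝ) ^ k * 2 ^ (-k) = 1 := by rw [← zpow_add₀ (by norm_num)]; simp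
  have e' : t = 2 ^ k * t * 2 ^ (-k) := by linear_combination -t * e
  have h' : (0 : ℝ) < 2 ^ (-k) := by positivity
  rw [dyadicIndex, Int.floor_eq_iff, mem_Ico]
  constructor
  · rintro ⟨h1, h2⟩
    rw [e']
    exact ⟨mul_le_mul_of_nonneg_right h1 h'.le, by nlinarith⟩
  · rintro ⟨h1, h2⟩
    constructor
    · have := mul_le_mul_of_nonneg_left h1 h.le
      linear_combination this - j * e
    · have := mul_lt_mul_of_pos_left h2 h
      linear_combination this + (j + 1) * e

lemma measurable_dyadicIndex (k : ℤ) : Measurable (dyadicIndex k) :=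
  Int.measurable_floor.comp (measurable_const_mul _)

lemma abs_sub_le_of_dyadicIndex_eq {k : ℤ} {s t : ℝ} (h : dyadicIndex k s = dyadicIndex k t) :
    |s - t| ≤ 2 ^ (-k) := by
  have h1 := dyadicIndex_eq_iff.1 h
  have h2 := (dyadicIndex_eq_iff (k := k) (t := t)).1 rfl
  rw [abs_le]
  constructor <;> linarith [h1.1, h1.2, h2.1, h2.2]

lemma dyadicIndex_eq_of_le {k k' : ℤ} (hk : k ≤ k') {s t : ℝ}
    (h : dyadicIndex k' s = dyadicIndex k' t) : dyadicIndex k s = dyadicIndex k t := by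
  obtain ⟨j, rfl⟩ := Int.exists_add_of_le hk
  have e : ∀ t : ℝ, dyadicIndex k t = dyadicIndex (k + j) t / ((2 ^ j : ℕ) : ℤ) := by
    intro t
    rw [dyadicIndex, dyadicIndex, ← Int.floor_div_natCast]
    congr 1
    rw [zpow_add₀ (by norm_num)]
    push_cast
    rw [zpow_natCast]
    field_simp
  rw [e, e, h]

variable {d : ℕ}

local notation "E" => EuclideanSpace ℝ (Fin d)

/-- The half-open dyadic cube of side `2⁻ᵏ` containing `x`. -/
def dyadicCube (k : ℤ) (x : E) : Set E :=
  {y | ∀ i, dyadicIndex k (y i) = dyadicIndex k (x i)}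

lemma measurableSet_dyadicCube (k : ℤ) (x : E) : MeasurableSet (dyadicCube k x) := by
  have : dyadicCube k x = ⋂ i, {y | dyadicIndex k (y i) = dyadicIndex k (x i)} := by
    ext y
    simp [dyadicCube]
  rw [this]
  refine MeasurableSet.iInter fun i => ?_
  exact ((measurable_dyadicIndex k).comp (g := dyadicIndex k) (f := fun y : E => y i) (by fun_prop))
    (measurableSet_singleton _)

lemma volume_dyadicCube (k : ℤ) (x : E) :
    volume (dyadicCube k x) = ENNReal.ofReal (2 ^ (-k)) ^ d := by
  have h := PiLp.volume_preserving_ofLp (Fin d)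
  have e : dyadicCube k x = (WithLp.ofLp : E → Fin d → ℝ) ⁻¹' (univ.pi fun i =>
      Ico (dyadicIndex k (x i) * (2 : ℝ) ^ (-k))
        (dyadicIndex k (x i) * (2 : ℝ) ^ (-k) + 2 ^ (-k))) := by
    ext y
    simp only [dyadicCube, mem_ofPred_eq, mem_preimage, mem_pi, mem_univ, true_imp_iff,
      dyadicIndex_eq_iff]
  rw [e, h.measure_preimage (MeasurableSet.univ_pi fun _ => measurableSet_Ico).nullMeasurableSet,
    volume_pi_pi]
  simp

lemma norm_sub_le_of_mem_dyadicCube {k : ℤ} {x y z : E} (hy : y ∈ dyadicCube k x)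
    (hz : z ∈ dyadicCube k x) : ‖y - z‖ ≤ d * 2 ^ (-k) := by
  calc ‖y - z‖ = ‖∑ i, EuclideanSpace.single i ((y - z) i)‖ := by
        congr 1
        ext j
        simp [Finset.sum_apply]
    _ ≤ ∑ i, ‖EuclideanSpace.single i ((y - z) i)‖ := norm_sum_le _ _
    _ ≤ ∑ _i : Fin d, (2 : ℝ) ^ (-k) := by
        refine Finset.sum_le_sum fun i _ => ?_
        rw [PiLp.norm_single, PiLp.sub_apply, Real.norm_eq_abs]
        exact abs_sub_le_of_dyadicIndex_eq ((hy i).trans (hz i).symm)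
    _ = d * 2 ^ (-k) := by simp

/-- With `R = 2⁻ⁿ`, the dyadic side `2^{-⌊γ n⌋}` lies between `R^γ` and `2 R^γ`. -/
lemma two_zpow_neg_floor_bounds (γ : ℝ) (n : ℤ) :
    ((2 : ℝ) ^ (-n)) ^ γ ≤ 2 ^ (-⌊γ * n⌋) ∧ (2 : ℝ) ^ (-⌊γ * n⌋) ≤ 2 * ((2 : ℝ) ^ (-n)) ^ γ := by
  have e : ((2 : ℝ) ^ (-n)) ^ γ = (2 : ℝ) ^ (-(γ * n)) := by
    rw [← Real.rpow_intCast, ← Real.rpow_mul (by norm_num)]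
    congr 1
    push_cast
    ring
  have e2 : (2 : ℝ) * (2 : ℝ) ^ (-(γ * n)) = (2 : ℝ) ^ (1 - γ * n) := by
    rw [sub_eq_add_neg, Real.rpow_add (by norm_num), Real.rpow_one]
  rw [e, e2, ← Real.rpow_intCast]
  push_cast
  constructor
  · exact Real.rpow_le_rpow_of_exponent_le (by norm_num) (by linarith [Int.floor_le (γ * n)])
  · exact Real.rpow_le_rpow_of_exponent_le (by norm_num)
      (by linarith [Int.lt_floor_add_one (γ * n)])

/-- The anisotropic dyadic box of level `n`: its time length is `R = 2⁻ⁿ` and its sides in space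
are comparable with `R^γ`. -/
def dyadicBox (γ : ℝ) (n : ℤ) (z : ℝ × E) : Set (ℝ × E) :=
  {w | dyadicIndex n w.1 = dyadicIndex n z.1} ∩ {w | w.2 ∈ dyadicCube ⌊γ * n⌋ z.2}

lemma dyadicBox_eq_prod (γ : ℝ) (n : ℤ) (z : ℝ × E) :
    dyadicBox γ n z = Ico (dyadicIndex n z.1 * (2 : ℝ) ^ (-n))
      (dyadicIndex n z.1 * (2 : ℝ) ^ (-n) + 2 ^ (-n)) ×ˢ dyadicCube ⌊γ * n⌋ z.2 := by
  ext w
  simp only [dyadicBox, mem_inter_iff, mem_ofPred_eq, mem_prod, dyadicIndex_eq_iff]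

/-- The volume of a box of level `n`. -/
noncomputable def boxVolume (d : ℕ) (γ : ℝ) (n : ℤ) : ℝ≥0∞ :=
  ENNReal.ofReal (2 ^ (-n)) * ENNReal.ofReal (2 ^ (-⌊γ * n⌋)) ^ d

lemma volume_dyadicBox (γ : ℝ) (n : ℤ) (z : ℝ × E) :
    volume (dyadicBox γ n z) = boxVolume d γ n := by
  rw [dyadicBox_eq_prod, Measure.volume_eq_prod, Measure.prod_prod, Real.volume_Ico,
    volume_dyadicCube, add_sub_cancel_left, boxVolume]

/-- The floor in the exponent `⌊γ n⌋` costs a factor `2` in each side, which together with the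
scaling accounts for the constant relating a box to its parent. -/
theorem cellFamily_dyadicBox {γ : ℝ} (hγ : 0 < γ) :
    CellFamily (dyadicBox (d := d) γ) (boxVolume d γ) (2 * (2 * Real.toNNReal (2 ^ γ)) ^ d) where
  mem_self n z := ⟨rfl, fun _ => rfl⟩
  eq_of_mem n z w hw := by
    obtain ⟨h1, h2⟩ := hw
    simp only [mem_ofPred_eq, dyadicCube] at h1 h2
    simp only [dyadicBox, dyadicCube, h1, h2]
  measurableSet n z := by
    rw [dyadicBox_eq_prod]
    exact measurableSet_Ico.prod (measurableSet_dyadicCube _ _)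
  subset_of_le n n' z hn w hw := by
    refine ⟨dyadicIndex_eq_of_le hn hw.1, fun i => dyadicIndex_eq_of_le ?_ (hw.2 i)⟩
    refine Int.floor_le_floor (mul_le_mul_of_nonneg_left ?_ hγ.le)
    exact_mod_cast hn
  countable n := by
    -- a box is determined by the integer indices of its point
    have : range (dyadicBox (d := d) γ n) ⊆ range fun b : ℤ × (Fin d → ℤ) =>
        {w : ℝ × E | dyadicIndex n w.1 = b.1} ∩
          {w | ∀ i, dyadicIndex ⌊γ * n⌋ (w.2 i) = b.2 i} := by
      rintro _ ⟨z, rfl⟩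
      exact ⟨(dyadicIndex n z.1, fun i => dyadicIndex ⌊γ * n⌋ (z.2 i)), rfl⟩
    exact (countable_range _).mono this
  volume_eq := volume_dyadicBox γ
  ne_zero n := by
    refine mul_ne_zero ?_ (pow_ne_zero _ ?_)
    · rw [ENNReal.ofReal_ne_zero_iff]
      positivity
    · rw [ENNReal.ofReal_ne_zero_iff]
      positivity
  ne_top n := ENNReal.mul_ne_top ENNReal.ofReal_ne_top (ENNReal.pow_ne_top ENNReal.ofReal_ne_top)
  parent_le n := by
    have e1 : (2 : ℝ) ^ (-(n - 1)) = 2 * 2 ^ (-n) := by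
      rw [neg_sub, sub_eq_add_neg, zpow_add₀ (by norm_num), zpow_one]
    have h1 := (two_zpow_neg_floor_bounds γ (n - 1)).2
    have h2 := (two_zpow_neg_floor_bounds γ n).1
    have h3 : (2 : ℝ) ^ (-⌊γ * (n - 1 : ℤ)⌋) ≤ (2 * 2 ^ γ) * 2 ^ (-⌊γ * n⌋) := by
      refine h1.trans ?_
      rw [e1, Real.mul_rpow (by norm_num) (by positivity), mul_assoc]
      gcongr
    have e4 : ENNReal.ofReal (2 * 2 ^ γ) = 2 * ((2 ^ γ : ℝ).toNNReal : ℝ≥0∞) := by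
      rw [ENNReal.ofReal_mul (by norm_num), ENNReal.ofReal_ofNat]
      rfl
    calc boxVolume d γ (n - 1) ≤ ENNReal.ofReal (2 * 2 ^ (-n)) *
          ENNReal.ofReal ((2 * 2 ^ γ) * 2 ^ (-⌊γ * n⌋)) ^ d := by
          rw [boxVolume, e1]
          gcongr
      _ = _ := by
          rw [ENNReal.ofReal_mul (by norm_num), ENNReal.ofReal_mul (by positivity), e4, mul_pow,
            ENNReal.ofReal_ofNat, boxVolume]
          push_cast
          ring
  large C hC := by
    obtain ⟨k, hk⟩ := ENNReal.exists_nat_gt hC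
    refine ⟨-k, fun n hn => hk.le.trans ?_⟩
    have hfl : ⌊γ * n⌋ ≤ 0 := by
      refine Int.floor_nonpos (mul_nonpos_of_nonneg_of_nonpos hγ.le ?_)
      have : n ≤ 0 := by omega
      exact_mod_cast this
    have h1 : (1 : ℝ≥0∞) ≤ ENNReal.ofReal (2 ^ (-⌊γ * n⌋)) ^ d := by
      refine one_le_pow₀ ?_
      rw [ENNReal.one_le_ofReal]
      exact one_le_zpow₀ (by norm_num) (by omega)
    have h2 : (k : ℝ) ≤ 2 ^ (-n) := by
      have h3 : (k : ℝ) ≤ 2 ^ k := by exact_mod_cast Nat.lt_two_pow_self.le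
      refine h3.trans ?_
      rw [← zpow_natCast]
      exact zpow_le_zpow_right₀ (by norm_num) (by omega)
    calc (k : ℝ≥0∞) = ENNReal.ofReal k := by simp
      _ ≤ ENNReal.ofReal (2 ^ (-n)) * 1 := by
          rw [mul_one]
          exact ENNReal.ofReal_le_ofReal h2
      _ ≤ _ := mul_le_mul_right h1 _
  small U hU z hz := by
    obtain ⟨ε, hε, hball⟩ := Metric.isOpen_iff.1 hU z hz
    -- the boxes shrink to their point
    have ht : Filter.Tendsto (fun n : ℕ => (2 : ℝ) ^ (-(n : ℤ))) Filter.atTop (nhds 0) := by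
      have := tendsto_pow_atTop_nhds_zero_of_lt_one (r := (1 / 2 : ℝ)) (by norm_num) (by norm_num)
      refine this.congr fun n => ?_
      rw [zpow_neg, zpow_natCast, one_div, inv_pow]
    have ht' : Filter.Tendsto (fun n : ℕ => d * (2 * ((2 : ℝ) ^ (-(n : ℤ))) ^ γ))
        Filter.atTop (nhds 0) := by
      have := ((ht.rpow_const (Or.inr hγ.le)).const_mul 2).const_mul (d : ℝ)
      rwa [Real.zero_rpow hγ.ne', mul_zero, mul_zero] at this
    obtain ⟨n, hn1, hn2⟩ := ((ht.eventually_lt_const hε).and (ht'.eventually_lt_const hε)).exists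
    refine ⟨n, by positivity, fun w hw => hball ?_⟩
    rw [Metric.mem_ball, Prod.dist_eq, max_lt_iff]
    constructor
    · rw [Real.dist_eq]
      exact (abs_sub_le_of_dyadicIndex_eq hw.1).trans_lt hn1
    · rw [dist_eq_norm]
      have h1 := norm_sub_le_of_mem_dyadicCube hw.2
        (show z.2 ∈ dyadicCube ⌊γ * (n : ℤ)⌋ z.2 from fun _ => rfl)
      refine (h1.trans ?_).trans_lt hn2
      exact mul_le_mul_of_nonneg_left (two_zpow_neg_floor_bounds γ n).2 (by positivity)

end Cells

/-! ### Boundedness in `L_p` -/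

section Boundedness

variable {d : ℕ}

local notation "E" => EuclideanSpace ℝ (Fin d)

variable {𝕜 : Type*} [RCLike 𝕜] {H : Type*} [NormedAddCommGroup H]
    [InnerProductSpace 𝕜 H] [NormedSpace ℝ H]

lemma measurable_slice_maximalFunction {g : ℝ × E → ℝ≥0∞} (hg : Measurable g) :
    Measurable fun w : E × ℝ => maximalFunction (fun y => g (w.2, y)) w.1 := by
  have h := measurable_maximalFunction_prod hg
  exact h.comp (f := fun w : E × ℝ => (w.2, w.1)) (by fun_prop)

lemma measurable_mixedMaximal {g : ℝ × E → ℝ≥0∞} (hg : Measurable g) :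
    Measurable (mixedMaximal g) := by
  have h := measurable_maximalFunction_prod (measurable_slice_maximalFunction hg)
  exact h.comp (f := fun w : ℝ × E => (w.2, w.1)) (by fun_prop)

/-- The iterated maximal function is bounded in `L_q`, one variable at a time. -/
lemma exists_lintegral_mixedMaximal_rpow_le {q : ℝ} (hq : 1 < q) :
    ∃ N : ℝ≥0, ∀ g : ℝ × E → ℝ≥0∞, Measurable g →
      ∫⁻ z, mixedMaximal g z ^ q ≤ N * ∫⁻ z, g z ^ q := by
  obtain ⟨N₁, hN₁⟩ : ∃ N : ℝ≥0, (N : ℝ≥0∞) = maximalConst (Module.finrank ℝ ℝ) q :=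
    ⟨_, ENNReal.coe_toNNReal (maximalConst_ne_top _ hq)⟩
  obtain ⟨N₂, hN₂⟩ : ∃ N : ℝ≥0, (N : ℝ≥0∞) = maximalConst (Module.finrank ℝ E) q :=
    ⟨_, ENNReal.coe_toNNReal (maximalConst_ne_top _ hq)⟩
  refine ⟨N₁ * N₂, fun g hg => ?_⟩
  have hm : Measurable fun z => mixedMaximal g z ^ q := (measurable_mixedMaximal hg).pow_const q
  have hs := measurable_slice_maximalFunction hg
  have hs' : Measurable fun w : E × ℝ => maximalFunction (fun y => g (w.2, y)) w.1 ^ q :=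
    hs.pow_const q
  have hgq : Measurable fun z => g z ^ q := hg.pow_const q
  calc ∫⁻ z, mixedMaximal g z ^ q = ∫⁻ x, ∫⁻ t, mixedMaximal g (t, x) ^ q := by
        rw [Measure.volume_eq_prod, lintegral_prod_symm _ hm.aemeasurable]
    _ ≤ ∫⁻ x, N₁ * ∫⁻ s, maximalFunction (fun y => g (s, y)) x ^ q := by
        refine lintegral_mono fun x => ?_
        rw [hN₁]
        have hx : Measurable fun s => maximalFunction (fun y => g (s, y)) x :=
          hs.comp (f := fun s => (x, s)) (by fun_prop)
        exact lintegral_maximalFunction_rpow_le hq hx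
    _ = N₁ * ∫⁻ s, ∫⁻ x, maximalFunction (fun y => g (s, y)) x ^ q := by
        rw [lintegral_const_mul' _ _ ENNReal.coe_ne_top,
          lintegral_lintegral_swap hs'.aemeasurable]
    _ ≤ N₁ * ∫⁻ s, N₂ * ∫⁻ y, g (s, y) ^ q := by
        refine mul_le_mul_right (lintegral_mono fun s => ?_) _
        rw [hN₂]
        have hy : Measurable fun y => g (s, y) := hg.comp measurable_prodMk_left
        exact lintegral_maximalFunction_rpow_le hq hy
    _ = _ := by
        rw [lintegral_const_mul' _ _ ENNReal.coe_ne_top, Measure.volume_eq_prod,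
          lintegral_prod _ hgq.aemeasurable, ENNReal.coe_mul, mul_assoc]

/-- The `L_p` bound for the square function, from its `L_2` bound and the estimates of the
increments of the kernel. The exponent `p = 2` is the `L_2` bound; for larger exponents the
oscillation over anisotropic dyadic boxes controls the square function. -/
theorem KernelEstimates.exists_lintegral_squareEnergy_rpow_le {K : ℝ → ℝ → E → 𝕜}
    (hKm : Measurable fun z : ℝ × ℝ × E => K z.1 z.2.1 z.2.2) {γ : ℝ} (hγ : 0 < γ)
    {ν : Fin 3 → ℝ} {N₁ C₀ : ℝ≥0} (hest : KernelEstimates K γ ν (2 * d) N₁)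
    (hL2 : ∀ s, ∀ u : E → H, ContDiff ℝ ∞ u → HasCompactSupport u →
      ∫⁻ t in Ioi s, ∫⁻ x, ‖conv (K t s) u x‖ₑ ^ 2 ≤ C₀ * ∫⁻ x, ‖u x‖ₑ ^ 2)
    {q : ℝ} (hq : 1 ≤ q) :
    ∃ N : ℝ≥0, ∀ f : ℝ × E → H, ContDiff ℝ ∞ f → HasCompactSupport f →
      ∫⁻ z, squareEnergy K f z ^ q ≤ N * ∫⁻ z, (‖f z‖ₑ ^ 2) ^ q := by
  rcases hq.eq_or_lt with rfl | hq
  · refine ⟨C₀, fun f hf hfc => ?_⟩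
    simp only [ENNReal.rpow_one]
    exact lintegral_squareEnergy_le hKm hL2 hf hfc
  obtain ⟨N, hN⟩ := hest.exists_oscillation_le hKm hγ (by positivity) hL2
  -- boxes of level `n` have time length `R = 2⁻ⁿ` and diameter in space at most `2 d R^γ`
  obtain ⟨N', hN'⟩ := (cellFamily_dyadicBox (d := d) hγ).exists_lintegral_rpow_le hq N
  obtain ⟨N'', hN''⟩ := exists_lintegral_mixedMaximal_rpow_le (d := d) hq
  refine ⟨N' * N'', fun f hf hfc => ?_⟩
  have hfm : Measurable fun z : ℝ × E => ‖f z‖ₑ ^ 2 := hf.continuous.enorm.measurable.pow_const 2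
  have hfin : ∫⁻ z, ‖f z‖ₑ ^ 2 ≠ ⊤ := by
    have h1 : MemLp f 2 volume := hf.continuous.memLp_of_hasCompactSupport hfc
    have h2 := lintegral_rpow_enorm_lt_top_of_eLpNorm_lt_top (by norm_num) (by norm_num) h1.2
    simpa using h2.ne
  rw [ENNReal.coe_mul, mul_assoc]
  refine (hN' (squareEnergy K f) (mixedMaximal fun z => ‖f z‖ₑ ^ 2)
    (measurable_squareEnergy hKm hf.continuous) (measurable_mixedMaximal hfm)
    (ne_top_of_le_ne_top (ENNReal.mul_ne_top ENNReal.coe_ne_top hfin)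
      (lintegral_squareEnergy_le hKm hL2 hf hfc)) fun n z z₀ hz₀ => ?_).trans
    (mul_le_mul_right (hN'' _ hfm) _)
  have hb := two_zpow_neg_floor_bounds γ n
  have hv := volume_dyadicBox γ n z
  rw [dyadicBox_eq_prod] at hv hz₀ ⊢
  rw [← hv]
  refine hN f hf hfc _ _ (by positivity) _ (measurableSet_dyadicCube _ _) (fun x hx x' hx' => ?_)
    ?_ ?_ z₀ hz₀
  · refine (norm_sub_le_of_mem_dyadicCube hx hx').trans ?_
    calc (d : ℝ) * 2 ^ (-⌊γ * n⌋) ≤ d * (2 * ((2 : ℝ) ^ (-n)) ^ γ) := by gcongr; exact hb.2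
      _ = _ := by ring
  · rw [volume_dyadicCube, ENNReal.ofReal_pow (by positivity)]
    gcongr
    exact hb.1
  · rw [volume_dyadicCube]
    exact ENNReal.pow_ne_top ENNReal.ofReal_ne_top

end Boundedness

end LittlewoodPaley

theorem mainTheorem1 {𝕜 : Type*} [RCLike 𝕜] {d : ℕ} (hd : 1 ≤ d)
    {H : Type*} [NormedAddCommGroup H] [InnerProductSpace 𝕜 H] [CompleteSpace H]
    [NormedSpace ℝ H] [IsScalarTower ℝ 𝕜 H]
    (K : ℝ → ℝ → EuclideanSpace ℝ (Fin d) → 𝕜) (p : ℝ) (hp : 2 ≤ p)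
    (c₂ : ℝ) (hc₂ : 1 / 2 < c₂)
    (hK₁ : LittlewoodPaley.FourierBound K) (hK₂ : LittlewoodPaley.ScalingBounds K c₂) :
    ∃ N : ℝ≥0, ∀ f : ℝ × EuclideanSpace ℝ (Fin d) → H,
      ContDiff ℝ ∞ f → HasCompactSupport f →
        AEMeasurable (LittlewoodPaley.squareFunction K f) volume ∧
        eLpNorm (LittlewoodPaley.squareFunction K f) (ENNReal.ofReal p) volume ≤
          N * eLpNorm f (ENNReal.ofReal p) volume := by
  -- space increments are needed up to the diameter `2 d R^γ` of a box
  obtain ⟨γ, ν, N₁, hγ, hest⟩ := hK₂.exists_kernelEstimates hd hc₂ hK₁ (A := 2 * d) (by positivity)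
  obtain ⟨hKm, Khat, C₀, hKhat, hFT, hC₀⟩ := hK₁
  have hL2 : ∀ s, ∀ u : EuclideanSpace ℝ (Fin d) → H, ContDiff ℝ ∞ u → HasCompactSupport u →
      ∫⁻ t in Ioi s, ∫⁻ x, ‖LittlewoodPaley.conv (K t s) u x‖ₑ ^ 2 ≤
        C₀ * ∫⁻ x, ‖u x‖ₑ ^ 2 := fun s u hu huc =>
    LittlewoodPaley.lintegral_convolution_le (K := fun t => K t s) (Khat := fun t => Khat t s)
      (hKm.comp (f := fun w : ℝ × EuclideanSpace ℝ (Fin d) => (w.1, s, w.2)) (by fun_prop))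
      (hKhat.comp (f := fun w : ℝ × EuclideanSpace ℝ (Fin d) => (w.1, s, w.2)) (by fun_prop))
      (hFT s) (hC₀ s) hu huc
  have hp0 : 0 < p := by linarith
  -- the `L_p` norm of the square function is the `L_{p/2}` norm of its square
  obtain ⟨N, hN⟩ := hest.exists_lintegral_squareEnergy_rpow_le hKm hγ hL2 (q := p / 2)
    (by linarith)
  refine ⟨N ^ (1 / p), fun f hf hfc => ⟨?_, ?_⟩⟩
  · have h := (LittlewoodPaley.measurable_squareEnergy hKm hf.continuous).pow_const (1 / 2 : ℝ)
    rw [show LittlewoodPaley.squareFunction K f = fun z =>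
      LittlewoodPaley.squareEnergy K f z ^ (1 / 2 : ℝ) from
        funext fun z => LittlewoodPaley.squareFunction_eq_rpow K f z]
    exact h.aemeasurable
  · have hne : ENNReal.ofReal p ≠ 0 := by simpa using hp0
    rw [eLpNorm_eq_lintegral_rpow_enorm_toReal hne ENNReal.ofReal_ne_top,
      eLpNorm_eq_lintegral_rpow_enorm_toReal hne ENNReal.ofReal_ne_top,
      ENNReal.toReal_ofReal hp0.le, ENNReal.coe_rpow_of_nonneg _ (by positivity),
      ← ENNReal.mul_rpow_of_nonneg _ _ (by positivity)]
    refine ENNReal.rpow_le_rpow ?_ (by positivity)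
    have e1 : ∀ z, ‖LittlewoodPaley.squareFunction K f z‖ₑ ^ p =
        LittlewoodPaley.squareEnergy K f z ^ (p / 2) := by
      intro z
      rw [LittlewoodPaley.squareFunction_eq_rpow, enorm_eq_self, ← ENNReal.rpow_mul]
      congr 1
      ring
    have e2 : ∀ z, (‖f z‖ₑ ^ 2) ^ (p / 2) = ‖f z‖ₑ ^ p := by
      intro z
      rw [← ENNReal.rpow_natCast, ← ENNReal.rpow_mul]
      congr 1
      push_cast
      ring
    have h := hN f hf hfc
    simp only [e2] at h
    simpa only [e1] using h
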